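/- Let $N_1,N_2\ge 1$ and let $R=(R^{\lambda\alpha}_{\beta\mu})$ be complex numbers ($1\le\lambda,\mu\le N_1$, $1\le\alpha,\beta\le N_2$). Repeated indices of $R$ are summed. Call $R$ admissible if it satisfies - reality: $\bar R^{\lambda\alpha}_{\beta\mu}R^{\mu\beta}_{\gamma\nu}=\delta^\lambda_\nu\delta^\alpha_\gamma$; - the Yang–Baxter equations: $R^{\lambda\alpha}_{\gamma\rho}R^{\rho\beta}_{\delta\mu}=R^{\lambda\beta}_{\delta\rho}R^{\rho\alpha}_{\gamma\mu}$, its complex conjugate, and $\bar R^{\lambda\alpha}_{\gamma\rho}R^{\rho\beta}_{\delta\mu}=R^{\lambda\beta}_{\delta\rho}\bar R^{\rho\alpha}_{\gamma\mu}$; and $R^{\lambda\alpha}_{\gamma\nu}R^{\mu\gamma}_{\beta\rho}=R^{\mu\alpha}_{\gamma\rho}R^{\lambda\gamma}_{\beta\nu}$, its complex conjugate, and $R^{\lambda\alpha}_{\gamma\nu}\bar R^{\mu\gamma}_{\beta\rho}=\bar R^{\mu\alpha}_{\gamma\rho}R^{\lambda\gamma}_{\beta\nu}$; - the Euclidean conditions: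 $\sum_\lambda R^{\lambda\gamma}_{\beta\nu}R^{\lambda\beta}_{\alpha\mu}=\delta^\gamma_\alpha\delta_{\mu\nu}$ and $\sum_\alpha R^{\lambda\alpha}_{\beta\rho}R^{\rho\alpha}_{\gamma\mu}=\delta^\lambda_\mu\delta_{\beta\gamma}$. Let $\mathcal A_R$ be the unital complex $*$-algebra generated by hermitian elements $x_1^\lambda,x_2^\alpha$ with relations $$x_1^\lambda x_1^\mu=x_1^\mu x_1^\lambda,\quad x_2^\alpha x_2^\beta=x_2^\beta x_2^\alpha,\quad x_1^\lambda x_2^\alpha=R^{\lambda\alpha}_{\beta\mu}x_2^\beta x_1^\mu,\quad x_2^\alpha x_1^\lambda=\bar R^{\lambda\alpha}_{\beta\mu}x_1^\mu x_2^\beta,$$ and put $(x,x)=\sum_\lambda (x_1^\lambda)^2+\sum_\alpha (x_2^\alpha)^2$. For a unital complex $*$-algebra $A$ let $\bar A=A/\mathbb C1$. For $e,U\in M_q(A)$ with $e=e^*=e^2$ and $U$ unitary, define $$ch_k(e)=\sum (e-\tfrac12)^{i_0}_{i_1}\otimes \bar e^{\,i_1}_{i_2}\otimes\cdots\otimes \bar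 e^{\,i_{2k}}_{i_0}\in A\otimes\bar A^{\otimes 2k},$$ $$ch_{k+\frac12}(U)=\sum U^{i_0}_{i_1}\otimes (\bar U^{*})^{i_1}_{i_2}\otimes\cdots\otimes(\bar U^{*})^{i_{2k+1}}_{i_0}-\sum (U^{*})^{i_0}_{i_1}\otimes \bar U^{i_1}_{i_2}\otimes\cdots\otimes\bar U^{i_{2k+1}}_{i_0}\in A\otimes\bar A^{\otimes(2k+1)},$$ where the bar denotes classes in $\bar A$. These are regarded as chains of the normalized Hochschild complex of $A$. $A$ is the algebra of a noncommutative spherical manifold of dimension $d$ if either $d=2m$ and for some $q$ there is a self-adjoint idempotent $e\in M_q(A)$ whose entries generate $A$ as a $*$-algebra, such that $ch_k(e)=0$ for all $k<m$ and $ch_m(e)$ is a nonzero Hochschild cycle; or $d=2m+1$ and for some $q$ there is a unitary $U\in M_q(A)$ whose entries generate $A$ as a $*$-algebra, such that $ch_{k+1/2}(U)=0$ for all $k<m$ and $ch_{m+1/2}(U)$ is a nonzero Hochschild cycle. Claim. For every admissible $R$: 1. $(x,x)$ is central in $\mathcal A_R$; 2. the $*$-algebra $\mathcal A_R/((x,x)-1)$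 of the sphere $S_R^{N_1+N_2-1}$ is the algebra of a noncommutative spherical manifold of dimension $N_1+N_2-1$; 3. if $R$ lies in the connected component, in the set of admissible matrices, of the classical solution $(R_0)^{\lambda\alpha}_{\beta\mu}=\delta^\lambda_\mu\delta^\alpha_\beta$, then $e$ (respectively $U$) in 2 can be chosen so that moreover the Hochschild homology class of the cycle $ch_{(N_1+N_2-1)/2}$ is nonzero. -/

import Mathlib

open scoped TensorProduct

noncomputable section

namespace NCSphere

section Hochschild

variable (A : Type*) [Ring A] [Algebra ℂ A]

/-- Merging of the adjacent entries `i` and `i + 1` of a tuple. -/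
def merge {A : Type*} [Ring A] {l : ℕ} (i : Fin (l + 1)) (a : Fin (l + 2) → A) : Fin (l + 1) → A :=
  fun k => if k < i then a k.castSucc else if k = i then a k.castSucc * a k.succ else a k.succ

theorem merge_update {A : Type*} [Ring A] {l : ℕ} (i : Fin (l + 1)) (a : Fin (l + 2) → A)
    (m : Fin (l + 2)) (x : A) :
    merge i (Function.update a m x) = Function.update (merge i a) (i.predAbove m)
      (if m = i.castSucc then x * a i.succ else if m = i.succ then a i.castSucc * x else x) := by
  funext k
  rcases le_or_gt m i.castSucc with h | h
  · obtain ⟨t, rfl⟩ := Fin.exists_castSucc_eq.mpr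
      (ne_of_lt (lt_of_le_of_lt h (Fin.castSucc_lt_last i)))
    rw [Fin.predAbove_castSucc_of_le _ _ (Fin.castSucc_le_castSucc_iff.mp h)]
    simp only [merge, Function.update_apply, Fin.ext_iff, Fin.lt_def, Fin.val_castSucc,
      Fin.val_succ, Fin.le_def] at *
    rcases lt_trichotomy k.val i.val with h1 | h1 | h1
    · grind
    · obtain rfl : k = i := Fin.ext h1
      grind
    · grind
  · obtain ⟨t, rfl⟩ := Fin.exists_succ_eq.mpr (Fin.ne_zero_of_lt h)
    have h' : i ≤ t := Fin.castSucc_lt_succ_iff.mp h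
    rw [Fin.predAbove_succ_of_le _ _ h']
    simp only [merge, Function.update_apply, Fin.ext_iff, Fin.lt_def, Fin.val_castSucc,
      Fin.val_succ, Fin.le_def] at *
    rcases lt_trichotomy k.val i.val with h1 | h1 | h1
    · grind
    · obtain rfl : k = i := Fin.ext h1
      grind
    · grind

/-- The multilinear map `(a₀, …, aₗ₊₁) ↦ a₀ ⊗ ⋯ ⊗ aᵢ aᵢ₊₁ ⊗ ⋯ ⊗ aₗ₊₁`. -/
def face (l : ℕ) (i : Fin (l + 1)) :
    MultilinearMap ℂ (fun _ : Fin (l + 2) => A) (⨂[ℂ] _ : Fin (l + 1), A) where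
  toFun a := PiTensorProduct.tprod ℂ (merge i a)
  map_update_add' {inst} a m x y := by
    obtain rfl : inst = instDecidableEqFin _ := Subsingleton.elim _ _
    simp only [merge_update]
    rw [← MultilinearMap.map_update_add]
    congr 2
    split_ifs <;> simp [add_mul, mul_add]
  map_update_smul' {inst} a m c x := by
    obtain rfl : inst = instDecidableEqFin _ := Subsingleton.elim _ _
    simp only [merge_update]
    rw [← MultilinearMap.map_update_smul]
    congr 2
    split_ifs <;> simp

/-- The multilinear map `(a₀, …, aₗ₊₁) ↦ aₗ₊₁ a₀ ⊗ a₁ ⊗ ⋯ ⊗ aₗ`. -/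
def lastFace (l : ℕ) :
    MultilinearMap ℂ (fun _ : Fin (l + 2) => A) (⨂[ℂ] _ : Fin (l + 1), A) :=
  (face A l 0).domDomCongr (finRotate (l + 2)).symm

/-- The Hochschild boundary on unnormalized chains:
`b(a₀ ⊗ ⋯ ⊗ aₗ₊₁) = ∑ᵢ (-1)ⁱ a₀ ⊗ ⋯ ⊗ aᵢ aᵢ₊₁ ⊗ ⋯ + (-1)ˡ⁺¹ aₗ₊₁ a₀ ⊗ a₁ ⊗ ⋯ ⊗ aₗ`. -/
def bFull (l : ℕ) : (⨂[ℂ] _ : Fin (l + 2), A) →ₗ[ℂ] (⨂[ℂ] _ : Fin (l + 1), A) :=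
  PiTensorProduct.lift
    (∑ i : Fin (l + 1), (-1 : ℂ) ^ (i : ℕ) • face A l i + (-1 : ℂ) ^ (l + 1) • lastFace A l)

/-- Degenerate chains: those spanned by `a₀ ⊗ ⋯ ⊗ aₗ` with `aⱼ = 1` for some `j ≥ 1`. -/
def degenerate (l : ℕ) : Submodule ℂ (⨂[ℂ] _ : Fin (l + 1), A) :=
  Submodule.span ℂ {c | ∃ (a : Fin (l + 1) → A) (j : Fin (l + 1)), j ≠ 0 ∧ a j = 1 ∧
    c = PiTensorProduct.tprod ℂ a}

theorem face_apply (l : ℕ) (i : Fin (l + 1)) (a : Fin (l + 2) → A) :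
    face A l i a = PiTensorProduct.tprod ℂ (merge i a) := rfl

theorem lastFace_apply (l : ℕ) (a : Fin (l + 2) → A) :
    lastFace A l a = PiTensorProduct.tprod ℂ
      (fun k : Fin (l + 1) => if k = 0 then a (Fin.last _) * a 0 else a k.castSucc) := by
  show PiTensorProduct.tprod ℂ (merge 0 (fun i => a ((finRotate (l + 2)).symm i))) = _
  have h1 : ∀ k : Fin (l + 1), (finRotate (l + 2)).symm k.succ = k.castSucc := by
    intro k
    rw [Equiv.symm_apply_eq, finRotate_apply]
    ext; simp
  have h0 : (finRotate (l + 2)).symm 0 = Fin.last _ := by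
    rw [Equiv.symm_apply_eq, finRotate_last]
  congr 1
  funext k
  by_cases hk : k = 0
  · subst hk
    simp only [merge, lt_irrefl, if_true, if_false, Fin.castSucc_zero, h0, h1]
  · simp [merge, hk, h1]

theorem face_mem {l : ℕ} (i : Fin (l + 1)) (a : Fin (l + 2) → A) (j : Fin (l + 2))
    (hj : j ≠ 0) (h1 : a j = 1) (hi : j ≠ i.castSucc) (hi' : j ≠ i.succ) :
    face A l i a ∈ degenerate A l := by
  refine Submodule.subset_span ⟨merge i a, i.predAbove j, ?_, ?_, rfl⟩
  · rcases le_or_gt j i.castSucc with h | h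
    · obtain ⟨t, rfl⟩ := Fin.exists_castSucc_eq.mpr
        (ne_of_lt (lt_of_le_of_lt h (Fin.castSucc_lt_last i)))
      rw [Fin.predAbove_castSucc_of_le _ _ (Fin.castSucc_le_castSucc_iff.mp h)]
      rintro rfl
      exact hj rfl
    · obtain ⟨t, rfl⟩ := Fin.exists_succ_eq.mpr (Fin.ne_zero_of_lt h)
      rw [Fin.predAbove_succ_of_le _ _ (Fin.castSucc_lt_succ_iff.mp h)]
      rintro rfl
      have : i = 0 := Fin.le_zero_iff.mp (Fin.castSucc_lt_succ_iff.mp h)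
      exact hi' (by rw [this])
  · have := congrFun (merge_update i a j (a j)) (i.predAbove j)
    rw [Function.update_eq_self, Function.update_self, if_neg hi, if_neg hi'] at this
    rw [this, h1]

theorem bFull_degenerate (l : ℕ) : degenerate A (l + 1) ≤ (degenerate A l).comap (bFull A l) := by
  refine Submodule.span_le.mpr ?_
  rintro _ ⟨a, j, hj, h1, rfl⟩
  obtain ⟨p, rfl⟩ := Fin.exists_succ_eq.mpr hj
  simp only [SetLike.mem_coe, Submodule.mem_comap, bFull, PiTensorProduct.lift.tprod,
    add_apply, sum_apply, smul_apply]
  by_cases hp : p = Fin.last l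
  · subst hp
    have e : face A l (Fin.last l) a = lastFace A l a := by
      rw [face_apply, lastFace_apply]
      congr 1
      funext k
      rw [Fin.succ_last] at h1
      rcases eq_or_ne k (Fin.last l) with rfl | hk
      · rcases eq_or_ne (Fin.last l) 0 with h0 | h0
        · obtain rfl : l = 0 := by simpa [Fin.ext_iff] using h0
          have h2 : a 1 = 1 := h1
          simp [merge, h2]
        · simp [merge, h0, h1]
      · have hk' : k < Fin.last l := lt_of_le_of_ne (Fin.le_last k) hk
        rcases eq_or_ne k 0 with rfl | h0
        · simp [merge, hk', h1]
        · simp [merge, hk', h0]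
    rw [Fin.sum_univ_castSucc, add_assoc, e, Fin.val_last, ← add_smul, pow_succ]
    simp only [mul_neg, mul_one, add_neg_cancel, zero_smul, add_zero]
    refine Submodule.sum_mem _ fun i _ => Submodule.smul_mem _ _ (face_mem A _ a _ hj h1 ?_ ?_)
    · simp only [ne_eq, Fin.ext_iff, Fin.val_succ, Fin.val_last, Fin.val_castSucc]; omega
    · simp only [ne_eq, Fin.ext_iff, Fin.val_succ, Fin.val_last, Fin.val_castSucc]; omega
  · obtain ⟨q, hq⟩ : ∃ q : Fin (l + 1), q.val = p.val + 1 := by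
      refine ⟨⟨p.val + 1, ?_⟩, rfl⟩
      have := Fin.val_lt_last hp
      omega
    have e : face A l p a = face A l q a := by
      rw [face_apply, face_apply]
      congr 1
      have hps : p.succ = q.castSucc := by ext; simp [hq]
      funext k
      have hk : k < q ↔ k ≤ p := by rw [Fin.lt_def, Fin.le_def]; omega
      rcases lt_trichotomy k p with h | rfl | h
      · simp [merge, h, hk, h.le]
      · simp [merge, hk, h1]
      · rcases eq_or_ne k q with rfl | hkq
        · simp [merge, h.not_gt, h.ne', ← hps, h1]
        · simp [merge, h.not_gt, h.ne', hk, h.not_ge, hkq]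
    have hpq : p ≠ q := by
      rintro rfl
      omega
    refine Submodule.add_mem _ ?_ (Submodule.smul_mem _ _ ?_)
    · rw [← Finset.add_sum_erase _ _ (Finset.mem_univ p),
        ← Finset.add_sum_erase _ _ (Finset.mem_erase.mpr ⟨hpq.symm, Finset.mem_univ q⟩),
        ← add_assoc, e, ← add_smul, hq, pow_succ]
      simp only [mul_neg, mul_one, add_neg_cancel, zero_smul, zero_add]
      refine Submodule.sum_mem _ fun i hi => Submodule.smul_mem _ _ (face_mem A _ a _ hj h1 ?_ ?_)
      · simp only [Finset.mem_erase] at hi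
        intro h
        apply hi.1
        ext
        have := congrArg Fin.val h
        simp at this
        omega
      · simp only [Finset.mem_erase] at hi
        intro h
        exact hi.2.1 (Fin.succ_injective _ h).symm
    · rw [lastFace_apply]
      refine Submodule.subset_span ⟨_, q, ?_, ?_, rfl⟩
      · intro h
        rw [h] at hq
        simp at hq
      · have hq0 : q ≠ 0 := by
          intro h
          rw [h] at hq
          simp at hq
        have hps : q.castSucc = p.succ := by ext; simp [hq]
        simp [hq0, hps, h1]

/-- Normalized Hochschild `l`-chains, i.e. `A ⊗ (A / ℂ 1)^{⊗ l}`. -/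
abbrev Chain (l : ℕ) : Type _ := (⨂[ℂ] _ : Fin (l + 1), A) ⧸ degenerate A l

/-- The Hochschild boundary of the normalized Hochschild complex. -/
def b (l : ℕ) : Chain A (l + 1) →ₗ[ℂ] Chain A l :=
  Submodule.mapQ _ _ (bFull A l) (bFull_degenerate A l)

/-- A normalized Hochschild `l`-chain is a cycle when its Hochschild boundary vanishes. -/
def IsCycle : (l : ℕ) → Chain A l → Prop
  | 0, _ => True
  | l + 1, c => b A l c = 0

/-- The normalized Hochschild chain `∑ (M₀)^{i₀}_{i₁} ⊗ (M₁)^{i₁}_{i₂} ⊗ ⋯ ⊗ (Mₗ)^{iₗ}_{i₀}`. -/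
def trChain {A : Type*} [Ring A] [Algebra ℂ A] {q l : ℕ}
    (M : Fin (l + 1) → Matrix (Fin q) (Fin q) A) : Chain A l :=
  Submodule.Quotient.mk
    (∑ i : Fin (l + 1) → Fin q, PiTensorProduct.tprod ℂ fun j => M j (i j) (i (j + 1)))

/-- The component `ch_k(e) ∈ A ⊗ (A / ℂ 1)^{⊗ 2k}` of the Chern character of an idempotent. -/
def chEven {A : Type*} [Ring A] [Algebra ℂ A] {q : ℕ} (k : ℕ) (e : Matrix (Fin q) (Fin q) A) :
    Chain A (2 * k) :=
  trChain fun j => if j = 0 then e - (1 / 2 : ℂ) • 1 else e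

/-- The component `ch_{k + 1/2}(U) ∈ A ⊗ (A / ℂ 1)^{⊗ (2k + 1)}` of the Chern character of a
unitary. -/
def chOdd {A : Type*} [Ring A] [Algebra ℂ A] [StarRing A] {q : ℕ} (k : ℕ)
    (U : Matrix (Fin q) (Fin q) A) : Chain A (2 * k + 1) :=
  trChain (fun j => if Even j.val then U else star U) -
    trChain (fun j => if Even j.val then star U else U)

end Hochschild

section Spherical

variable (A : Type*) [Ring A] [StarRing A] [Algebra ℂ A] [StarModule ℂ A]

/-- Data of an even-dimensional noncommutative spherical manifold of dimension `2m`: a self-adjoint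
idempotent matrix whose entries generate `A`, with `ch_k(e) = 0` for `k < m`, and such that
`ch_m(e)` is a nonzero Hochschild cycle. -/
structure IsSphericalProjection {q : ℕ} (m : ℕ) (e : Matrix (Fin q) (Fin q) A) : Prop where
  idempotent : e * e = e
  selfAdjoint : star e = e
  generates : StarAlgebra.adjoin ℂ {a : A | ∃ i j, a = e i j} = ⊤
  vanishing : ∀ k < m, chEven k e = 0
  cycle : IsCycle A (2 * m) (chEven m e)
  nonzero : chEven m e ≠ 0

/-- Data of an odd-dimensional noncommutative spherical manifold of dimension `2m + 1`: a unitary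
matrix whose entries generate `A`, with `ch_{k + 1/2}(U) = 0` for `k < m`, and such that
`ch_{m + 1/2}(U)` is a nonzero Hochschild cycle. -/
structure IsSphericalUnitary {q : ℕ} (m : ℕ) (U : Matrix (Fin q) (Fin q) A) : Prop where
  star_mul_self : star U * U = 1
  mul_star_self : U * star U = 1
  generates : StarAlgebra.adjoin ℂ {a : A | ∃ i j, a = U i j} = ⊤
  vanishing : ∀ k < m, chOdd k U = 0
  cycle : IsCycle A (2 * m + 1) (chOdd m U)
  nonzero : chOdd m U ≠ 0

/-- `A` is the `*`-algebra of a noncommutative spherical manifold of dimension `d`. -/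
def IsSphericalManifold (d : ℕ) : Prop :=
  (∃ (m q : ℕ) (e : Matrix (Fin q) (Fin q) A), d = 2 * m ∧ IsSphericalProjection A m e) ∨
  (∃ (m q : ℕ) (U : Matrix (Fin q) (Fin q) A), d = 2 * m + 1 ∧ IsSphericalUnitary A m U)

/-- `A` is the `*`-algebra of a noncommutative spherical manifold of dimension `d` whose volume form
`ch_{d/2}` is not a Hochschild boundary, i.e. has a nonzero class in Hochschild homology. -/
def IsSphericalManifoldWithVolumeClass (d : ℕ) : Prop :=
  (∃ (m q : ℕ) (e : Matrix (Fin q) (Fin q) A), d = 2 * m ∧ IsSphericalProjection A m e ∧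
    chEven m e ∉ LinearMap.range (b A (2 * m))) ∨
  (∃ (m q : ℕ) (U : Matrix (Fin q) (Fin q) A), d = 2 * m + 1 ∧ IsSphericalUnitary A m U ∧
    chOdd m U ∉ LinearMap.range (b A (2 * m + 1)))

end Spherical

section FreeStarAlgebra

/-- The free unital complex algebra on `X`; below it carries the conjugate-linear `*`-structure
for which the generators are hermitian. -/
def FreeStar (X : Type*) : Type _ := FreeAlgebra ℂ X

namespace FreeStar

variable {X : Type*}

instance : Ring (FreeStar X) := inferInstanceAs (Ring (FreeAlgebra ℂ X))

instance : Algebra ℂ (FreeStar X) := inferInstanceAs (Algebra ℂ (FreeAlgebra ℂ X))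

/-- The generators. -/
def gen (x : X) : FreeStar X := FreeAlgebra.ι ℂ x

/-- A copy of the free algebra, with opposite product and conjugate scalar multiplication. -/
def ConjOp (X : Type*) : Type _ := (FreeStar X)ᵐᵒᵖ

instance : Ring (ConjOp X) := inferInstanceAs (Ring (FreeStar X)ᵐᵒᵖ)

instance : Algebra ℂ (ConjOp X) :=
  RingHom.toAlgebra' ((algebraMap ℂ (FreeStar X)ᵐᵒᵖ).comp (starRingEnd ℂ))
    (fun c x => Algebra.commutes (A := (FreeStar X)ᵐᵒᵖ) (starRingEnd ℂ c) x)

/-- The antiautomorphism fixing the generators and conjugating the scalars. -/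
def conjHom : FreeStar X →ₐ[ℂ] ConjOp X :=
  FreeAlgebra.lift ℂ (fun x => (MulOpposite.op (gen x) : (FreeStar X)ᵐᵒᵖ))

/-- The star operation. -/
def conjStar (a : FreeStar X) : FreeStar X :=
  MulOpposite.unop (α := FreeStar X) (conjHom a)

theorem conjStar_gen (x : X) : conjStar (gen x) = gen x := by
  have : conjHom (gen x) = (MulOpposite.op (gen x) : (FreeStar X)ᵐᵒᵖ) :=
    FreeAlgebra.lift_ι_apply _ _
  unfold conjStar
  rw [this]
  rfl

theorem conjStar_algebraMap (c : ℂ) :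
    conjStar (algebraMap ℂ (FreeStar X) c) = algebraMap ℂ (FreeStar X) (starRingEnd ℂ c) := by
  unfold conjStar
  rw [AlgHom.commutes]
  rfl

theorem conjStar_mul (a c : FreeStar X) : conjStar (a * c) = conjStar c * conjStar a := by
  unfold conjStar
  rw [map_mul]
  rfl

theorem conjStar_add (a c : FreeStar X) : conjStar (a + c) = conjStar a + conjStar c := by
  unfold conjStar
  rw [map_add]
  rfl

theorem conjStar_conjStar (a : FreeStar X) : conjStar (conjStar a) = a := by
  refine FreeAlgebra.induction (R := ℂ) (X := X)
    (motive := fun a => conjStar (X := X) (conjStar a) = a) ?_ ?_ ?_ ?_ a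
  · intro c
    have h := conjStar_algebraMap (X := X)
    exact ((congrArg conjStar (h c)).trans (h _)).trans (by simp; rfl)
  · intro x
    exact (congrArg conjStar (conjStar_gen x)).trans (conjStar_gen x)
  · intro a c ha hc
    exact ((congrArg conjStar (conjStar_mul a c)).trans (conjStar_mul _ _)).trans (by rw [ha, hc]; rfl)
  · intro a c ha hc
    exact ((congrArg conjStar (conjStar_add a c)).trans (conjStar_add _ _)).trans (by rw [ha, hc]; rfl)

instance : StarRing (FreeStar X) where
  star := conjStar
  star_involutive := conjStar_conjStar
  star_mul := conjStar_mul
  star_add := conjStar_add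

theorem star_gen (x : X) : star (gen x) = gen x := conjStar_gen x

instance : StarModule ℂ (FreeStar X) where
  star_smul c a := by
    rw [Algebra.smul_def, star_mul, Algebra.smul_def, Algebra.commutes]
    exact congrArg (star a * ·) (conjStar_algebraMap c)

end FreeStar

end FreeStarAlgebra

section StarQuotient

variable {B : Type*} [Ring B] [StarRing B]

/-- The star operation on the quotient of a `*`-ring by a `*`-invariant relation. -/
def quotStarHom (r : B → B → Prop) (hr : ∀ a c, r a c → r (star a) (star c)) :
    RingQuot r →+* (RingQuot r)ᵐᵒᵖ :=
  RingQuot.lift ⟨(RingHom.op (RingQuot.mkRingHom r)).comp (starRingEquiv (R := B) : B →+* Bᵐᵒᵖ),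
    fun _ _ h => congrArg MulOpposite.op (RingQuot.mkRingHom_rel (hr _ _ h))⟩

theorem quotStarHom_mk (r : B → B → Prop) (hr : ∀ a c, r a c → r (star a) (star c)) (a : B) :
    quotStarHom r hr (RingQuot.mkRingHom r a) = MulOpposite.op (RingQuot.mkRingHom r (star a)) :=
  RingQuot.lift_mkRingHom_apply _ _ _

/-- The quotient of a `*`-ring by a `*`-invariant relation is a `*`-ring. -/
abbrev quotStarRing (r : B → B → Prop) (hr : ∀ a c, r a c → r (star a) (star c)) :
    StarRing (RingQuot r) where
  star x := (quotStarHom r hr x).unop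
  star_involutive x := by
    obtain ⟨a, rfl⟩ := RingQuot.mkRingHom_surjective r x
    simp only [quotStarHom_mk, MulOpposite.unop_op, star_star]
  star_mul x y := by simp only [map_mul, MulOpposite.unop_mul]
  star_add x y := by simp only [map_add, MulOpposite.unop_add]

/-- Conjugate linearity passes to the quotient. -/
theorem quotStarModule [Algebra ℂ B] [StarModule ℂ B] (r : B → B → Prop)
    (hr : ∀ a c, r a c → r (star a) (star c)) :
    @StarModule ℂ (RingQuot r) _ (quotStarRing r hr).toStar _ := by
  let _ := quotStarRing r hr
  refine ⟨fun c x => ?_⟩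
  obtain ⟨a, rfl⟩ := RingQuot.mkAlgHom_surjective ℂ r x
  have key : ∀ a : B, star (RingQuot.mkAlgHom ℂ r a) = RingQuot.mkAlgHom ℂ r (star a) := by
    intro a
    have h := quotStarHom_mk r hr a
    rw [← RingQuot.mkAlgHom_coe ℂ r] at h
    exact congrArg MulOpposite.unop h
  rw [← map_smul, key, key, star_smul, map_smul]

end StarQuotient

section Algebras

variable {N₁ N₂ : ℕ}

/-- The matrices `R`: the value `R l a b m` is the entry `R^{λα}_{βμ}` with
`(λ, α, β, μ) = (l, a, b, m)`. -/
abbrev RMatrix (N₁ N₂ : ℕ) : Type := Fin N₁ → Fin N₂ → Fin N₂ → Fin N₁ → ℂ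

/-- The classical matrix `R₀`. -/
def classicalR (N₁ N₂ : ℕ) : RMatrix N₁ N₂ :=
  fun l a b m => if l = m ∧ a = b then 1 else 0

/-- The conditions on `R` defining a noncommutative product of the Euclidean spaces `ℝ^{N₁}` and
`ℝ^{N₂}`: reality, the Yang-Baxter equations, and centrality of the two quadratic elements. -/
structure Admissible (R : RMatrix N₁ N₂) : Prop where
  real : ∀ l a c n, ∑ b, ∑ m, star (R l a b m) * R m b c n = if l = n ∧ a = c then 1 else 0
  yb₁ : ∀ l a b c d m, ∑ r, R l a c r * R r b d m = ∑ r, R l b d r * R r a c m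
  yb₁' : ∀ l a b c d m, ∑ r, star (R l a c r) * star (R r b d m) =
    ∑ r, star (R l b d r) * star (R r a c m)
  yb₁'' : ∀ l a b c d m, ∑ r, star (R l a c r) * R r b d m = ∑ r, R l b d r * star (R r a c m)
  yb₂ : ∀ l m a b n r, ∑ c, R l a c n * R m c b r = ∑ c, R m a c r * R l c b n
  yb₂' : ∀ l m a b n r, ∑ c, star (R l a c n) * star (R m c b r) =
    ∑ c, star (R m a c r) * star (R l c b n)
  yb₂'' : ∀ l m a b n r, ∑ c, R l a c n * star (R m c b r) = ∑ c, star (R m a c r) * R l c b n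
  central₁ : ∀ c n a m, ∑ l, ∑ b, R l c b n * R l b a m = if c = a ∧ m = n then 1 else 0
  central₂ : ∀ l b c m, ∑ a, ∑ r, R l a b r * R r a c m = if l = m ∧ b = c then 1 else 0

/-- The free `*`-algebra on the hermitian coordinates of `ℝ^{N₁}` and `ℝ^{N₂}`. -/
abbrev Free (N₁ N₂ : ℕ) : Type := FreeStar (Fin N₁ ⊕ Fin N₂)

/-- The free coordinates of `ℝ^{N₁}`. -/
def f₁ (l : Fin N₁) : Free N₁ N₂ := FreeStar.gen (Sum.inl l)

/-- The free coordinates of `ℝ^{N₂}`. -/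
def f₂ (a : Fin N₂) : Free N₁ N₂ := FreeStar.gen (Sum.inr a)

/-- The defining relations of `A_R`. -/
inductive Rel (R : RMatrix N₁ N₂) : Free N₁ N₂ → Free N₁ N₂ → Prop
  | comm₁ (l m : Fin N₁) : Rel R (f₁ l * f₁ m) (f₁ m * f₁ l)
  | comm₂ (a b : Fin N₂) : Rel R (f₂ a * f₂ b) (f₂ b * f₂ a)
  | mixed (l : Fin N₁) (a : Fin N₂) :
      Rel R (f₁ l * f₂ a) (∑ b, ∑ m, R l a b m • (f₂ b * f₁ m))
  | mixed' (l : Fin N₁) (a : Fin N₂) :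
      Rel R (f₂ a * f₁ l) (∑ b, ∑ m, star (R l a b m) • (f₁ m * f₂ b))

theorem Rel.star_rel (R : RMatrix N₁ N₂) (u v : Free N₁ N₂) (h : Rel R u v) :
    Rel R (star u) (star v) := by
  have h₁ : ∀ l : Fin N₁, star (f₁ l : Free N₁ N₂) = f₁ l := fun l => FreeStar.star_gen _
  have h₂ : ∀ a : Fin N₂, star (f₂ a : Free N₁ N₂) = f₂ a := fun a => FreeStar.star_gen _
  cases h with
  | comm₁ l m => simpa only [star_mul, h₁] using Rel.comm₁ m l
  | comm₂ a b => simpa only [star_mul, h₂] using Rel.comm₂ b a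
  | mixed l a => simpa only [star_mul, star_sum, star_smul, h₁, h₂] using Rel.mixed' l a
  | mixed' l a =>
    simpa only [star_mul, star_sum, star_smul, h₁, h₂, star_star] using Rel.mixed l a

/-- The quadratic `*`-algebra `A_R`. -/
def AlgR (R : RMatrix N₁ N₂) : Type := RingQuot (Rel R)

instance (R : RMatrix N₁ N₂) : Ring (AlgR R) := inferInstanceAs (Ring (RingQuot (Rel R)))

instance (R : RMatrix N₁ N₂) : Algebra ℂ (AlgR R) :=
  inferInstanceAs (Algebra ℂ (RingQuot (Rel R)))

instance (R : RMatrix N₁ N₂) : StarRing (AlgR R) := quotStarRing (Rel R) (Rel.star_rel R)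

instance (R : RMatrix N₁ N₂) : StarModule ℂ (AlgR R) := quotStarModule (Rel R) (Rel.star_rel R)

/-- The coordinates `x₁^λ` in `A_R`. -/
def x₁ (R : RMatrix N₁ N₂) (l : Fin N₁) : AlgR R := RingQuot.mkRingHom (Rel R) (f₁ l)

/-- The coordinates `x₂^α` in `A_R`. -/
def x₂ (R : RMatrix N₁ N₂) (a : Fin N₂) : AlgR R := RingQuot.mkRingHom (Rel R) (f₂ a)

theorem star_x₁ (R : RMatrix N₁ N₂) (l : Fin N₁) : star (x₁ R l) = x₁ R l := by
  have h := quotStarHom_mk (Rel R) (Rel.star_rel R) (f₁ l)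
  rw [show star (f₁ l : Free N₁ N₂) = f₁ l from FreeStar.star_gen _] at h
  exact congrArg MulOpposite.unop h

theorem star_x₂ (R : RMatrix N₁ N₂) (a : Fin N₂) : star (x₂ R a) = x₂ R a := by
  have h := quotStarHom_mk (Rel R) (Rel.star_rel R) (f₂ a)
  rw [show star (f₂ a : Free N₁ N₂) = f₂ a from FreeStar.star_gen _] at h
  exact congrArg MulOpposite.unop h

/-- The quadratic element `(x, x)`. -/
def normSq (R : RMatrix N₁ N₂) : AlgR R := ∑ l, x₁ R l ^ 2 + ∑ a, x₂ R a ^ 2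

theorem star_normSq (R : RMatrix N₁ N₂) : star (normSq R) = normSq R := by
  simp only [normSq, star_add, star_sum, star_pow, star_x₁, star_x₂]

/-- The relation `(x, x) = 1`. -/
inductive SphereRel (R : RMatrix N₁ N₂) : AlgR R → AlgR R → Prop
  | unit : SphereRel R (normSq R) 1

theorem SphereRel.star_rel (R : RMatrix N₁ N₂) (u v : AlgR R) (h : SphereRel R u v) :
    SphereRel R (star u) (star v) := by
  cases h
  simpa only [star_normSq, star_one] using SphereRel.unit

/-- The `*`-algebra `A_R / ((x, x) - 1)` of the noncommutative sphere `S_R^{N₁ + N₂ - 1}`. -/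
def Sphere (R : RMatrix N₁ N₂) : Type := RingQuot (SphereRel R)

instance (R : RMatrix N₁ N₂) : Ring (Sphere R) := inferInstanceAs (Ring (RingQuot (SphereRel R)))

instance (R : RMatrix N₁ N₂) : Algebra ℂ (Sphere R) :=
  inferInstanceAs (Algebra ℂ (RingQuot (SphereRel R)))

instance (R : RMatrix N₁ N₂) : StarRing (Sphere R) :=
  quotStarRing (SphereRel R) (SphereRel.star_rel R)

instance (R : RMatrix N₁ N₂) : StarModule ℂ (Sphere R) :=
  quotStarModule (SphereRel R) (SphereRel.star_rel R)

end Algebras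

end NCSphere

end

set_option linter.unusedSectionVars false
set_option linter.unusedSimpArgs false

noncomputable section

namespace NCSphere

/-! ### Chains obtained from cyclic products of matrices. -/

section TraceChains

variable {A : Type*} [Ring A] [Algebra ℂ A]

/-! Centrality is a computation: pushing $x_1^\lambda$ through $\sum_\alpha (x_2^\alpha)^2$ produces
exactly the contraction in the second Euclidean condition, and symmetrically for the other factor.

For the spheres, three facts make the Chern characters flexible. The sequences $(ch_k)_k$ of all
projections, or of all unitaries, form a group (`evenReal`, `oddReal`): block sums add them, while
$1-e$ and $U^*$ negate them. Blocks of total character zero can carry entries that generate the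
algebra. Finally $b\,ch$ in one degree is determined by $ch$ in the preceding one (`b_chEven`,
`b_trAlt`), so the cycle condition follows from the vanishing. It is therefore enough to find a
member of the group that vanishes below $m$ and not at $m$ (`exists_sphericalProjection`,
`exists_sphericalUnitary`).

For arbitrary admissible $R$ with $N_1+N_2\ge 3$, take the projections onto the columns $(\alpha
x,\beta)$ with $\alpha^2+\beta^2=1$. Up to a diagonal conjugation, invisible to the trace, they are
affine in $\alpha^2$, so $ch_k$ is polynomial of degree at most $2k+1$ in $\alpha^2$. An integer
finite difference of order $2m+1$ kills $ch_k$ for $k<m$ and leaves a multiple of the leading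
coefficient of $ch_m$, which is detected by characters of the sphere at three points
(`exists_even_of_detects`). The odd case passes from $p$ to the unitary $\frac35+\frac45 i(2p-1)$
(`exists_odd_of_detects`). For $N_1=N_2=1$ only $R=\pm1$ occur: $+1$ is classical, and for $-1$ the
element $x_1+x_2$ is an involution.

On the classical component a geometric cycle is needed. Admissibility makes the blocks of $R$
commuting Hermitian matrices, so $R=(u\otimes v)^*\,\mathrm{diag}(t_{ij})\,(u\otimes v)$ with phases
$t_{ij}$ (`exists_diagonalizes`). The products $\prod_i t_{ij}$ and $\prod_j t_{ij}$ are $\pm1$, and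
connectedness to $R_0$ makes them all $1$ (`det_eq_one_of_mem_connectedComponentIn`). On a fermionic
Fock space the Clifford generators, multiplied by second quantized phases, give a self-adjoint
unitary $F$ linear in the coordinates (`Fock.dirac_sq`, `Fock.star_dirac`). The determinant
conditions let the chirality operator commute with the phases, so the classical trace identities
kill the lower characters built from $F$ (`Fock.exists_even`, `Fock.exists_odd`).

The top character is not a boundary because it pairs nontrivially with a Hochschild cocycle
$\mathrm{tr}(c\,\rho(a_0)\delta(a_1)\cdots\delta(a_n))$, where $\rho$ and $\delta$ are the twisted
value and first derivative at a coordinate point (`Fock.exists_derivation`, `derCocycle_b`). The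
phases of chain and cocycle are inverse to each other, and the pairing becomes a product of two
nonzero forms of top degree (`Fock.derCocycle_topChain_ne_zero`). -/

/-- The class in the normalized complex of an elementary tensor, as a multilinear map. -/
def chainMk (A : Type*) [Ring A] [Algebra ℂ A] (l : ℕ) :
    MultilinearMap ℂ (fun _ : Fin (l + 1) => A) (Chain A l) :=
  (degenerate A l).mkQ.compMultilinearMap (PiTensorProduct.tprod ℂ)

theorem chainMk_eq_zero {l : ℕ} (a : Fin (l + 1) → A) (j : Fin (l + 1)) (hj : j ≠ 0) (c : ℂ)
    (ha : a j = algebraMap ℂ A c) : chainMk A l a = 0 := by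
  have h : a = Function.update a j (c • 1) := by
    rw [← Algebra.algebraMap_eq_smul_one, ← ha, Function.update_eq_self]
  rw [h, MultilinearMap.map_update_smul]
  have : chainMk A l (Function.update a j 1) = 0 :=
    (Submodule.Quotient.mk_eq_zero _).mpr
      (Submodule.subset_span ⟨Function.update a j 1, j, hj, by simp, rfl⟩)
  rw [this, smul_zero]

variable {ι κ : Type*} [Fintype ι] [Fintype κ]

/-- The trace chain over an arbitrary finite index type, as a multilinear map in the matrices. -/
def trM (A : Type*) [Ring A] [Algebra ℂ A] (ι : Type*) [Fintype ι] (l : ℕ) :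
    MultilinearMap ℂ (fun _ : Fin (l + 1) => Matrix ι ι A) (Chain A l) :=
  ∑ i : Fin (l + 1) → ι,
    (chainMk A l).compLinearMap (fun j => Matrix.entryLinearMap ℂ A (i j) (i (j + 1)))

theorem trM_apply {l : ℕ} (M : Fin (l + 1) → Matrix ι ι A) :
    trM A ι l M = ∑ i : Fin (l + 1) → ι, chainMk A l (fun j => M j (i j) (i (j + 1))) := by
  simp [trM]

theorem trChain_eq {q l : ℕ} (M : Fin (l + 1) → Matrix (Fin q) (Fin q) A) :
    trChain M = trM A (Fin q) l M := by
  rw [trM_apply, trChain, ← Submodule.mkQ_apply, map_sum]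
  rfl

theorem degenerate_le_ker {V : Type*} [AddCommGroup V] [Module ℂ V] {l : ℕ}
    (f : MultilinearMap ℂ (fun _ : Fin (l + 1) => A) V)
    (hf : ∀ a j, j ≠ 0 → a j = 1 → f a = 0) :
    degenerate A l ≤ LinearMap.ker (PiTensorProduct.lift f) := by
  refine Submodule.span_le.mpr ?_
  rintro _ ⟨a, j, hj, h1, rfl⟩
  simpa using hf a j hj h1

/-- A linear map on normalized chains, from a multilinear map vanishing on degenerate tuples. -/
def chainLift {V : Type*} [AddCommGroup V] [Module ℂ V] {l : ℕ}
    (f : MultilinearMap ℂ (fun _ : Fin (l + 1) => A) V)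
    (hf : ∀ a j, j ≠ 0 → a j = 1 → f a = 0) : Chain A l →ₗ[ℂ] V :=
  (degenerate A l).liftQ (PiTensorProduct.lift f) (degenerate_le_ker f hf)

theorem chainLift_chainMk {V : Type*} [AddCommGroup V] [Module ℂ V] {l : ℕ}
    (f : MultilinearMap ℂ (fun _ : Fin (l + 1) => A) V)
    (hf : ∀ a j, j ≠ 0 → a j = 1 → f a = 0) (a : Fin (l + 1) → A) :
    chainLift f hf (chainMk A l a) = f a :=
  (Submodule.liftQ_apply _ _ _).trans (PiTensorProduct.lift.tprod _)

theorem trM_reindex {l : ℕ} (e : κ ≃ ι) (M : Fin (l + 1) → Matrix ι ι A) :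
    trM A κ l (fun j => (M j).submatrix e e) = trM A ι l M := by
  simp only [trM_apply, Matrix.submatrix_apply]
  exact Fintype.sum_equiv (Equiv.arrowCongr (Equiv.refl (Fin (l + 1))) e)
    _ _ (fun i => by simp [Equiv.arrowCongr])

theorem trM_const [DecidableEq ι] {l : ℕ} (M : Fin (l + 1) → Matrix ι ι A) (j : Fin (l + 1))
    (hj : j ≠ 0) (C : Matrix ι ι ℂ) (hM : M j = C.map (algebraMap ℂ A)) : trM A ι l M = 0 := by
  rw [trM_apply]
  exact Finset.sum_eq_zero fun i _ =>
    chainMk_eq_zero _ j hj (C (i j) (i (j + 1))) (by rw [hM]; rfl)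

/-- Constant matrices may be added in all slots but the zeroth. -/
theorem trM_add_const [DecidableEq ι] {l : ℕ} (M C : Fin (l + 1) → Matrix ι ι A)
    (h0 : C 0 = 0) (hC : ∀ j, j ≠ 0 → ∃ D : Matrix ι ι ℂ, C j = D.map (algebraMap ℂ A)) :
    trM A ι l (M + C) = trM A ι l M := by
  rw [MultilinearMap.map_add_univ]
  rw [Finset.sum_eq_single Finset.univ]
  · simp
  · intro s _ hs
    obtain ⟨j, hj⟩ : ∃ j, j ∉ s := by
      by_contra! h
      exact hs (Finset.eq_univ_iff_forall.mpr h)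
    by_cases hj0 : j = 0
    · subst hj0
      exact MultilinearMap.map_coord_zero _ 0 (by simp [hj, h0])
    · obtain ⟨D, hD⟩ := hC j hj0
      exact trM_const _ j hj0 D (by simp [hj, hD])
  · simp

/-- Path expansion of a matrix product: the inner vertices are summed, the two end vertices are
fixed. -/
theorem sum_path {B : Type*} [Ring B] [DecidableEq ι] : ∀ (l : ℕ) (C : Fin (l + 1) → Matrix ι ι B)
    (x y : ι), (List.ofFn C).prod x y =
      ∑ i : Fin l → ι, (List.ofFn fun j : Fin (l + 1) =>
        C j (Fin.cons (α := fun _ => ι) x i j) (Fin.snoc (α := fun _ => ι) i y j)).prod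
  | 0, C, x, y => by simp [Fin.snoc]
  | l + 1, C, x, y => by
    rw [List.ofFn_succ, List.prod_cons, Matrix.mul_apply,
      ← (Fin.consEquiv (fun _ : Fin (l + 1) => ι)).sum_comp, Fintype.sum_prod_type]
    refine Finset.sum_congr rfl fun z _ => ?_
    rw [sum_path l (fun i => C i.succ) z y, Finset.mul_sum]
    refine Finset.sum_congr rfl fun i _ => ?_
    rw [List.ofFn_succ (n := l + 1), List.prod_cons]
    simp only [Fin.consEquiv, Equiv.coe_fn_mk, Fin.cons_succ, Fin.cons_zero,
      ← Fin.cons_snoc_eq_snoc_cons]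

/-- The trace closes the path; addition in `Fin (l + 1)` is cyclic, so the successor of the last
vertex is the first. -/
theorem trace_prod {B : Type*} [Ring B] [DecidableEq ι] (l : ℕ)
    (C : Fin (l + 1) → Matrix ι ι B) :
    Matrix.trace (List.ofFn C).prod =
      ∑ i : Fin (l + 1) → ι, (List.ofFn fun j => C j (i j) (i (j + 1))).prod := by
  rw [Matrix.trace, ← (Fin.consEquiv (fun _ : Fin (l + 1) => ι)).sum_comp,
    Fintype.sum_prod_type]
  refine Finset.sum_congr rfl fun x _ => ?_
  rw [Matrix.diag_apply, sum_path]
  refine Finset.sum_congr rfl fun i _ => ?_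
  congr 2
  funext j
  congr 1
  simp only [Fin.consEquiv, Equiv.coe_fn_mk]
  rcases Fin.eq_castSucc_or_eq_last j with ⟨k, rfl⟩ | rfl
  · rw [Fin.snoc_castSucc]
    have : k.castSucc + 1 = k.succ := by simp
    rw [this, Fin.cons_succ]
  · rw [Fin.snoc_last, Fin.last_add_one, Fin.cons_zero]

/-- Evaluation of a product functional on a trace chain. -/
theorem trace_prod_comm [DecidableEq ι] (l : ℕ) (C : Fin (l + 1) → Matrix ι ι ℂ) :
    ∑ i : Fin (l + 1) → ι, ∏ j, C j (i j) (i (j + 1)) = Matrix.trace (List.ofFn C).prod := by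
  rw [trace_prod]
  exact Finset.sum_congr rfl fun i _ => (List.prod_ofFn).symm

/-- The elementary matrix-valued tensor `C ⊗ x`. -/
def sm (C : Matrix ι ι ℂ) (x : A) : Matrix ι ι A := C.map (fun c => c • x)

theorem sm_apply (C : Matrix ι ι ℂ) (x : A) (i j : ι) : sm C x i j = C i j • x := rfl

/-- Scalar coefficients separate from algebra elements, which reduces Chern characters of matrices
linear in the coordinates to traces of words of scalar matrices. -/
theorem trM_sum_sm [DecidableEq ι] {l : ℕ} {τ : Type*} [Fintype τ] [DecidableEq τ]
    (C : Fin (l + 1) → τ → Matrix ι ι ℂ) (y : τ → A) :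
    trM A ι l (fun j => ∑ a, sm (C j a) (y a)) =
      ∑ a : Fin (l + 1) → τ, Matrix.trace (List.ofFn fun j => C j (a j)).prod •
        chainMk A l (fun j => y (a j)) := by
  rw [MultilinearMap.map_sum]
  refine Finset.sum_congr rfl fun a _ => ?_
  rw [trM_apply, ← trace_prod_comm, Finset.sum_smul]
  refine Finset.sum_congr rfl fun i _ => ?_
  simp only [sm_apply]
  rw [MultilinearMap.map_smul_univ]

theorem sm_mul [DecidableEq ι] (C D : Matrix ι ι ℂ) (x y : A) :
    sm C x * sm D y = sm (C * D) (x * y) := by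
  ext i j
  simp [Matrix.mul_apply, sm_apply, Finset.sum_smul, smul_smul, mul_comm]

theorem sm_add (C D : Matrix ι ι ℂ) (x : A) : sm (C + D) x = sm C x + sm D x := by
  ext i j; simp [sm_apply, add_smul]

theorem sm_smul (c : ℂ) (C : Matrix ι ι ℂ) (x : A) : sm (c • C) x = c • sm C x := by
  ext i j; simp [sm_apply, smul_smul]

theorem sm_smul' (c : ℂ) (C : Matrix ι ι ℂ) (x : A) : sm C (c • x) = c • sm C x := by
  ext i j; simp [sm_apply, smul_smul, mul_comm]

theorem sm_sum' {τ : Type*} (s : Finset τ) (C : Matrix ι ι ℂ) (x : τ → A) :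
    sm C (∑ a ∈ s, x a) = ∑ a ∈ s, sm C (x a) := by
  ext i j; simp [sm_apply, Finset.smul_sum, Matrix.sum_apply]

theorem sm_sum {τ : Type*} (s : Finset τ) (C : τ → Matrix ι ι ℂ) (x : A) :
    sm (∑ a ∈ s, C a) x = ∑ a ∈ s, sm (C a) x := by
  ext i j; simp [sm_apply, Finset.sum_smul, Matrix.sum_apply]

theorem sm_one [DecidableEq ι] : sm (1 : Matrix ι ι ℂ) (1 : A) = 1 := by
  ext i j; simp [sm_apply, Matrix.one_apply]

theorem sm_one_eq_map (C : Matrix ι ι ℂ) : sm C (1 : A) = C.map (algebraMap ℂ A) := by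
  ext i j; simp [sm_apply, Algebra.algebraMap_eq_smul_one]

theorem sm_zero (x : A) : sm (0 : Matrix ι ι ℂ) x = 0 := by ext; simp [sm_apply]

theorem star_sm [StarRing A] [StarModule ℂ A] (C : Matrix ι ι ℂ) (x : A) :
    star (sm C x) = sm (star C) (star x) := by
  ext i j; simp [sm_apply, Matrix.star_apply]

end TraceChains

/-! ### The Hochschild boundary of trace chains and the even characters. -/

section Boundary

variable {A : Type*} [Ring A] [Algebra ℂ A] {ι : Type*} [Fintype ι]

/-- The cyclic face is the zeroth merge of the rotated tuple, so that every face is an instance of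
`merge`. -/
theorem b_chainMk (l : ℕ) (a : Fin (l + 2) → A) :
    b A l (chainMk A (l + 1) a) = ∑ i : Fin (l + 1), (-1 : ℂ) ^ (i : ℕ) • chainMk A l (merge i a) +
      (-1 : ℂ) ^ (l + 1) • chainMk A l (merge 0 (a ∘ (finRotate (l + 2)).symm)) := by
  have h : b A l (chainMk A (l + 1) a) =
      (degenerate A l).mkQ (bFull A l (PiTensorProduct.tprod ℂ a)) := rfl
  rw [h, bFull, PiTensorProduct.lift.tprod]
  simp only [add_apply, sum_apply, smul_apply, map_add, map_sum, map_smul]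
  rfl

/-- Multiplying the matrices in slots `i` and `i + 1` sums over the index at position `i.succ`. This
lemma and the next three locate the remaining indices once that one is inserted. -/
theorem insertNth_succ_le {l : ℕ} (i k : Fin (l + 1)) (c : ι) (j : Fin (l + 1) → ι) (h : k ≤ i) :
    Fin.insertNth (α := fun _ => ι) i.succ c j k.castSucc = j k := by
  have : k.castSucc = i.succ.succAbove k :=
    (Fin.succAbove_of_castSucc_lt _ _ (Fin.castSucc_lt_succ_iff.mpr h)).symm
  rw [this, Fin.insertNth_apply_succAbove]

theorem insertNth_succ_gt {l : ℕ} (i k : Fin (l + 1)) (c : ι) (j : Fin (l + 1) → ι) (h : i < k) :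
    Fin.insertNth (α := fun _ => ι) i.succ c j k.succ = j k := by
  have : k.succ = i.succ.succAbove k :=
    (Fin.succAbove_of_le_castSucc _ _ (Fin.succ_le_castSucc_iff.mpr h)).symm
  rw [this, Fin.insertNth_apply_succAbove]

theorem insertNth_succ_add_one {l : ℕ} (i k : Fin (l + 1)) (c : ι) (j : Fin (l + 1) → ι)
    (h : i ≤ k) : Fin.insertNth (α := fun _ => ι) i.succ c j (k.succ + 1) = j (k + 1) := by
  rcases eq_or_ne k (Fin.last l) with rfl | hk
  · rw [Fin.succ_last, Fin.last_add_one, Fin.last_add_one, ← Fin.castSucc_zero]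
    exact insertNth_succ_le i 0 c j (Fin.zero_le _)
  · obtain ⟨k', rfl⟩ := Fin.exists_castSucc_eq.mpr hk
    obtain ⟨l, rfl⟩ : ∃ l', l = l' + 1 := ⟨l - 1, by have := k'.2; omega⟩
    have h1 : k'.castSucc + 1 = k'.succ := by simp
    have h2 : k'.castSucc.succ + 1 = k'.succ.succ := by
      rw [Fin.succ_castSucc]; exact Fin.coeSucc_eq_succ
    rw [h1, h2]
    exact insertNth_succ_gt i k'.succ c j (lt_of_le_of_lt h (Fin.castSucc_lt_succ))

theorem insertNth_castSucc_add_one {l : ℕ} (i k : Fin (l + 1)) (c : ι) (j : Fin (l + 1) → ι)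
    (h : k < i) : Fin.insertNth (α := fun _ => ι) i.succ c j (k.castSucc + 1) = j (k + 1) := by
  obtain ⟨k', rfl⟩ := Fin.exists_castSucc_eq.mpr (ne_of_lt (lt_of_lt_of_le h (Fin.le_last i)))
  obtain ⟨l, rfl⟩ : ∃ l', l = l' + 1 := ⟨l - 1, by have := k'.2; omega⟩
  have h1 : k'.castSucc + 1 = k'.succ := by simp
  have h2 : k'.castSucc.castSucc + 1 = k'.succ.castSucc := by
    rw [← Fin.succ_castSucc]; simp
  rw [h1, h2]
  exact insertNth_succ_le i k'.succ c j (Fin.castSucc_lt_iff_succ_le.mp h)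

theorem trM_merge [DecidableEq ι] {l : ℕ} (i : Fin (l + 1)) (M : Fin (l + 2) → Matrix ι ι A) :
    trM A ι l (merge i M) =
      ∑ j : Fin (l + 2) → ι, chainMk A l (merge i (fun k => M k (j k) (j (k + 1)))) := by
  rw [trM_apply, ← (Fin.insertNthEquiv (fun _ : Fin (l + 2) => ι) i.succ).sum_comp,
    Fintype.sum_prod_type_right]
  refine Finset.sum_congr rfl fun j _ => ?_
  have key : (fun k => merge i M k (j k) (j (k + 1))) =
      Function.update (fun k => merge i M k (j k) (j (k + 1))) i
        (∑ c, M i.castSucc (j i) c * M i.succ c (j (i + 1))) := by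
    rw [eq_comm, Function.update_eq_self_iff]
    simp [merge, Matrix.mul_apply]
  rw [key, MultilinearMap.map_update_sum]
  refine Finset.sum_congr rfl fun c _ => ?_
  congr 1
  funext k
  simp only [Fin.insertNthEquiv, Equiv.coe_fn_mk]
  rcases lt_trichotomy k i with h | rfl | h
  · simp only [merge, Function.update_of_ne h.ne, h, if_true]
    rw [insertNth_succ_le i k c j h.le, insertNth_castSucc_add_one i k c j h]
  · have h1 : k.castSucc + 1 = k.succ := by simp
    simp only [merge, Function.update_self, lt_irrefl, if_true, if_false]
    rw [insertNth_succ_le k k c j le_rfl, h1, Fin.insertNth_apply_same,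
      insertNth_succ_add_one k k c j le_rfl]
  · simp only [merge, Function.update_of_ne h.ne', h.not_gt, h.ne', if_false]
    rw [insertNth_succ_gt i k c j h, insertNth_succ_add_one i k c j h.le]

/-- The generalized trace is compatible with the boundary: summing faces of entries over the
contracted index is matrix multiplication. -/
theorem b_trM [DecidableEq ι] (l : ℕ) (M : Fin (l + 2) → Matrix ι ι A) :
    b A l (trM A ι (l + 1) M) = ∑ i : Fin (l + 1), (-1 : ℂ) ^ (i : ℕ) • trM A ι l (merge i M) +
      (-1 : ℂ) ^ (l + 1) • trM A ι l (merge 0 (M ∘ (finRotate (l + 2)).symm)) := by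
  rw [trM_apply, map_sum]
  simp only [b_chainMk, Finset.sum_add_distrib]
  congr 1
  · rw [Finset.sum_comm]
    refine Finset.sum_congr rfl fun i _ => ?_
    rw [trM_merge, Finset.smul_sum]
  · rw [trM_merge, Finset.smul_sum]
    refine Fintype.sum_equiv (Equiv.arrowCongr (finRotate (l + 2)) (Equiv.refl ι)) _ _ fun i => ?_
    congr 2
    congr 1
    funext k
    have : (finRotate (l + 2)).symm (k + 1) = (finRotate (l + 2)).symm k + 1 := by
      rw [← finRotate_apply k, Equiv.symm_apply_apply, ← finRotate_apply, Equiv.apply_symm_apply]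
    simp [Equiv.arrowCongr, this]

/-- The operator `c ↦ 1 ⊗ c` on normalized chains. -/
def oneTensor (A : Type*) [Ring A] [Algebra ℂ A] (l : ℕ) : Chain A l →ₗ[ℂ] Chain A (l + 1) :=
  chainLift ((chainMk A (l + 1)).curryLeft 1) (fun a j _ h => by
    rw [MultilinearMap.curryLeft_apply]
    exact chainMk_eq_zero _ j.succ (Fin.succ_ne_zero j) 1 (by simpa using h))

/-- The leading identity matrix forces the additional index to equal `i 0`. -/
theorem oneTensor_trM [DecidableEq ι] (l : ℕ) (M : Fin (l + 1) → Matrix ι ι A) :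
    oneTensor A l (trM A ι l M) =
      trM A ι (l + 1) (Fin.cons (α := fun _ => Matrix ι ι A) 1 M) := by
  rw [trM_apply, map_sum, trM_apply, ← (Fin.consEquiv (fun _ : Fin (l + 2) => ι)).sum_comp,
    Fintype.sum_prod_type_right]
  refine Finset.sum_congr rfl fun i _ => ?_
  rw [oneTensor, chainLift_chainMk, MultilinearMap.curryLeft_apply, Finset.sum_eq_single (i 0)]
  · congr 1
    funext k
    refine Fin.cases ?_ (fun k => ?_) k
    · simp [Fin.consEquiv]
    · simp only [Fin.consEquiv, Equiv.coe_fn_mk, Fin.cons_succ]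
      congr 1
      rcases Fin.eq_castSucc_or_eq_last k with ⟨k, rfl⟩ | rfl
      · have h1 : k.castSucc.succ + 1 = k.succ.succ := by
          rw [Fin.succ_castSucc]; exact Fin.coeSucc_eq_succ
        have h2 : k.castSucc + 1 = k.succ := by simp
        rw [h1, h2, Fin.cons_succ]
      · rw [Fin.succ_last, Fin.last_add_one, Fin.last_add_one, Fin.cons_zero]
  · intro x _ hx
    refine MultilinearMap.map_coord_zero _ 0 ?_
    have h1 : (0 : Fin (l + 2)) + 1 = Fin.succ 0 := by simp
    simp only [Fin.consEquiv, Equiv.coe_fn_mk, Fin.cons_zero, h1, Fin.cons_succ]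
    exact Matrix.one_apply_ne hx
  · simp

theorem sum_neg_one_pow_succ (m : ℕ) :
    ∑ i : Fin (2 * m + 1), (-1 : ℂ) ^ ((i.succ : Fin (2 * m + 2)) : ℕ) = -1 := by
  induction m with
  | zero => simp
  | succ m ih =>
    have := Fin.sum_univ_eq_sum_range (fun i => (-1 : ℂ) ^ (i + 1)) (2 * m + 1)
    have h2 := Fin.sum_univ_eq_sum_range (fun i => (-1 : ℂ) ^ (i + 1)) (2 * (m + 1) + 1)
    simp only [Fin.val_succ] at *
    rw [h2, show 2 * (m + 1) + 1 = 2 * m + 1 + 1 + 1 by ring, Finset.sum_range_succ,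
      Finset.sum_range_succ, ← this, ih]
    simp [pow_succ, pow_mul]

/-- The trace chain with `X` in the zeroth slot and `e` elsewhere. -/
def trHead (l : ℕ) (X e : Matrix ι ι A) : Chain A l := trM A ι l (fun j => if j = 0 then X else e)

theorem trHead_eq_update (l : ℕ) (X e : Matrix ι ι A) :
    trHead l X e = trM A ι l (Function.update (fun _ => e) 0 X) := by
  unfold trHead
  congr 1
  funext j
  simp [Function.update_apply]

theorem trHead_add (l : ℕ) (X Y e : Matrix ι ι A) :
    trHead l (X + Y) e = trHead l X e + trHead l Y e := by
  simp only [trHead_eq_update, MultilinearMap.map_update_add]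

theorem trHead_smul (l : ℕ) (c : ℂ) (X e : Matrix ι ι A) :
    trHead l (c • X) e = c • trHead l X e := by
  simp only [trHead_eq_update, MultilinearMap.map_update_smul]

/-- The `2 * m + 1` inner faces all coincide because `e` is idempotent, and their alternating signs
add up to `-1`; the zeroth and cyclic faces give the other two terms. -/
theorem b_trHead [DecidableEq ι] (m : ℕ) (X e : Matrix ι ι A) (he : e * e = e) :
    b A (2 * m + 1) (trHead (2 * m + 1 + 1) X e) =
      trHead (2 * m + 1) (X * e) e - trHead (2 * m + 1) X e + trHead (2 * m + 1) (e * X) e := by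
  have h0 : merge 0 (fun j : Fin (2 * m + 3) => if j = 0 then X else e) =
      fun j => if j = 0 then X * e else e := by
    funext k
    by_cases hk : k = 0
    · subst hk; simp [merge]
    · simp [merge, hk]
  have h1 : ∀ i : Fin (2 * m + 1), merge i.succ (fun j : Fin (2 * m + 3) => if j = 0 then X else e) =
      fun j => if j = 0 then X else e := by
    intro i
    funext k
    rcases lt_trichotomy k i.succ with h | rfl | h
    · simp only [merge, h, if_true, Fin.castSucc_eq_zero_iff]
    · simp [merge, he]
    · simp [merge, h.not_gt, h.ne', (lt_of_le_of_lt (Fin.zero_le _) h).ne']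
  have h2 : merge 0 ((fun j : Fin (2 * m + 3) => if j = 0 then X else e) ∘
      (finRotate (2 * m + 3)).symm) = fun j => if j = 0 then e * X else e := by
    have r1 : ∀ k : Fin (2 * m + 2), (finRotate (2 * m + 3)).symm k.succ = k.castSucc := by
      intro k
      rw [Equiv.symm_apply_eq, finRotate_apply]
      ext; simp
    have r0 : (finRotate (2 * m + 3)).symm 0 = Fin.last _ := by
      rw [Equiv.symm_apply_eq, finRotate_last]
    funext k
    by_cases hk : k = 0
    · subst hk
      simp only [merge, lt_irrefl, if_true, if_false, Function.comp, Fin.castSucc_zero, r0, r1]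
      rw [if_neg (Fin.last_pos.ne')]
    · simp [merge, hk, r1]
  rw [trHead, b_trM, Fin.sum_univ_succ, h0, h2]
  simp only [h1]
  rw [← Finset.sum_smul, sum_neg_one_pow_succ]
  simp [trHead, pow_succ, pow_mul, sub_eq_add_neg]

theorem trHead_one [DecidableEq ι] (l : ℕ) (e : Matrix ι ι A) :
    trHead (l + 1) 1 e = oneTensor A l (trM A ι l (fun _ => e)) := by
  rw [oneTensor_trM, trHead]
  congr 1
  funext j
  refine Fin.cases ?_ (fun j => ?_) j <;> simp

/-- Replacing the zeroth matrix by one that differs by a constant does not affect `1 ⊗ c`. -/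
theorem oneTensor_add_const [DecidableEq ι] (l : ℕ) (M C : Fin (l + 1) → Matrix ι ι A)
    (hC : ∀ j, ∃ D : Matrix ι ι ℂ, C j = D.map (algebraMap ℂ A)) :
    oneTensor A l (trM A ι l (M + C)) = oneTensor A l (trM A ι l M) := by
  rw [oneTensor_trM, oneTensor_trM]
  have : (Fin.cons (α := fun _ => Matrix ι ι A) 1 (M + C) : Fin (l + 2) → Matrix ι ι A) =
      Fin.cons (α := fun _ => Matrix ι ι A) 1 M + Fin.cons (α := fun _ => Matrix ι ι A) 0 C := by
    funext j
    refine Fin.cases ?_ (fun j => ?_) j <;> simp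
  rw [this]
  refine trM_add_const _ _ (by simp) fun j hj => ?_
  obtain ⟨k, rfl⟩ := Fin.exists_succ_eq.mpr hj
  simpa using hC k

theorem algebraMap_matrix_map [DecidableEq ι] (c : ℂ) :
    (c • (1 : Matrix ι ι A)) = (c • (1 : Matrix ι ι ℂ)).map (algebraMap ℂ A) := by
  ext i j
  by_cases h : i = j <;>
    simp [h, Algebra.algebraMap_eq_smul_one]

/-- Since `e - 1/2` times `e` is half of `e` on either side, the three terms of `b_trHead` combine
to half of $1\otimes e\otimes\cdots\otimes e$, and after a leading $1$ the constant shift of `e` is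
irrelevant. Thus $ch_m=0$ makes $ch_{m+1}$ a cycle. -/
theorem b_chEven [DecidableEq ι] (m : ℕ) (e : Matrix ι ι A) (he : e * e = e) :
    b A (2 * m + 1) (trHead (2 * m + 1 + 1) (e - (1 / 2 : ℂ) • 1) e) =
      (1 / 2 : ℂ) • oneTensor A (2 * m) (trHead (2 * m) (e - (1 / 2 : ℂ) • 1) e) := by
  rw [b_trHead m _ _ he]
  have h1 : (e - (1 / 2 : ℂ) • 1) * e = (1 / 2 : ℂ) • e := by
    rw [sub_mul, he, smul_mul_assoc, one_mul]
    nth_rewrite 1 [← one_smul ℂ e]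
    rw [← sub_smul]; norm_num
  have h2 : e * (e - (1 / 2 : ℂ) • 1) = (1 / 2 : ℂ) • e := by
    rw [mul_sub, he, mul_smul_comm, mul_one]
    nth_rewrite 1 [← one_smul ℂ e]
    rw [← sub_smul]; norm_num
  have h3 : trHead (2 * m + 1) ((1 / 2 : ℂ) • e) e -
      trHead (2 * m + 1) (e - (1 / 2 : ℂ) • 1) e + trHead (2 * m + 1) ((1 / 2 : ℂ) • e) e =
      (1 / 2 : ℂ) • trHead (2 * m + 1) 1 e := by
    rw [sub_eq_add_neg e, trHead_add, ← neg_smul, trHead_smul, trHead_smul]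
    module
  rw [h1, h2, h3, trHead_one]
  congr 1
  have : (fun j : Fin (2 * m + 1) => if j = 0 then e - (1 / 2 : ℂ) • 1 else e) =
      (fun _ => e) + fun j => if j = 0 then (-(1 / 2) : ℂ) • 1 else 0 := by
    funext j
    by_cases h : j = 0 <;> simp [h, sub_eq_add_neg]
  rw [trHead, this, oneTensor_add_const]
  intro j
  by_cases h : j = 0
  · exact ⟨_, by
      simpa [h] using algebraMap_matrix_map (A := A) (ι := ι) (-(1 / 2) : ℂ)⟩
  · exact ⟨0, by ext; simp [h]⟩

end Boundary

/-! ### The Hochschild boundary of the odd characters. -/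

section Odd

variable {A : Type*} [Ring A] [Algebra ℂ A] {ι κ : Type*} [Fintype ι] [DecidableEq ι]
  [Fintype κ] [DecidableEq κ]

/-- The alternating trace chain `tr (U ⊗ V ⊗ U ⊗ ⋯)`. -/
def trAlt (l : ℕ) (U V : Matrix ι ι A) : Chain A l :=
  trM A ι l (fun j => if Even j.val then U else V)

theorem finRotate_symm_succ (n : ℕ) (k : Fin (n + 1)) :
    (finRotate (n + 2)).symm k.succ = k.castSucc := by
  rw [Equiv.symm_apply_eq, finRotate_apply]
  ext; simp

/-- Every inner face has the constant `U * V` or `V * U` in a positive slot and dies. The zeroth and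
cyclic faces put this constant in front, with opposite signs. -/
theorem b_trAlt (m : ℕ) (U V : Matrix ι ι A) (h1 : U * V = 1) (h2 : V * U = 1) :
    b A (2 * m + 2) (trAlt (2 * m + 2 + 1) U V) =
      oneTensor A (2 * m + 1) (trAlt (2 * m + 1) U V) -
        oneTensor A (2 * m + 1) (trAlt (2 * m + 1) V U) := by
  have e0 : merge 0 (fun j : Fin (2 * m + 4) => if Even j.val then U else V) =
      Fin.cons (α := fun _ => Matrix ι ι A) 1
        (fun j : Fin (2 * m + 2) => if Even j.val then U else V) := by
    funext k
    refine Fin.cases ?_ (fun k => ?_) k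
    · simp [merge, h1]
    · simp only [merge, Fin.not_lt_zero, Fin.succ_ne_zero, if_false, Fin.val_succ, Fin.cons_succ]
      congr 1
      simp [Nat.even_add_one]
  have e1 : ∀ i : Fin (2 * m + 2), trM A ι (2 * m + 2)
      (merge i.succ (fun j : Fin (2 * m + 4) => if Even j.val then U else V)) = 0 := by
    intro i
    refine trM_const _ i.succ (Fin.succ_ne_zero i) 1 ?_
    rw [Matrix.map_one _ (map_zero _) (map_one _)]
    by_cases h : Even (i : ℕ) <;> simp [merge, Nat.even_add_one, h, h1, h2]
  have e2 : merge 0 ((fun j : Fin (2 * m + 4) => if Even j.val then U else V) ∘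
      (finRotate (2 * m + 4)).symm) = Fin.cons (α := fun _ => Matrix ι ι A) 1
        (fun j : Fin (2 * m + 2) => if Even j.val then V else U) := by
    have hodd : ¬ Even (2 * m + 3) := by
      rw [Nat.not_even_iff_odd]; exact ⟨m + 1, by ring⟩
    funext k
    refine Fin.cases ?_ (fun k => ?_) k
    · simp [merge, hodd, h2]
    · simp only [merge, Fin.not_lt_zero, Fin.succ_ne_zero, if_false, Fin.cons_succ,
        Function.comp, finRotate_symm_succ, Fin.val_castSucc, Fin.val_succ, Nat.even_add_one]
      by_cases h : Even (k : ℕ) <;> simp [h]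
  rw [trAlt, b_trM, Fin.sum_univ_succ, e0, e2]
  simp only [e1, smul_zero, Finset.sum_const_zero, add_zero, oneTensor_trM, trAlt]
  simp [pow_succ, pow_mul, sub_eq_add_neg]

/-- In the lowest odd degree there is no earlier character to use; the two faces are both the chain
of the identity matrix and cancel. -/
theorem b_trAlt_one (U V : Matrix ι ι A) (h1 : U * V = 1) (h2 : V * U = 1) :
    b A 0 (trAlt (0 + 1) U V) = 0 := by
  have e0 : merge 0 (fun j : Fin (0 + 2) => if Even j.val then U else V) = fun _ => 1 := by
    funext k
    obtain rfl : k = 0 := Fin.le_zero_iff.mp (Fin.le_last k)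
    simp [merge, h1]
  have e2 : merge 0 ((fun j : Fin (0 + 2) => if Even j.val then U else V) ∘
      (finRotate (0 + 2)).symm) = fun _ => 1 := by
    funext k
    obtain rfl : k = 0 := Fin.le_zero_iff.mp (Fin.le_last k)
    have h : merge 0 ((fun j : Fin (0 + 2) => if Even j.val then U else V) ∘
      (finRotate (0 + 2)).symm) 0 = V * U := by
      simp [merge]
    rw [h, h2]
  rw [trAlt, b_trM, Fin.sum_univ_succ, e0, e2]
  simp

end Odd

/-! ### Additivity over block-diagonal matrices. -/

section Blocks

variable {A : Type*} [Ring A] [Algebra ℂ A] {ι κ : Type*} [Fintype ι] [DecidableEq ι]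
  [Fintype κ] [DecidableEq κ]

theorem isLeft_const {l : ℕ} (i : Fin (l + 1) → ι ⊕ κ)
    (h : ∀ j, (i j).isLeft = (i (j + 1)).isLeft) (j : Fin (l + 1)) :
    (i j).isLeft = (i 0).isLeft := by
  induction j using Fin.induction with
  | zero => rfl
  | succ j ih =>
    have h1 : j.castSucc + 1 = j.succ := by simp
    rw [← ih, h j.castSucc, h1]

/-- A closed index path either stays in one block or meets a zero off-diagonal entry. -/
theorem trM_fromBlocks {l : ℕ} (M : Fin (l + 1) → Matrix ι ι A) (M' : Fin (l + 1) → Matrix κ κ A) :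
    trM A (ι ⊕ κ) l (fun j => Matrix.fromBlocks (M j) 0 0 (M' j)) =
      trM A ι l M + trM A κ l M' := by
  classical
  simp only [trM_apply]
  set f : (Fin (l + 1) → ι ⊕ κ) → Chain A l := fun i =>
    chainMk A l (fun j => Matrix.fromBlocks (M j) 0 0 (M' j) (i j) (i (j + 1))) with hf
  let L : (Fin (l + 1) → ι) ↪ (Fin (l + 1) → ι ⊕ κ) :=
    ⟨fun i j => Sum.inl (i j), fun i i' h => funext fun j => Sum.inl_injective (congrFun h j)⟩
  let R : (Fin (l + 1) → κ) ↪ (Fin (l + 1) → ι ⊕ κ) :=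
    ⟨fun i j => Sum.inr (i j), fun i i' h => funext fun j => Sum.inr_injective (congrFun h j)⟩
  have hd : Disjoint (Finset.univ.map L) (Finset.univ.map R) := by
    rw [Finset.disjoint_left]
    intro x hx hy
    simp only [Finset.mem_map, Finset.mem_univ, true_and] at hx hy
    obtain ⟨i, rfl⟩ := hx
    obtain ⟨i', h⟩ := hy
    exact Sum.inr_ne_inl (congrFun h 0)
  have hs : ∑ i, f i = ∑ i ∈ (Finset.univ.map L).disjUnion (Finset.univ.map R) hd, f i := by
    symm
    refine Finset.sum_subset (Finset.subset_univ _) fun i _ hi => ?_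
    by_cases h : ∀ j, (i j).isLeft = (i (j + 1)).isLeft
    · exfalso
      apply hi
      have hc := isLeft_const i h
      rw [Finset.mem_disjUnion, Finset.mem_map, Finset.mem_map]
      cases h0 : (i 0).isLeft with
      | true =>
        left
        refine ⟨fun j => (i j).getLeft (by rw [hc j, h0]), Finset.mem_univ _, ?_⟩
        funext j
        exact Sum.inl_getLeft _ _
      | false =>
        right
        refine ⟨fun j => (i j).getRight (by
          rw [← Sum.isLeft_eq_false, hc j, h0]), Finset.mem_univ _, ?_⟩
        funext j
        exact Sum.inr_getRight _ _
    · push Not at h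
      obtain ⟨j, hj⟩ := h
      refine MultilinearMap.map_coord_zero _ j ?_
      rcases hx : i j with x | x <;> rcases hy : i (j + 1) with y | y <;> simp_all
  rw [hs, Finset.sum_disjUnion, Finset.sum_map, Finset.sum_map]
  rfl

end Blocks

/-! ### The groups of realizable character sequences. -/

section Realised

variable {A : Type*} [Ring A] [StarRing A] [Algebra ℂ A] [StarModule ℂ A]
  {ι κ : Type*} [Fintype ι] [DecidableEq ι] [Fintype κ] [DecidableEq κ]

/-- The sequence of all `ch_k` of a matrix over an arbitrary index type. -/
def evenSeq (e : Matrix ι ι A) : (k : ℕ) → Chain A (2 * k) :=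
  fun k => trHead (2 * k) (e - (1 / 2 : ℂ) • 1) e

/-- The sequence of all `ch_{k + 1/2}` of a matrix over an arbitrary index type. -/
def oddSeq (U : Matrix ι ι A) : (k : ℕ) → Chain A (2 * k + 1) :=
  fun k => trAlt (2 * k + 1) U (star U) - trAlt (2 * k + 1) (star U) U

theorem chEven_eq {q : ℕ} (k : ℕ) (e : Matrix (Fin q) (Fin q) A) : chEven k e = evenSeq e k :=
  trChain_eq _

theorem chOdd_eq {q : ℕ} (k : ℕ) (U : Matrix (Fin q) (Fin q) A) : chOdd k U = oddSeq U k :=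
  congrArg₂ _ (trChain_eq _) (trChain_eq _)

theorem evenSeq_reindex (f : κ ≃ ι) (e : Matrix ι ι A) :
    evenSeq (e.submatrix f f) = evenSeq e := by
  funext k
  unfold evenSeq trHead
  rw [← trM_reindex f]
  congr 1
  funext j
  by_cases h : j = 0
  · subst h
    ext x y
    simp [Matrix.one_apply]
  · simp [h]

theorem oddSeq_reindex (f : κ ≃ ι) (e : Matrix ι ι A) :
    oddSeq (e.submatrix f f) = oddSeq e := by
  funext k
  unfold oddSeq trAlt
  rw [← trM_reindex f, ← trM_reindex f]
  congr 2 <;> funext j <;> split_ifs <;> rfl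

theorem evenSeq_fromBlocks (e : Matrix ι ι A) (e' : Matrix κ κ A) :
    evenSeq (Matrix.fromBlocks e 0 0 e') = evenSeq e + evenSeq e' := by
  funext k
  simp only [evenSeq, trHead, Pi.add_apply]
  rw [← trM_fromBlocks]
  congr 1
  funext j
  by_cases h : j = 0
  · simp only [h, if_true]
    rw [← Matrix.fromBlocks_one, Matrix.fromBlocks_smul, sub_eq_add_neg, Matrix.fromBlocks_neg,
      Matrix.fromBlocks_add]
    simp [sub_eq_add_neg]
  · simp [h]

theorem star_fromBlocks_diag (e : Matrix ι ι A) (e' : Matrix κ κ A) :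
    star (Matrix.fromBlocks e 0 0 e') = Matrix.fromBlocks (star e) 0 0 (star e') := by
  rw [Matrix.star_eq_conjTranspose, Matrix.fromBlocks_conjTranspose]
  simp [Matrix.star_eq_conjTranspose]

theorem oddSeq_fromBlocks (e : Matrix ι ι A) (e' : Matrix κ κ A) :
    oddSeq (Matrix.fromBlocks e 0 0 e') = oddSeq e + oddSeq e' := by
  funext k
  simp only [oddSeq, trAlt, Pi.add_apply]
  rw [← add_sub_add_comm, ← trM_fromBlocks, ← trM_fromBlocks, star_fromBlocks_diag]
  congr 2 <;> funext j <;> split_ifs <;> rfl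

/-- The shift by $\frac12$ makes the zeroth slot exactly odd under $e\mapsto 1-e$, and the other
slots are odd modulo constants; there are $2k+1$ slots in all. -/
theorem evenSeq_one_sub (e : Matrix ι ι A) : evenSeq (1 - e) = -evenSeq e := by
  funext k
  have h1 : evenSeq (1 - e) k = trHead (2 * k) (-(e - (1 / 2 : ℂ) • 1)) (-e) := by
    unfold evenSeq trHead
    rw [← trM_add_const (fun j : Fin (2 * k + 1) => if j = 0 then -(e - (1 / 2 : ℂ) • 1) else -e)
      (fun j => if j = 0 then 0 else 1) (by simp)]
    · congr 1
      funext j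
      by_cases h : j = 0
      · simp only [h, if_true, Pi.add_apply, add_zero]
        have : (1 : Matrix ι ι A) = (1 / 2 : ℂ) • 1 + (1 / 2 : ℂ) • 1 := by
          rw [← add_smul]; norm_num
        nth_rewrite 1 [this]
        abel
      · simp only [h, if_false, Pi.add_apply]
        abel
    · intro j hj
      refine ⟨1, ?_⟩
      rw [Matrix.map_one _ (map_zero _) (map_one _)]
      simp [hj]
  have h2 : (fun j : Fin (2 * k + 1) => if j = 0 then -(e - (1 / 2 : ℂ) • 1) else -e) =
      fun j => (-1 : ℂ) • (if j = 0 then (e - (1 / 2 : ℂ) • 1) else e) := by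
    funext j
    split_ifs <;> simp
  rw [h1, trHead, h2, MultilinearMap.map_smul_univ]
  simp [evenSeq, trHead, pow_succ, pow_mul]

theorem oddSeq_star (U : Matrix ι ι A) : oddSeq (star U) = -oddSeq U := by
  funext k
  simp [oddSeq]

theorem oddSeq_of_selfAdjoint (U : Matrix ι ι A) (h : star U = U) : oddSeq U = 0 := by
  funext k
  simp [oddSeq, h]

variable (A) in
/-- The sequences `(ch_k(e))_k` of self-adjoint idempotents. -/
def evenReal : AddSubgroup ((k : ℕ) → Chain A (2 * k)) where
  carrier := {f | ∃ (q : ℕ) (e : Matrix (Fin q) (Fin q) A), e * e = e ∧ star e = e ∧ evenSeq e = f}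
  zero_mem' := ⟨0, 0, by simp, by simp, by
    funext k
    simp [evenSeq, trHead, trM_apply]⟩
  add_mem' := by
    rintro _ _ ⟨q, e, h1, h2, rfl⟩ ⟨q', e', h1', h2', rfl⟩
    refine ⟨q + q', (Matrix.fromBlocks e 0 0 e').submatrix finSumFinEquiv.symm finSumFinEquiv.symm,
      ?_, ?_, ?_⟩
    · rw [Matrix.submatrix_mul_equiv, Matrix.fromBlocks_multiply]
      simp [h1, h1']
    · rw [Matrix.star_eq_conjTranspose, Matrix.conjTranspose_submatrix,
        ← Matrix.star_eq_conjTranspose, star_fromBlocks_diag, h2, h2']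
    · rw [evenSeq_reindex, evenSeq_fromBlocks]
  neg_mem' := by
    rintro _ ⟨q, e, h1, h2, rfl⟩
    refine ⟨q, 1 - e, ?_, by simp [h2], evenSeq_one_sub e⟩
    rw [sub_mul, one_mul, mul_sub, h1, mul_one, sub_self, sub_zero]

variable (A) in
/-- The sequences `(ch_{k + 1/2}(U))_k` of unitary matrices. -/
def oddReal : AddSubgroup ((k : ℕ) → Chain A (2 * k + 1)) where
  carrier := {f | ∃ (q : ℕ) (U : Matrix (Fin q) (Fin q) A),
    star U * U = 1 ∧ U * star U = 1 ∧ oddSeq U = f}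
  zero_mem' := ⟨0, 0, Subsingleton.elim _ _, Subsingleton.elim _ _, by
    funext k
    simp [oddSeq, trAlt, trM_apply]⟩
  add_mem' := by
    rintro _ _ ⟨q, e, h1, h2, rfl⟩ ⟨q', e', h1', h2', rfl⟩
    refine ⟨q + q', (Matrix.fromBlocks e 0 0 e').submatrix finSumFinEquiv.symm finSumFinEquiv.symm,
      ?_, ?_, ?_⟩
    · rw [Matrix.star_eq_conjTranspose, Matrix.conjTranspose_submatrix,
        ← Matrix.star_eq_conjTranspose, Matrix.submatrix_mul_equiv, star_fromBlocks_diag,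
        Matrix.fromBlocks_multiply]
      simp [h1, h1']
    · rw [Matrix.star_eq_conjTranspose, Matrix.conjTranspose_submatrix,
        ← Matrix.star_eq_conjTranspose, Matrix.submatrix_mul_equiv, star_fromBlocks_diag,
        Matrix.fromBlocks_multiply]
      simp [h2, h2']
    · rw [oddSeq_reindex, oddSeq_fromBlocks]
  neg_mem' := by
    rintro _ ⟨q, e, h1, h2, rfl⟩
    exact ⟨q, star e, by simpa using h2, by simpa using h1, oddSeq_star e⟩

theorem evenSeq_mem (e : Matrix ι ι A) (h1 : e * e = e) (h2 : star e = e) :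
    evenSeq e ∈ evenReal A := by
  refine ⟨Fintype.card ι, e.submatrix (Fintype.equivFin ι).symm (Fintype.equivFin ι).symm,
    ?_, ?_, evenSeq_reindex _ e⟩
  · rw [Matrix.submatrix_mul_equiv, h1]
  · rw [Matrix.star_eq_conjTranspose, Matrix.conjTranspose_submatrix,
      ← Matrix.star_eq_conjTranspose, h2]

theorem oddSeq_mem (U : Matrix ι ι A) (h1 : star U * U = 1) (h2 : U * star U = 1) :
    oddSeq U ∈ oddReal A := by
  refine ⟨Fintype.card ι, U.submatrix (Fintype.equivFin ι).symm (Fintype.equivFin ι).symm,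
    ?_, ?_, oddSeq_reindex _ U⟩
  · rw [Matrix.star_eq_conjTranspose, Matrix.conjTranspose_submatrix,
      ← Matrix.star_eq_conjTranspose, Matrix.submatrix_mul_equiv, h1, Matrix.submatrix_one_equiv]
  · rw [Matrix.star_eq_conjTranspose, Matrix.conjTranspose_submatrix,
      ← Matrix.star_eq_conjTranspose, Matrix.submatrix_mul_equiv, h2, Matrix.submatrix_one_equiv]

/-- The projection `w w*` of a column `w` with `w* w = 1`. -/
def colProj (w : ι → A) : Matrix ι ι A := Matrix.of fun i j => w i * star (w j)

theorem colProj_mul_self (w : ι → A) (h : ∑ i, star (w i) * w i = 1) :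
    colProj w * colProj w = colProj w := by
  ext i j
  simp only [Matrix.mul_apply, colProj, Matrix.of_apply]
  calc ∑ k, w i * star (w k) * (w k * star (w j))
      = w i * (∑ k, star (w k) * w k) * star (w j) := by
        simp only [Finset.mul_sum, Finset.sum_mul, mul_assoc]
    _ = _ := by rw [h, mul_one]

theorem star_colProj (w : ι → A) : star (colProj w) = colProj w := by
  ext i j
  simp [colProj, Matrix.star_apply]

/-- The column `(α x, β)`. -/
def affineCol (α β : ℝ) (x : ι → A) : Option ι → A
  | some i => (α : ℂ) • x i
  | none => (β : ℂ) • 1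

theorem affineCol_norm (α β : ℝ) (x : ι → A) (hx : ∀ i, star (x i) = x i)
    (hs : ∑ i, x i * x i = 1) (h : α ^ 2 + β ^ 2 = 1) :
    ∑ i, star (affineCol α β x i) * affineCol α β x i = 1 := by
  rw [Fintype.sum_option]
  simp only [affineCol, star_smul, hx, star_one, smul_mul_smul_comm, mul_one, ← Finset.smul_sum,
    hs, ← add_smul]
  have : star (β : ℂ) * β + star (α : ℂ) * α = 1 := by
    rw [Complex.star_def, Complex.conj_ofReal, Complex.conj_ofReal]
    norm_cast
    linarith [h]
  rw [this, one_smul]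

end Realised

/-! ### Enlarging a matrix until its entries generate the algebra. -/

section Enhance

variable {A : Type*} [Ring A] [StarRing A] [Algebra ℂ A] [StarModule ℂ A]
  {ι : Type*} [Fintype ι] [DecidableEq ι]

theorem adjoin_eq_top_of_entry {κ : Type*} (x : ι → A)
    (hgen : StarAlgebra.adjoin ℂ (Set.range x) = ⊤) (E : Matrix κ κ A)
    (h : ∀ i, ∃ r s, ∃ c : ℂ, x i = c • E r s) :
    StarAlgebra.adjoin ℂ {a : A | ∃ i j, a = E i j} = ⊤ := by
  rw [eq_top_iff, ← hgen]
  refine StarAlgebra.adjoin_le ?_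
  rintro _ ⟨i, rfl⟩
  obtain ⟨r, s, c, h⟩ := h i
  rw [SetLike.mem_coe, h]
  exact SMulMemClass.smul_mem c (StarAlgebra.subset_adjoin ℂ _ ⟨r, s, rfl⟩)

/-- The projection whose off-diagonal entries are multiples of the coordinates. -/
def halfProj (x : ι → A) : Matrix (Option ι) (Option ι) A :=
  colProj (affineCol (3 / 5) (4 / 5) x)

theorem halfProj_mul_self (x : ι → A) (hx : ∀ i, star (x i) = x i) (hs : ∑ i, x i * x i = 1) :
    halfProj x * halfProj x = halfProj x :=
  colProj_mul_self _ (affineCol_norm _ _ x hx hs (by norm_num))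

/-- The entry is $\frac35\cdot\frac45\,x_i$; a rational point of the unit circle avoids square
roots. -/
theorem eq_smul_halfProj (x : ι → A) (i : ι) :
    x i = (25 / 12 : ℂ) • halfProj x (some i) none := by
  have h : (3 / 5 : ℂ) * star (4 / 5 : ℂ) = 12 / 25 := by
    have : (4 / 5 : ℂ) = ((4 / 5 : ℝ) : ℂ) := by norm_num
    rw [this, Complex.star_def, Complex.conj_ofReal]
    norm_num
  simp only [halfProj, colProj, affineCol, Matrix.of_apply, star_smul, star_one]
  push_cast
  rw [smul_mul_smul_comm, mul_one, h, smul_smul]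
  norm_num

/-- Adding the blocks `P` and `1 - P` leaves all characters unchanged, while `P` contains every
coordinate up to a scalar. Being a cycle is then automatic by `b_chEven`. -/
theorem exists_sphericalProjection (x : ι → A) (hx : ∀ i, star (x i) = x i)
    (hs : ∑ i, x i * x i = 1) (hgen : StarAlgebra.adjoin ℂ (Set.range x) = ⊤)
    (f : (k : ℕ) → Chain A (2 * k)) (hf : f ∈ evenReal A) (m : ℕ) (h0 : ∀ k < m, f k = 0)
    (hm : f m ≠ 0) :
    ∃ (q : ℕ) (e : Matrix (Fin q) (Fin q) A), IsSphericalProjection A m e ∧ chEven m e = f m := by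
  obtain ⟨q, e, h1, h2, rfl⟩ := hf
  have hp := halfProj_mul_self x hx hs
  have hp' : star (halfProj x) = halfProj x := star_colProj _
  set P := halfProj x
  set E := Matrix.fromBlocks e 0 0 (Matrix.fromBlocks P 0 0 (1 - P)) with hE
  let σ := (Fintype.equivFin (Fin q ⊕ (Option ι ⊕ Option ι))).symm
  have hseq : evenSeq (E.submatrix σ σ) = evenSeq e := by
    rw [evenSeq_reindex, hE, evenSeq_fromBlocks, evenSeq_fromBlocks, evenSeq_one_sub]
    simp
  have hq : (1 - P) * (1 - P) = 1 - P := by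
    rw [sub_mul, one_mul, mul_sub, hp, mul_one, sub_self, sub_zero]
  have hidem : E.submatrix σ σ * E.submatrix σ σ = E.submatrix σ σ := by
    rw [Matrix.submatrix_mul_equiv, hE, Matrix.fromBlocks_multiply]
    simp [Matrix.fromBlocks_multiply, h1, hp, hq]
  have hch : ∀ k, chEven k (E.submatrix σ σ) = evenSeq e k := fun k => by
    rw [chEven_eq, hseq]
  refine ⟨_, E.submatrix σ σ, ⟨hidem, ?_, ?_, fun k hk => ?_, ?_, ?_⟩, hch m⟩
  · rw [Matrix.star_eq_conjTranspose, Matrix.conjTranspose_submatrix,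
      ← Matrix.star_eq_conjTranspose, hE, star_fromBlocks_diag, star_fromBlocks_diag, h2, hp',
      star_sub, star_one, hp']
  · refine adjoin_eq_top_of_entry x hgen _ fun i =>
      ⟨σ.symm (Sum.inr (Sum.inl (some i))), σ.symm (Sum.inr (Sum.inl none)), 25 / 12, ?_⟩
    simpa [hE] using eq_smul_halfProj x i
  · rw [hch, h0 k hk]
  · cases m with
    | zero => trivial
    | succ m =>
      change b A (2 * m + 1) (chEven (m + 1) (E.submatrix σ σ)) = 0
      rw [chEven_eq]
      have h3 : evenSeq (E.submatrix σ σ) m = 0 := by rw [hseq, h0 m (Nat.lt_succ_self m)]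
      exact (b_chEven m _ hidem).trans (by
        rw [show trHead (2 * m) (E.submatrix σ σ - (1 / 2 : ℂ) • 1) (E.submatrix σ σ) = 0 from h3,
          map_zero, smul_zero])
  · rw [hch]; exact hm

/-- The added block `P + P - 1` is a self-adjoint unitary, whose odd characters vanish, and its
off-diagonal entries are twice those of `P`. -/
theorem exists_sphericalUnitary (x : ι → A) (hx : ∀ i, star (x i) = x i)
    (hs : ∑ i, x i * x i = 1) (hgen : StarAlgebra.adjoin ℂ (Set.range x) = ⊤)
    (f : (k : ℕ) → Chain A (2 * k + 1)) (hf : f ∈ oddReal A) (m : ℕ) (h0 : ∀ k < m, f k = 0)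
    (hm : f m ≠ 0) :
    ∃ (q : ℕ) (U : Matrix (Fin q) (Fin q) A), IsSphericalUnitary A m U ∧ chOdd m U = f m := by
  obtain ⟨q, U, h1, h2, rfl⟩ := hf
  have hp := halfProj_mul_self x hx hs
  have hp' : star (halfProj x) = halfProj x := star_colProj _
  set P := halfProj x with hP
  have hS : star (P + P - 1) = P + P - 1 := by simp [hp']
  have hSS : (P + P - 1) * (P + P - 1) = 1 := by
    simp only [sub_mul, mul_sub, add_mul, mul_add, hp, mul_one, one_mul]
    abel
  set E := Matrix.fromBlocks U 0 0 (P + P - 1) with hE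
  let σ := (Fintype.equivFin (Fin q ⊕ Option ι)).symm
  have hseq : oddSeq (E.submatrix σ σ) = oddSeq U := by
    rw [oddSeq_reindex, hE, oddSeq_fromBlocks, oddSeq_of_selfAdjoint _ hS, add_zero]
  have hstar : star (E.submatrix σ σ) = (star E).submatrix σ σ := by
    rw [Matrix.star_eq_conjTranspose, Matrix.conjTranspose_submatrix,
      ← Matrix.star_eq_conjTranspose]
  have hu1 : star (E.submatrix σ σ) * E.submatrix σ σ = 1 := by
    rw [hstar, Matrix.submatrix_mul_equiv, hE, star_fromBlocks_diag, hS,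
      Matrix.fromBlocks_multiply]
    simp [h1, hSS]
  have hu2 : E.submatrix σ σ * star (E.submatrix σ σ) = 1 := by
    rw [hstar, Matrix.submatrix_mul_equiv, hE, star_fromBlocks_diag, hS,
      Matrix.fromBlocks_multiply]
    simp [h2, hSS]
  have hch : ∀ k, chOdd k (E.submatrix σ σ) = oddSeq U k := fun k => by
    rw [chOdd_eq, hseq]
  refine ⟨_, E.submatrix σ σ, ⟨hu1, hu2, ?_, fun k hk => ?_, ?_, ?_⟩, hch m⟩
  · refine adjoin_eq_top_of_entry x hgen _ fun i =>
      ⟨σ.symm (Sum.inr (some i)), σ.symm (Sum.inr none), 25 / 24, ?_⟩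
    have := eq_smul_halfProj x i
    simp only [hE, Matrix.submatrix_apply, Equiv.apply_symm_apply, Matrix.fromBlocks_apply₂₂,
      Matrix.sub_apply, Matrix.add_apply]
    rw [Matrix.one_apply_ne (by simp), sub_zero, ← two_smul ℂ, smul_smul]
    rw [this, hP]
    norm_num
  · rw [hch, h0 k hk]
  · cases m with
    | zero =>
      change b A 0 (chOdd 0 (E.submatrix σ σ)) = 0
      rw [chOdd_eq]
      change b A 0 (trAlt (0 + 1) _ _ - trAlt (0 + 1) _ _) = 0
      rw [map_sub, b_trAlt_one _ _ hu2 hu1, b_trAlt_one _ _ hu1 hu2, sub_zero]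
    | succ m =>
      have h3 : oddSeq (E.submatrix σ σ) m = 0 := by rw [hseq, h0 m (Nat.lt_succ_self m)]
      change b A (2 * m + 2) (chOdd (m + 1) (E.submatrix σ σ)) = 0
      rw [chOdd_eq]
      change b A (2 * m + 2) (trAlt (2 * m + 2 + 1) _ _ - trAlt (2 * m + 2 + 1) _ _) = 0
      rw [map_sub, b_trAlt _ _ _ hu2 hu1, b_trAlt _ _ _ hu1 hu2]
      have h4 := congrArg (oneTensor A (2 * m + 1)) h3
      rw [oddSeq, map_sub, map_zero] at h4
      rw [← neg_sub (oneTensor A (2 * m + 1) (trAlt (2 * m + 1) (E.submatrix σ σ) _)), h4]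
      simp
  · rw [hch]; exact hm

end Enhance

/-! ### Finite-difference weights. -/

section FiniteDifference

/-- Integer weights at nodes of the open unit interval that annihilate all lower powers. -/
theorem exists_weights (D : ℕ) : ∃ (c : ℕ → ℤ) (a : ℕ → ℝ),
    (∀ j ∈ Finset.range (D + 1), 0 < a j ∧ a j < 1) ∧
    (∀ r < D, ∑ j ∈ Finset.range (D + 1), (c j : ℝ) * a j ^ r = 0) ∧
    ∑ j ∈ Finset.range (D + 1), (c j : ℝ) * a j ^ D ≠ 0 := by
  -- The weights of the `D`-th forward difference, at equally spaced nodes inside the interval: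
  -- powers below `D` are killed and the power `D` gives $D!/(D+2)^D$.
  refine ⟨fun j => (-1) ^ (D - j) * D.choose j, fun j => (j + 1) / (D + 2), ?_, ?_, ?_⟩
  · intro j hj
    have hj' : (j : ℝ) < D + 1 := by exact_mod_cast Finset.mem_range.mp hj
    constructor
    · positivity
    · rw [div_lt_one (by positivity)]; linarith
  all_goals
    have key : ∀ r, ∑ j ∈ Finset.range (D + 1), (((-1) ^ (D - j) * D.choose j : ℤ) : ℝ) *
        (((j : ℝ) + 1) / (D + 2)) ^ r =
        ((fwdDiff (1 : ℝ))^[D] (fun x => x ^ r) 1) / (D + 2) ^ r := by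
      intro r
      rw [fwdDiff_iter_eq_sum_shift, Finset.sum_div]
      refine Finset.sum_congr rfl fun j _ => ?_
      rw [zsmul_eq_mul, nsmul_eq_mul, mul_one, div_pow, mul_div_assoc, add_comm (1 : ℝ)]
  · intro r hr
    rw [key, fwdDiff_iter_pow_eq_zero_of_lt hr]
    simp
  · rw [key, fwdDiff_iter_eq_factorial]
    simp only [Pi.natCast_apply]
    positivity

end FiniteDifference

/-! ### Multilinear maps along affine families. -/

section Families

theorem multilinear_affine {V W : Type*} [AddCommGroup V] [Module ℂ V] [AddCommGroup W]
    [Module ℂ W] {l : ℕ} (f : MultilinearMap ℂ (fun _ : Fin (l + 1) => V) W)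
    (n P : Fin (l + 1) → V) (a : ℂ) :
    f (fun j => a • n j + P j) =
      ∑ s : Finset (Fin (l + 1)), a ^ s.card • f (s.piecewise n P) := by
  have h : (fun j => a • n j + P j) = (fun j => a • n j) + P := rfl
  rw [h, MultilinearMap.map_add_univ]
  refine Finset.sum_congr rfl fun s _ => ?_
  have h2 : s.piecewise (fun j => a • n j) P =
      s.piecewise (fun j => (fun _ => a) j • s.piecewise n P j) (s.piecewise n P) := by
    funext j
    by_cases hj : j ∈ s <;> simp [hj]
  rw [h2, MultilinearMap.map_piecewise_smul, Finset.prod_const]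

/-- The subset `t` records the slots holding the leading term, so weights annihilating low powers of
the parameter annihilate all small subsets. -/
theorem weighted_sum_affine {V W : Type*} [AddCommGroup V] [Module ℂ V] [AddCommGroup W]
    [Module ℂ W] {l : ℕ} (f : MultilinearMap ℂ (fun _ : Fin (l + 1) => V) W)
    (n P : Fin (l + 1) → V) (s : Finset ℕ) (c : ℕ → ℤ) (a : ℕ → ℝ) :
    ∑ j ∈ s, c j • f (fun i => (a j : ℂ) • n i + P i) =
      ∑ t : Finset (Fin (l + 1)), ((∑ j ∈ s, (c j : ℝ) * a j ^ t.card : ℝ) : ℂ) •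
        f (t.piecewise n P) := by
  simp only [multilinear_affine, Finset.smul_sum]
  rw [Finset.sum_comm]
  refine Finset.sum_congr rfl fun t _ => ?_
  push_cast
  rw [Finset.sum_smul]
  refine Finset.sum_congr rfl fun j _ => ?_
  rw [← smul_smul, Int.cast_smul_eq_zsmul]

end Families

/-! ### Diagonal conjugation and product functionals. -/

section Gauge

variable {A : Type*} [Ring A] [Algebra ℂ A] {ι : Type*} [Fintype ι] [DecidableEq ι]

/-- Around a closed index path the factors `g` and `g⁻¹` cancel in pairs. -/
theorem trM_gauge {l : ℕ} (g : ι → ℂ) (hg : ∀ i, g i ≠ 0) (M M' : Fin (l + 1) → Matrix ι ι A)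
    (h : ∀ j x y, M' j x y = (g x * (g y)⁻¹) • M j x y) : trM A ι l M' = trM A ι l M := by
  rw [trM_apply, trM_apply]
  refine Finset.sum_congr rfl fun i _ => ?_
  simp only [h]
  rw [MultilinearMap.map_smul_univ, Finset.prod_mul_distrib]
  have : ∏ j, (g (i (j + 1)))⁻¹ = ∏ j, (g (i j))⁻¹ :=
    Equiv.prod_comp (Equiv.addRight (1 : Fin (l + 1))) (fun j => (g (i j))⁻¹)
  rw [this, ← Finset.prod_mul_distrib]
  simp [hg]

/-- The product of linear functionals on normalized chains. -/
def prodFunctional {l : ℕ} (f : Fin (l + 1) → A →ₗ[ℂ] ℂ) (hf : ∀ j, j ≠ 0 → f j 1 = 0) :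
    Chain A l →ₗ[ℂ] ℂ :=
  chainLift ((MultilinearMap.mkPiAlgebra ℂ (Fin (l + 1)) ℂ).compLinearMap f) (fun a j hj h => by
    simp only [MultilinearMap.compLinearMap_apply, MultilinearMap.mkPiAlgebra_apply]
    exact Finset.prod_eq_zero (Finset.mem_univ j) (by rw [h, hf j hj]))

theorem prodFunctional_trM {l : ℕ} (f : Fin (l + 1) → A →ₗ[ℂ] ℂ) (hf : ∀ j, j ≠ 0 → f j 1 = 0)
    (M : Fin (l + 1) → Matrix ι ι A) :
    prodFunctional f hf (trM A ι l M) =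
      Matrix.trace (List.ofFn fun j => (M j).map (f j)).prod := by
  rw [trM_apply, map_sum, ← trace_prod_comm]
  refine Finset.sum_congr rfl fun i _ => ?_
  rw [prodFunctional, chainLift_chainMk]
  simp

end Gauge

/-! ### An affine family of projections, and unitaries made from projections. -/

section Column

variable {A : Type*} [Ring A] [StarRing A] [Algebra ℂ A] [StarModule ℂ A]
  {ι : Type*} [Fintype ι] [DecidableEq ι]

/-- The leading coefficient of the affine family of idempotents of the column `(x, 1)`. -/
def leadMat (x : ι → A) : Matrix (Option ι) (Option ι) A
  | some i, some j => x i * x j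
  | some i, none => x i
  | none, some j => -x j
  | none, none => -1

/-- The constant coefficient of the affine family of idempotents of the column `(x, 1)`. -/
def baseMat (x : ι → A) : Matrix (Option ι) (Option ι) A
  | some _, _ => 0
  | none, some j => x j
  | none, none => 1

/-- The scaling factors relating the affine family to a family of self-adjoint projections. -/
def gaugeFun (α β : ℂ) : Option ι → ℂ
  | some _ => α
  | none => β

/-- Conjugating by $\mathrm{diag}(\alpha,\beta)$ turns the entries $\alpha\beta x_i$ into
$\alpha^2x_i$ in the last column and $\beta^2x_j$ in the last row. All entries are then affine in
$\alpha^2$, because $\beta^2=1-\alpha^2$. -/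
theorem affine_eq_gauge (x : ι → A) (hx : ∀ i, star (x i) = x i) (α β : ℝ) (hα : α ≠ 0)
    (hβ : β ≠ 0) (h : α ^ 2 + β ^ 2 = 1) (r s : Option ι) :
    (((α ^ 2 : ℝ) : ℂ) • leadMat x + baseMat x) r s =
      (gaugeFun (ι := ι) α β r * (gaugeFun (ι := ι) α β s)⁻¹) •
        colProj (affineCol α β x) r s := by
  have hα' : (α : ℂ) ≠ 0 := by exact_mod_cast hα
  have hβ' : (β : ℂ) ≠ 0 := by exact_mod_cast hβ
  have hab : (1 : ℂ) - (α : ℂ) ^ 2 = (β : ℂ) ^ 2 := by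
    have : (1 : ℝ) - α ^ 2 = β ^ 2 := by linarith
    exact_mod_cast this
  rcases r with _ | r <;> rcases s with _ | s <;>
    simp only [Matrix.add_apply, Matrix.smul_apply, leadMat, baseMat, gaugeFun, colProj,
      affineCol, Matrix.of_apply, star_smul, hx, star_one, Complex.star_def, Complex.conj_ofReal,
      smul_mul_smul_comm, mul_one, one_mul, smul_smul, Complex.ofReal_pow, smul_neg, add_zero]
  · rw [mul_inv_cancel₀ hβ', one_mul, neg_add_eq_sub]
    nth_rewrite 1 [← one_smul ℂ (1 : A)]
    rw [← sub_smul, hab, sq]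
  · rw [neg_add_eq_sub]
    nth_rewrite 1 [← one_smul ℂ (x s)]
    rw [← sub_smul, hab]
    congr 1
    field_simp
  · congr 1
    field_simp
  · rw [mul_inv_cancel₀ hα', one_mul, sq]

theorem evenSeq_colProj (x : ι → A) (hx : ∀ i, star (x i) = x i) (α β : ℝ) (hα : α ≠ 0)
    (hβ : β ≠ 0) (h : α ^ 2 + β ^ 2 = 1) (k : ℕ) :
    evenSeq (colProj (affineCol α β x)) k =
      trM A (Option ι) (2 * k) (fun j => ((α ^ 2 : ℝ) : ℂ) • leadMat x +
        (if j = 0 then baseMat x - (1 / 2 : ℂ) • 1 else baseMat x)) := by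
  symm
  refine trM_gauge (gaugeFun (ι := ι) α β) ?_ _ _ fun j r s => ?_
  · rintro (_ | i) <;> simpa [gaugeFun]
  · by_cases hj : j = 0
    · simp only [hj, if_true]
      rw [← add_sub_assoc, Matrix.sub_apply, affine_eq_gauge x hx α β hα hβ h, Matrix.sub_apply,
        smul_sub]
      congr 1
      by_cases hrs : r = s
      · subst hrs
        have : gaugeFun (ι := ι) (α : ℂ) β r ≠ 0 := by rcases r with _ | r <;> simpa [gaugeFun]
        rw [mul_inv_cancel₀ this, one_smul]
      · simp [Matrix.one_apply_ne hrs]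
    · simp only [hj, if_false]
      exact affine_eq_gauge x hx α β hα hβ h r s

theorem trM_colProj (x : ι → A) (hx : ∀ i, star (x i) = x i) (α β : ℝ) (hα : α ≠ 0)
    (hβ : β ≠ 0) (h : α ^ 2 + β ^ 2 = 1) (l : ℕ) :
    trM A (Option ι) l (fun _ => colProj (affineCol α β x)) =
      trM A (Option ι) l (fun _ => ((α ^ 2 : ℝ) : ℂ) • leadMat x + baseMat x) := by
  symm
  refine trM_gauge (gaugeFun (ι := ι) α β) ?_ _ _ fun j r s =>
    affine_eq_gauge x hx α β hα hβ h r s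
  rintro (_ | i) <;> simpa [gaugeFun]

/-- The unitary `3/5 + 4/5 i (2p - 1)` of a projection `p`. -/
def projUnitary {κ : Type*} [DecidableEq κ] (p : Matrix κ κ A) : Matrix κ κ A :=
  (3 / 5 - 4 / 5 * Complex.I) • 1 + (8 / 5 * Complex.I) • p

theorem star_projUnitary {κ : Type*} [Fintype κ] [DecidableEq κ] (p : Matrix κ κ A)
    (hp : star p = p) :
    star (projUnitary p) = (3 / 5 + 4 / 5 * Complex.I) • 1 + (-(8 / 5 * Complex.I)) • p := by
  have h3 : (star (3 / 5 : ℂ)) = 3 / 5 := by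
    rw [show (3 / 5 : ℂ) = ((3 / 5 : ℝ) : ℂ) by norm_num, Complex.star_def, Complex.conj_ofReal]
  have h4 : (star (4 / 5 : ℂ)) = 4 / 5 := by
    rw [show (4 / 5 : ℂ) = ((4 / 5 : ℝ) : ℂ) by norm_num, Complex.star_def, Complex.conj_ofReal]
  have h8 : (star (8 / 5 : ℂ)) = 8 / 5 := by
    rw [show (8 / 5 : ℂ) = ((8 / 5 : ℝ) : ℂ) by norm_num, Complex.star_def, Complex.conj_ofReal]
  have hI : star Complex.I = -Complex.I := by rw [Complex.star_def, Complex.conj_I]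
  rw [projUnitary, star_add, star_smul, star_smul, hp, star_one, star_sub, star_mul, star_mul, h3,
    h4, h8, hI]
  congr 2 <;> ring

theorem projUnitary_unitary {κ : Type*} [Fintype κ] [DecidableEq κ] (p : Matrix κ κ A)
    (hp : star p = p) (hpp : p * p = p) :
    star (projUnitary p) * projUnitary p = 1 ∧ projUnitary p * star (projUnitary p) = 1 := by
  have hI := Complex.I_mul_I
  rw [star_projUnitary p hp, projUnitary]
  constructor <;>
  · simp only [add_mul, mul_add, smul_mul_smul_comm, mul_one, one_mul, hpp]
    have : ∀ a b c d : ℂ, a = 1 → b + (c + d) = 0 →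
        a • (1 : Matrix κ κ A) + b • p + (c • p + d • p) = 1 := by
      intro a b c d ha hb
      rw [ha, add_assoc, ← add_smul, ← add_smul, hb]
      simp
    apply this
    · linear_combination (-16 / 25 : ℂ) * hI
    · linear_combination (0 : ℂ) * hI

/-- In positive slots only $\pm\frac{8i}5p$ survives. Exchanging the roles of the unitary and its
adjoint flips an odd number $2k+1$ of signs, so the two halves add up and the zeroth slot becomes
the constant $U+U^*=\frac65$. -/
theorem oddSeq_projUnitary (A κ : Type*) [Ring A] [StarRing A] [Algebra ℂ A] [StarModule ℂ A]
    [Fintype κ] [DecidableEq κ] (k : ℕ) : ∃ c : ℂ, c ≠ 0 ∧ ∀ p : Matrix κ κ A, star p = p →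
      oddSeq (projUnitary p) k = c • oneTensor A (2 * k) (trM A κ (2 * k) (fun _ => p)) := by
  set z : ℂ := 8 / 5 * Complex.I with hz
  have hz0 : z ≠ 0 := by simp [hz]
  let s : Fin (2 * k + 2) → ℂ := fun j => if j = 0 then 1 else if Even j.val then z else -z
  let s' : Fin (2 * k + 2) → ℂ := fun j => if j = 0 then 1 else if Even j.val then -z else z
  have hs : ∏ j, s j ≠ 0 := by
    refine Finset.prod_ne_zero_iff.mpr fun j _ => ?_
    simp only [s]
    split_ifs <;> simp [hz0]
  have hs' : ∏ j, s' j = -∏ j, s j := by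
    rw [Fin.prod_univ_succ s', Fin.prod_univ_succ s]
    have : ∀ j : Fin (2 * k + 1), s' j.succ = -s j.succ := by
      intro j
      simp only [s, s', Fin.succ_ne_zero, if_false]
      split_ifs <;> simp
    have h0 : s' 0 = 1 := by simp [s']
    have h0' : s 0 = 1 := by simp [s]
    simp only [this]
    rw [Finset.prod_neg, Finset.card_univ, Fintype.card_fin, Odd.neg_one_pow ⟨k, rfl⟩, h0, h0']
    ring
  have key : ∀ (t : Fin (2 * k + 2) → ℂ) (u : Fin (2 * k + 2) → ℂ) (p X : Matrix κ κ A),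
      t 0 = 1 → trM A κ (2 * k + 1) (fun j => if j = 0 then X else u j • 1 + t j • p) =
        (∏ j, t j) • trHead (2 * k + 1) X p := by
    intro t u p X ht
    have h1 : (fun j => if j = 0 then X else u j • 1 + t j • p) =
        (fun j => t j • (if j = 0 then X else p)) + fun j => if j = 0 then 0 else u j • 1 := by
      funext j
      by_cases hj : j = 0
      · simp [hj, ht]
      · simp [hj, add_comm]
    rw [h1, trM_add_const _ _ (by simp), MultilinearMap.map_smul_univ, trHead]
    intro j hj
    exact ⟨_, by simpa [hj] using algebraMap_matrix_map (A := A) (u j)⟩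
  refine ⟨(∏ j, s j) * (6 / 5), mul_ne_zero hs (by norm_num), fun p hp => ?_⟩
  have h1 : trAlt (2 * k + 1) (projUnitary p) (star (projUnitary p)) =
      (∏ j, s j) • trHead (2 * k + 1) (projUnitary p) p := by
    rw [← key s (fun j => if Even j.val then 3 / 5 - 4 / 5 * Complex.I
      else 3 / 5 + 4 / 5 * Complex.I) p _ (by simp [s]), trAlt]
    congr 1
    funext j
    by_cases hj : j = 0
    · simp [hj]
    · simp only [hj, if_false, s]
      split_ifs
      · rfl
      · rw [star_projUnitary p hp]
  have h2 : trAlt (2 * k + 1) (star (projUnitary p)) (projUnitary p) =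
      (∏ j, s' j) • trHead (2 * k + 1) (star (projUnitary p)) p := by
    rw [← key s' (fun j => if Even j.val then 3 / 5 + 4 / 5 * Complex.I
      else 3 / 5 - 4 / 5 * Complex.I) p _ (by simp [s']), trAlt]
    congr 1
    funext j
    by_cases hj : j = 0
    · simp [hj]
    · simp only [hj, if_false, s']
      split_ifs
      · rw [star_projUnitary p hp]
      · rfl
  have h3 : projUnitary p + star (projUnitary p) = (6 / 5 : ℂ) • 1 := by
    rw [star_projUnitary p hp, projUnitary]
    module
  rw [oddSeq, h1, h2, hs', neg_smul, sub_neg_eq_add, ← smul_add, ← trHead_add, h3, trHead_smul,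
    trHead_one, smul_smul]

end Column

/-! ### Nonvanishing of the leading coefficients. -/

section Column

variable {A : Type*} [Ring A] [StarRing A] [Algebra ℂ A] [StarModule ℂ A]
  {ι : Type*} [Fintype ι] [DecidableEq ι]

/-- Linear functionals detecting a coordinate and its square. -/
structure Detects (x : ι → A) (i₀ : ι) (f g : A →ₗ[ℂ] ℂ) : Prop where
  f_one : f 1 = 0
  f_lin : ∀ i, f (x i) = if i = i₀ then 1 else 0
  f_quad : ∀ i j, f (x i * x j) = 0
  g_one : g 1 = 0
  g_quad : g (x i₀ * x i₀) = 1

/-- Only the two entries linear in `x i₀` survive `f`; they form a quarter turn in the plane spanned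
by `some i₀` and `none`. -/
theorem leadMat_map_sq (x : ι → A) (i₀ : ι) (f g : A →ₗ[ℂ] ℂ) (h : Detects x i₀ f g) :
    (leadMat x).map f * (leadMat x).map f =
      -(Matrix.single (some i₀) (some i₀) 1 + Matrix.single none none 1) := by
  have hF : (leadMat x).map f =
      Matrix.single (some i₀) none 1 - Matrix.single none (some i₀) 1 := by
    ext r s
    rcases r with _ | r <;> rcases s with _ | s <;>
      simp [leadMat, h.f_one, h.f_lin, h.f_quad, Matrix.single_apply, eq_comm]
  rw [hF]
  simp only [sub_mul, mul_sub, Matrix.single_mul_single_same, mul_one]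
  rw [Matrix.single_mul_single_of_ne _ _ _ _ (by simp),
    Matrix.single_mul_single_of_ne _ _ _ _ (by simp)]
  abel

theorem leadMat_map_pow (x : ι → A) (i₀ : ι) (f g : A →ₗ[ℂ] ℂ) (h : Detects x i₀ f g) (m : ℕ) :
    ((leadMat x).map f) ^ (2 * (m + 1)) = (-1 : ℂ) ^ (m + 1) •
      (Matrix.single (some i₀) (some i₀) 1 + Matrix.single none none 1) := by
  induction m with
  | zero => rw [zero_add, mul_one, sq, leadMat_map_sq x i₀ f g h]; simp [add_comm]
  | succ m ih =>
    rw [show 2 * (m + 1 + 1) = 2 * (m + 1) + 2 by ring, pow_add, ih, sq,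
      leadMat_map_sq x i₀ f g h]
    rw [pow_succ (-1 : ℂ) (m + 1), mul_neg_one, neg_smul, mul_neg, smul_mul_assoc]
    congr 2
    simp only [add_mul, mul_add, Matrix.single_mul_single_same, mul_one]
    rw [Matrix.single_mul_single_of_ne _ _ _ _ (by simp),
      Matrix.single_mul_single_of_ne _ _ _ _ (by simp)]
    abel

/-- A positive even power of the quarter turn is up to sign the projection onto its plane, so the
trace only sees `g (x i₀ * x i₀) = 1` and `g 1 = 0`. -/
theorem trace_leadMat (x : ι → A) (i₀ : ι) (f g : A →ₗ[ℂ] ℂ) (h : Detects x i₀ f g) (m : ℕ)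
    (hm : 1 ≤ m) : Matrix.trace ((leadMat x).map g * ((leadMat x).map f) ^ (2 * m)) ≠ 0 := by
  obtain ⟨m, rfl⟩ : ∃ m', m = m' + 1 := ⟨m - 1, by omega⟩
  rw [leadMat_map_pow x i₀ f g h, mul_smul_comm, Matrix.trace_smul, mul_add, Matrix.trace_add,
    Matrix.trace_mul_single, Matrix.trace_mul_single]
  simp [leadMat, h.g_one, h.g_quad]

theorem trM_leadMat_ne_zero (x : ι → A) (i₀ : ι) (f g : A →ₗ[ℂ] ℂ) (h : Detects x i₀ f g) (m : ℕ)
    (hm : 1 ≤ m) : trM A (Option ι) (2 * m) (fun _ => leadMat x) ≠ 0 := by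
  intro h0
  have := congrArg (prodFunctional (fun j : Fin (2 * m + 1) => if j = 0 then g else f)
    (fun j hj => by simp [hj, h.f_one])) h0
  rw [prodFunctional_trM, map_zero, List.ofFn_succ, List.prod_cons] at this
  simp only [if_true, Fin.succ_ne_zero, if_false, List.ofFn_const, List.prod_replicate] at this
  exact trace_leadMat x i₀ f g h m hm this

theorem oneTensor_leadMat_ne_zero (x : ι → A) (i₀ : ι) (f g ε : A →ₗ[ℂ] ℂ)
    (h : Detects x i₀ f g) (hε : ε 1 = 1) (m : ℕ) (hm : 1 ≤ m) :
    oneTensor A (2 * m) (trM A (Option ι) (2 * m) (fun _ => leadMat x)) ≠ 0 := by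
  intro h0
  rw [oneTensor_trM] at h0
  have := congrArg (prodFunctional (Fin.cons (α := fun _ => A →ₗ[ℂ] ℂ) ε
      (fun j : Fin (2 * m + 1) => if j = 0 then g else f))
    (fun j hj => by
      obtain ⟨k, rfl⟩ := Fin.exists_succ_eq.mpr hj
      by_cases hk : k = 0 <;> simp [hk, h.f_one, h.g_one])) h0
  rw [prodFunctional_trM, map_zero, List.ofFn_succ, List.prod_cons, List.ofFn_succ,
    List.prod_cons] at this
  have h1 : (1 : Matrix (Option ι) (Option ι) A).map ε = 1 := by
    ext r s
    by_cases hrs : r = s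
    · subst hrs; simp [hε]
    · simp [hrs]
  simp only [Fin.cons_zero, Fin.cons_succ, if_true, Fin.succ_ne_zero, if_false, List.ofFn_const,
    List.prod_replicate, h1, one_mul] at this
  exact trace_leadMat x i₀ f g h m hm this

/-- The coefficient of $\alpha^{2r}$ collects the subsets of `r` slots. For `k < m` there are fewer
than $2m+1$ slots, and for `k = m` only the full subset survives the weights. -/
theorem exists_even_of_detects (x : ι → A) (hx : ∀ i, star (x i) = x i)
    (hs : ∑ i, x i * x i = 1) (i₀ : ι) (f g : A →ₗ[ℂ] ℂ) (h : Detects x i₀ f g) (m : ℕ)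
    (hm : 1 ≤ m) : ∃ F ∈ evenReal A, (∀ k < m, F k = 0) ∧ F m ≠ 0 := by
  -- The nodes `a j` are the values of $\alpha^2$; lying strictly between 0 and 1, they make both
  -- square roots positive.
  obtain ⟨c, a, ha, hlow, htop⟩ := exists_weights (2 * m + 1)
  have hmem : ∀ j ∈ Finset.range (2 * m + 1 + 1),
      evenSeq (colProj (affineCol (√(a j)) (√(1 - a j)) x)) ∈ evenReal A := fun j hj => by
    refine evenSeq_mem _ (colProj_mul_self _ (affineCol_norm _ _ x hx hs ?_)) (star_colProj _)
    rw [Real.sq_sqrt (ha j hj).1.le, Real.sq_sqrt (by linarith [(ha j hj).2])]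
    ring
  refine ⟨∑ j ∈ Finset.range (2 * m + 1 + 1), c j •
    evenSeq (colProj (affineCol (√(a j)) (√(1 - a j)) x)),
    AddSubgroup.sum_mem _ fun j hj => AddSubgroup.zsmul_mem _ (hmem j hj) _, ?_⟩
  have key : ∀ k, (∑ j ∈ Finset.range (2 * m + 1 + 1), c j •
      evenSeq (colProj (affineCol (√(a j)) (√(1 - a j)) x))) k =
      ∑ t : Finset (Fin (2 * k + 1)),
        ((∑ j ∈ Finset.range (2 * m + 1 + 1), (c j : ℝ) * a j ^ t.card : ℝ) : ℂ) •
        trM A (Option ι) (2 * k) (t.piecewise (fun _ => leadMat x)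
          (fun j => if j = 0 then baseMat x - (1 / 2 : ℂ) • 1 else baseMat x)) := by
    intro k
    rw [← weighted_sum_affine, Finset.sum_apply]
    refine Finset.sum_congr rfl fun j hj => ?_
    rw [Pi.smul_apply, evenSeq_colProj x hx _ _ (Real.sqrt_pos.mpr (ha j hj).1).ne'
      (Real.sqrt_pos.mpr (by linarith [(ha j hj).2])).ne' (by
        rw [Real.sq_sqrt (ha j hj).1.le, Real.sq_sqrt (by linarith [(ha j hj).2])]
        ring), Real.sq_sqrt (ha j hj).1.le]
  constructor
  · intro k hk
    rw [key]
    refine Finset.sum_eq_zero fun t _ => ?_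
    have ht : t.card < 2 * m + 1 := by
      have := Finset.card_le_univ t
      rw [Fintype.card_fin] at this
      omega
    rw [hlow _ ht]
    simp
  · rw [key, Finset.sum_eq_single Finset.univ]
    · rw [Finset.card_univ, Fintype.card_fin, Finset.piecewise_univ]
      exact smul_ne_zero (by exact_mod_cast htop) (trM_leadMat_ne_zero x i₀ f g h m hm)
    · intro t _ ht
      have ht : t.card < 2 * m + 1 := by
        obtain ⟨j, hj⟩ : ∃ j, j ∉ t := by
          by_contra! h
          exact ht (Finset.eq_univ_iff_forall.mpr h)
        have := Finset.card_lt_univ_of_notMem hj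
        rwa [Fintype.card_fin] at this
      rw [hlow _ ht]
      simp
    · simp

/-- By `oddSeq_projUnitary` the odd character is $1\otimes$ the trace chain of the projection, up to
a scalar depending only on the degree, so the even argument applies with `ε` evaluating the
additional slot. -/
theorem exists_odd_of_detects (x : ι → A) (hx : ∀ i, star (x i) = x i)
    (hs : ∑ i, x i * x i = 1) (i₀ : ι) (f g ε : A →ₗ[ℂ] ℂ) (h : Detects x i₀ f g)
    (hε : ε 1 = 1) (m : ℕ) (hm : 1 ≤ m) : ∃ F ∈ oddReal A, (∀ k < m, F k = 0) ∧ F m ≠ 0 := by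
  obtain ⟨c, a, ha, hlow, htop⟩ := exists_weights (2 * m + 1)
  have hsq : ∀ j ∈ Finset.range (2 * m + 1 + 1), √(a j) ^ 2 + √(1 - a j) ^ 2 = 1 := fun j hj => by
    rw [Real.sq_sqrt (ha j hj).1.le, Real.sq_sqrt (by linarith [(ha j hj).2])]
    ring
  have hmem : ∀ j ∈ Finset.range (2 * m + 1 + 1),
      oddSeq (projUnitary (colProj (affineCol (√(a j)) (√(1 - a j)) x))) ∈ oddReal A :=
    fun j hj => by
      have := projUnitary_unitary _ (star_colProj _)
        (colProj_mul_self _ (affineCol_norm _ _ x hx hs (hsq j hj)))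
      exact oddSeq_mem _ this.1 this.2
  refine ⟨∑ j ∈ Finset.range (2 * m + 1 + 1), c j •
    oddSeq (projUnitary (colProj (affineCol (√(a j)) (√(1 - a j)) x))),
    AddSubgroup.sum_mem _ fun j hj => AddSubgroup.zsmul_mem _ (hmem j hj) _, ?_⟩
  have key : ∀ k, ∃ z : ℂ, z ≠ 0 ∧ (∑ j ∈ Finset.range (2 * m + 1 + 1), c j •
      oddSeq (projUnitary (colProj (affineCol (√(a j)) (√(1 - a j)) x)))) k =
      z • oneTensor A (2 * k) (∑ t : Finset (Fin (2 * k + 1)),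
        ((∑ j ∈ Finset.range (2 * m + 1 + 1), (c j : ℝ) * a j ^ t.card : ℝ) : ℂ) •
        trM A (Option ι) (2 * k) (t.piecewise (fun _ => leadMat x) (fun _ => baseMat x))) := by
    intro k
    obtain ⟨z, hz, hz'⟩ := oddSeq_projUnitary A (Option ι) k
    refine ⟨z, hz, ?_⟩
    rw [← weighted_sum_affine, Finset.sum_apply, map_sum, Finset.smul_sum]
    refine Finset.sum_congr rfl fun j hj => ?_
    rw [Pi.smul_apply, hz' _ (star_colProj _), trM_colProj x hx _ _
      (Real.sqrt_pos.mpr (ha j hj).1).ne'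
      (Real.sqrt_pos.mpr (by linarith [(ha j hj).2])).ne' (hsq j hj), Real.sq_sqrt (ha j hj).1.le,
      map_zsmul, smul_comm]
  constructor
  · intro k hk
    obtain ⟨z, -, hz⟩ := key k
    rw [hz, Finset.sum_eq_zero, map_zero, smul_zero]
    intro t _
    have ht : t.card < 2 * m + 1 := by
      have := Finset.card_le_univ t
      rw [Fintype.card_fin] at this
      omega
    rw [hlow _ ht]
    simp
  · obtain ⟨z, hz0, hz⟩ := key m
    rw [hz, Finset.sum_eq_single Finset.univ]
    · rw [Finset.card_univ, Fintype.card_fin, Finset.piecewise_univ, map_smul]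
      exact smul_ne_zero hz0 (smul_ne_zero (by exact_mod_cast htop)
        (oneTensor_leadMat_ne_zero x i₀ f g ε h hε m hm))
    · intro t _ ht
      have ht : t.card < 2 * m + 1 := by
        obtain ⟨j, hj⟩ : ∃ j, j ∉ t := by
          by_contra! h
          exact ht (Finset.eq_univ_iff_forall.mpr h)
        have := Finset.card_lt_univ_of_notMem hj
        rwa [Fintype.card_fin] at this
      rw [hlow _ ht]
      simp
    · simp

end Column

/-! ### Presentations, universal properties and centrality. -/

section Presentation

variable {N₁ N₂ : ℕ}

/-- The quotient map onto the quadratic algebra. -/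
def algMk (R : RMatrix N₁ N₂) : Free N₁ N₂ →ₐ[ℂ] AlgR R := RingQuot.mkAlgHom ℂ (Rel R)

/-- The quotient map onto the algebra of the sphere. -/
def sphMk (R : RMatrix N₁ N₂) : AlgR R →ₐ[ℂ] Sphere R := RingQuot.mkAlgHom ℂ (SphereRel R)

theorem algMk_surjective (R : RMatrix N₁ N₂) : Function.Surjective (algMk R) :=
  RingQuot.mkAlgHom_surjective ℂ _

theorem sphMk_surjective (R : RMatrix N₁ N₂) : Function.Surjective (sphMk R) :=
  RingQuot.mkAlgHom_surjective ℂ _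

theorem algMk_f₁ (R : RMatrix N₁ N₂) (l : Fin N₁) : algMk R (f₁ l) = x₁ R l :=
  congrArg (fun f : Free N₁ N₂ →+* RingQuot (Rel R) => f (f₁ l)) (RingQuot.mkAlgHom_coe ℂ (Rel R))

theorem algMk_f₂ (R : RMatrix N₁ N₂) (a : Fin N₂) : algMk R (f₂ a) = x₂ R a :=
  congrArg (fun f : Free N₁ N₂ →+* RingQuot (Rel R) => f (f₂ a)) (RingQuot.mkAlgHom_coe ℂ (Rel R))

theorem algMk_rel (R : RMatrix N₁ N₂) {u v : Free N₁ N₂} (h : Rel R u v) :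
    algMk R u = algMk R v := RingQuot.mkAlgHom_rel ℂ h

/-- Elements `X₁`, `X₂` of an algebra satisfying the exchange relations of `R`. -/
structure Exchange {B : Type*} [Ring B] [Algebra ℂ B] (R : RMatrix N₁ N₂) (X₁ : Fin N₁ → B)
    (X₂ : Fin N₂ → B) : Prop where
  comm₁ : ∀ l m, X₁ l * X₁ m = X₁ m * X₁ l
  comm₂ : ∀ a b, X₂ a * X₂ b = X₂ b * X₂ a
  mixed : ∀ l a, X₁ l * X₂ a = ∑ b, ∑ m, R l a b m • (X₂ b * X₁ m)

theorem exchange_algR (R : RMatrix N₁ N₂) : Exchange R (x₁ R) (x₂ R) where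
  comm₁ l m := by
    simpa only [map_mul, algMk_f₁] using algMk_rel R (Rel.comm₁ l m)
  comm₂ a b := by
    simpa only [map_mul, algMk_f₂] using algMk_rel R (Rel.comm₂ a b)
  mixed l a := by
    simpa only [map_mul, map_sum, map_smul, algMk_f₁, algMk_f₂] using algMk_rel R (Rel.mixed l a)

variable {B : Type*} [Ring B] [Algebra ℂ B] {R : RMatrix N₁ N₂} {X₁ : Fin N₁ → B}
  {X₂ : Fin N₂ → B}

theorem Exchange.map {C : Type*} [Ring C] [Algebra ℂ C] (h : Exchange R X₁ X₂) (φ : B →ₐ[ℂ] C) :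
    Exchange R (fun l => φ (X₁ l)) (fun a => φ (X₂ a)) where
  comm₁ l m := by simp only [← map_mul, h.comm₁ l m]
  comm₂ a b := by simp only [← map_mul, h.comm₂ a b]
  mixed l a := by simp only [← map_mul, h.mixed l a, map_sum, map_smul]

/-- Reality says that the conjugate matrix inverts `R`, so the second mixed relation is a
consequence of the first and need not be checked in the universal property. -/
theorem Exchange.mixed' (h : Exchange R X₁ X₂) (hR : Admissible R) (l : Fin N₁) (a : Fin N₂) :
    X₂ a * X₁ l = ∑ b, ∑ m, star (R l a b m) • (X₁ m * X₂ b) := by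
  have h1 : ∀ b m, star (R l a b m) • (X₁ m * X₂ b) =
      ∑ c, ∑ n, (star (R l a b m) * R m b c n) • (X₂ c * X₁ n) := by
    intro b m
    simp only [h.mixed, Finset.smul_sum, smul_smul]
  simp only [h1]
  have h2 : ∑ b, ∑ m, ∑ c, ∑ n, (star (R l a b m) * R m b c n) • (X₂ c * X₁ n) =
      ∑ c, ∑ n, (∑ b, ∑ m, star (R l a b m) * R m b c n) • (X₂ c * X₁ n) := by
    simp only [Finset.sum_smul]
    rw [Finset.sum_congr rfl fun b _ => Finset.sum_comm, Finset.sum_comm]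
    refine Finset.sum_congr rfl fun c _ => ?_
    rw [Finset.sum_congr rfl fun b _ => Finset.sum_comm, Finset.sum_comm]
  rw [h2]
  simp only [hR.real, ite_and, ite_smul, one_smul, zero_smul]
  simp

/-- Moving `X₁ l` past both factors of each square leaves a contraction of two copies of `R`, which
`central₂` evaluates. -/
theorem Exchange.commute₁ (h : Exchange R X₁ X₂) (hR : Admissible R) (l : Fin N₁) :
    Commute (∑ a, X₂ a ^ 2) (X₁ l) := by
  symm
  have h1 : ∀ a, X₁ l * X₂ a ^ 2 =
      ∑ b, ∑ r, ∑ c, ∑ m, (R l a b r * R r a c m) • (X₂ b * X₂ c * X₁ m) := by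
    intro a
    rw [sq, ← mul_assoc, h.mixed, Finset.sum_mul]
    refine Finset.sum_congr rfl fun b _ => ?_
    rw [Finset.sum_mul]
    refine Finset.sum_congr rfl fun r _ => ?_
    rw [smul_mul_assoc, mul_assoc, h.mixed, Finset.mul_sum, Finset.smul_sum]
    refine Finset.sum_congr rfl fun c _ => ?_
    rw [Finset.mul_sum, Finset.smul_sum]
    refine Finset.sum_congr rfl fun m _ => ?_
    rw [mul_smul_comm, smul_smul, mul_assoc]
  have h2 : ∑ a, ∑ b, ∑ r, ∑ c, ∑ m, (R l a b r * R r a c m) • (X₂ b * X₂ c * X₁ m) =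
      ∑ b, ∑ c, ∑ m, (∑ a, ∑ r, R l a b r * R r a c m) • (X₂ b * X₂ c * X₁ m) := by
    rw [Finset.sum_comm]
    refine Finset.sum_congr rfl fun b _ => ?_
    rw [Finset.sum_congr rfl fun a _ => Finset.sum_comm, Finset.sum_comm]
    refine Finset.sum_congr rfl fun c _ => ?_
    rw [Finset.sum_congr rfl fun a _ => Finset.sum_comm, Finset.sum_comm]
    refine Finset.sum_congr rfl fun m _ => ?_
    simp only [Finset.sum_smul]
  rw [Commute, SemiconjBy, Finset.mul_sum, Finset.sum_mul]
  simp only [h1]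
  rw [h2]
  simp only [hR.central₂, ite_and, ite_smul, one_smul, zero_smul]
  simp [sq]

theorem Exchange.commute₂ (h : Exchange R X₁ X₂) (hR : Admissible R) (c : Fin N₂) :
    Commute (∑ l, X₁ l ^ 2) (X₂ c) := by
  have h1 : ∀ l, X₁ l ^ 2 * X₂ c =
      ∑ b, ∑ n, ∑ a, ∑ m, (R l c b n * R l b a m) • (X₂ a * X₁ m * X₁ n) := by
    intro l
    rw [sq, mul_assoc, h.mixed, Finset.mul_sum]
    refine Finset.sum_congr rfl fun b _ => ?_
    rw [Finset.mul_sum]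
    refine Finset.sum_congr rfl fun n _ => ?_
    rw [mul_smul_comm, ← mul_assoc, h.mixed, Finset.sum_mul, Finset.smul_sum]
    refine Finset.sum_congr rfl fun a _ => ?_
    rw [Finset.sum_mul, Finset.smul_sum]
    refine Finset.sum_congr rfl fun m _ => ?_
    rw [smul_mul_assoc, smul_smul, mul_assoc]
  have h2 : ∑ l, ∑ b, ∑ n, ∑ a, ∑ m, (R l c b n * R l b a m) • (X₂ a * X₁ m * X₁ n) =
      ∑ n, ∑ a, ∑ m, (∑ l, ∑ b, R l c b n * R l b a m) • (X₂ a * X₁ m * X₁ n) := by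
    rw [Finset.sum_congr rfl fun l _ => Finset.sum_comm, Finset.sum_comm]
    refine Finset.sum_congr rfl fun n _ => ?_
    rw [Finset.sum_congr rfl fun l _ => Finset.sum_comm, Finset.sum_comm]
    refine Finset.sum_congr rfl fun a _ => ?_
    rw [Finset.sum_congr rfl fun l _ => Finset.sum_comm, Finset.sum_comm]
    refine Finset.sum_congr rfl fun m _ => ?_
    simp only [Finset.sum_smul]
  rw [Commute, SemiconjBy, Finset.mul_sum, Finset.sum_mul]
  simp only [h1]
  rw [h2]
  simp only [hR.central₁, ite_and, ite_smul, one_smul, zero_smul]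
  simp [sq, mul_assoc]

theorem algR_induction (S : Subalgebra ℂ (AlgR R)) (h₁ : ∀ l, x₁ R l ∈ S) (h₂ : ∀ a, x₂ R a ∈ S)
    (u : AlgR R) : u ∈ S := by
  obtain ⟨v, rfl⟩ := algMk_surjective R u
  exact FreeAlgebra.induction (R := ℂ) (X := Fin N₁ ⊕ Fin N₂)
    (motive := fun v => algMk R v ∈ S)
    (fun c => (AlgHom.commutes (algMk R) c).symm ▸ S.algebraMap_mem c)
    (by rintro (l | a); exacts [algMk_f₁ R l ▸ h₁ l, algMk_f₂ R a ▸ h₂ a])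
    (fun a b ha hb => (map_mul (algMk R) a b).symm ▸ S.mul_mem ha hb)
    (fun a b ha hb => (map_add (algMk R) a b).symm ▸ S.add_mem ha hb)
    v

theorem normSq_central (hR : Admissible R) (u : AlgR R) : Commute (normSq R) u := by
  have h := exchange_algR R
  refine (Subalgebra.mem_centralizer_iff ℂ (s := {normSq R})).mp
    (algR_induction (Subalgebra.centralizer ℂ {normSq R}) ?_ ?_ u) _ rfl
  · intro l
    rw [Subalgebra.mem_centralizer_iff]
    rintro _ rfl
    refine Commute.add_left (Commute.sum_left _ _ _ fun m _ => ?_) (h.commute₁ hR l)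
    exact Commute.pow_left (h.comm₁ m l) 2
  · intro a
    rw [Subalgebra.mem_centralizer_iff]
    rintro _ rfl
    refine Commute.add_left (h.commute₂ hR a) (Commute.sum_left _ _ _ fun m _ => ?_)
    exact Commute.pow_left (h.comm₂ m a) 2

/-- The map out of the free algebra determined by the images of the generators. -/
def freeLift (X₁ : Fin N₁ → B) (X₂ : Fin N₂ → B) : Free N₁ N₂ →ₐ[ℂ] B :=
  FreeAlgebra.lift ℂ (Sum.elim X₁ X₂)

theorem freeLift_f₁ (l : Fin N₁) : freeLift X₁ X₂ (f₁ l) = X₁ l :=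
  FreeAlgebra.lift_ι_apply _ _

theorem freeLift_f₂ (a : Fin N₂) : freeLift X₁ X₂ (f₂ a) = X₂ a :=
  FreeAlgebra.lift_ι_apply _ _

/-- The universal property of `A_R`. -/
def algLift (hR : Admissible R) (h : Exchange R X₁ X₂) : AlgR R →ₐ[ℂ] B :=
  RingQuot.liftAlgHom ℂ ⟨freeLift X₁ X₂, by
    intro u v huv
    cases huv with
    | comm₁ l m => simp only [map_mul, freeLift_f₁, h.comm₁ l m]
    | comm₂ a b => simp only [map_mul, freeLift_f₂, h.comm₂ a b]
    | mixed l a => simp only [map_mul, map_sum, map_smul, freeLift_f₁, freeLift_f₂, h.mixed]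
    | mixed' l a =>
      simp only [map_mul, map_sum, map_smul, freeLift_f₁, freeLift_f₂, h.mixed' hR l a]⟩

theorem algLift_algMk (hR : Admissible R) (h : Exchange R X₁ X₂) (u : Free N₁ N₂) :
    algLift hR h (algMk R u) = freeLift X₁ X₂ u :=
  RingQuot.liftAlgHom_mkAlgHom_apply ℂ _ _ _

theorem algLift_x₁ (hR : Admissible R) (h : Exchange R X₁ X₂) (l : Fin N₁) :
    algLift hR h (x₁ R l) = X₁ l := by
  rw [← algMk_f₁, algLift_algMk, freeLift_f₁]

theorem algLift_x₂ (hR : Admissible R) (h : Exchange R X₁ X₂) (a : Fin N₂) :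
    algLift hR h (x₂ R a) = X₂ a := by
  rw [← algMk_f₂, algLift_algMk, freeLift_f₂]

/-- The universal property of the algebra of the sphere. -/
def sphLift (hR : Admissible R) (h : Exchange R X₁ X₂)
    (h1 : ∑ l, X₁ l ^ 2 + ∑ a, X₂ a ^ 2 = 1) : Sphere R →ₐ[ℂ] B :=
  RingQuot.liftAlgHom ℂ ⟨algLift hR h, by
    intro u v huv
    cases huv
    simp only [normSq, map_add, map_sum, map_pow, algLift_x₁, algLift_x₂, h1, map_one]⟩

theorem sphLift_sphMk (hR : Admissible R) (h : Exchange R X₁ X₂)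
    (h1 : ∑ l, X₁ l ^ 2 + ∑ a, X₂ a ^ 2 = 1) (u : AlgR R) :
    sphLift hR h h1 (sphMk R u) = algLift hR h u :=
  RingQuot.liftAlgHom_mkAlgHom_apply ℂ _ _ _

/-- The coordinates on the sphere. -/
def coord (R : RMatrix N₁ N₂) : Fin N₁ ⊕ Fin N₂ → Sphere R :=
  Sum.elim (fun l => sphMk R (x₁ R l)) (fun a => sphMk R (x₂ R a))

theorem sphLift_coord (hR : Admissible R) (h : Exchange R X₁ X₂)
    (h1 : ∑ l, X₁ l ^ 2 + ∑ a, X₂ a ^ 2 = 1) (i : Fin N₁ ⊕ Fin N₂) :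
    sphLift hR h h1 (coord R i) = Sum.elim X₁ X₂ i := by
  rcases i with l | a
  · exact (sphLift_sphMk hR h h1 _).trans (algLift_x₁ hR h l)
  · exact (sphLift_sphMk hR h h1 _).trans (algLift_x₂ hR h a)

theorem exchange_coord (R : RMatrix N₁ N₂) :
    Exchange R (fun l => coord R (Sum.inl l)) (fun a => coord R (Sum.inr a)) :=
  (exchange_algR R).map (sphMk R)

theorem star_sphMk (u : AlgR R) : star (sphMk R u) = sphMk R (star u) := by
  have h := quotStarHom_mk (SphereRel R) (SphereRel.star_rel R) u
  rw [← RingQuot.mkAlgHom_coe ℂ (SphereRel R)] at h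
  exact congrArg MulOpposite.unop h

theorem star_coord (i : Fin N₁ ⊕ Fin N₂) : star (coord R i) = coord R i := by
  rcases i with l | a
  · exact (star_sphMk _).trans (congrArg _ (star_x₁ R l))
  · exact (star_sphMk _).trans (congrArg _ (star_x₂ R a))

theorem sum_coord_sq : ∑ i, coord R i * coord R i = 1 := by
  have h : sphMk R (normSq R) = sphMk R 1 := RingQuot.mkAlgHom_rel ℂ SphereRel.unit
  rw [map_one] at h
  rw [← h, Fintype.sum_sum_type, normSq]
  simp only [map_add, map_sum, map_mul, sq]
  rfl

theorem adjoin_coord : StarAlgebra.adjoin ℂ (Set.range (coord R)) = ⊤ := by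
  rw [eq_top_iff]
  rintro u -
  obtain ⟨v, rfl⟩ := sphMk_surjective R u
  refine algR_induction (Subalgebra.comap (sphMk R)
    (StarAlgebra.adjoin ℂ (Set.range (coord R))).toSubalgebra) ?_ ?_ v
  · exact fun l => StarAlgebra.subset_adjoin ℂ _ ⟨Sum.inl l, rfl⟩
  · exact fun a => StarAlgebra.subset_adjoin ℂ _ ⟨Sum.inr a, rfl⟩

end Presentation

/-! ### Characters of the sphere and its Chern characters for arbitrary admissible matrices. -/

section Characters

variable {N₁ N₂ : ℕ} {R : RMatrix N₁ N₂}

/-- The character of the sphere at the point `±e₀` of the first factor. -/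
def charFst (hR : Admissible R) (i : Fin N₁) (s : ℂ) (hs : s ^ 2 = 1) : Sphere R →ₐ[ℂ] ℂ :=
  sphLift hR (X₁ := Pi.single i s) (X₂ := 0)
    ⟨fun _ _ => mul_comm _ _, fun _ _ => mul_comm _ _, fun _ _ => by simp⟩ (by
      simp [Pi.single_apply, ite_pow, hs])

/-- The character of the sphere at the point `e₀` of the second factor. -/
def charSnd (hR : Admissible R) (a : Fin N₂) : Sphere R →ₐ[ℂ] ℂ :=
  sphLift hR (X₁ := 0) (X₂ := Pi.single a 1)
    ⟨fun _ _ => mul_comm _ _, fun _ _ => mul_comm _ _, fun _ _ => by simp⟩ (by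
      simp [Pi.single_apply, ite_pow])

/-- Half the difference of two antipodal evaluations kills even polynomials, in particular 1 and the
quadratic ones. The difference between points of the two factors kills 1 but sees a square. -/
theorem detects_coord (hR : Admissible R) (i : Fin N₁) (a : Fin N₂) :
    Detects (coord R) (Sum.inl i)
      ((1 / 2 : ℂ) • ((charFst hR i 1 (by norm_num)).toLinearMap -
        (charFst hR i (-1) (by norm_num)).toLinearMap))
      ((charFst hR i 1 (by norm_num)).toLinearMap - (charSnd hR a).toLinearMap) where
  f_one := by simp
  f_lin j := by
    rcases j with l | b
    · simp [charFst, sphLift_coord, Pi.single_apply]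
      split_ifs <;> norm_num
    · simp [charFst, sphLift_coord]
  f_quad j k := by
    rcases j with l | b <;> rcases k with l' | b' <;>
    simp [charFst, sphLift_coord, Pi.single_apply]
    split_ifs <;> norm_num
  g_one := by simp
  g_quad := by simp [charFst, charSnd, sphLift_coord]

/-- Dimension at least two gives `1 ≤ m` in both parities, as the trace computation requires. -/
theorem isSphericalManifold_of_three_le (hN₁ : 0 < N₁) (hN₂ : 0 < N₂) (hN : 3 ≤ N₁ + N₂)
    (hR : Admissible R) : IsSphericalManifold (Sphere R) (N₁ + N₂ - 1) := by
  have hd := detects_coord hR ⟨0, hN₁⟩ ⟨0, hN₂⟩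
  rcases Nat.even_or_odd' (N₁ + N₂ - 1) with ⟨m, h | h⟩
  · obtain ⟨F, hF, h0, hm⟩ := exists_even_of_detects (coord R) star_coord sum_coord_sq _ _ _ hd m
      (by omega)
    obtain ⟨q, e, he, -⟩ := exists_sphericalProjection (coord R) star_coord sum_coord_sq
      adjoin_coord F hF m h0 hm
    exact Or.inl ⟨m, q, e, h, he⟩
  · obtain ⟨F, hF, h0, hm⟩ := exists_odd_of_detects (coord R) star_coord sum_coord_sq _ _ _
      (charFst hR ⟨0, hN₁⟩ 1 (by norm_num)).toLinearMap hd (by simp) m (by omega)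
    obtain ⟨q, e, he, -⟩ := exists_sphericalUnitary (coord R) star_coord sum_coord_sq
      adjoin_coord F hF m h0 hm
    exact Or.inr ⟨m, q, e, h, he⟩

/-- The two coordinates anticommute, so the square of their sum is $(x,x)=1$ and half of one plus
the sum is a projection. -/
theorem isSphericalManifold_circle {R : RMatrix 1 1} (hR : Admissible R)
    (h0 : R 0 0 0 0 = -1) : IsSphericalManifold (Sphere R) 1 := by
  have h := exchange_coord R
  set S := coord R (Sum.inl 0) + coord R (Sum.inr 0) with hS
  have hSS : S * S = 1 := by
    have h1 := h.mixed 0 0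
    have h2 := sum_coord_sq (R := R)
    simp only [Finset.univ_unique, Finset.sum_singleton, Fin.default_eq_zero, h0,
      Fintype.sum_sum_type] at h1 h2
    rw [hS, mul_add, add_mul, add_mul, h1, ← h2]
    module
  have hSs : star S = S := by rw [hS, star_add, star_coord, star_coord]
  obtain ⟨p, hp⟩ : ∃ p : Matrix (Fin 1) (Fin 1) (Sphere R), ∀ i j, p i j = (1 / 2 : ℂ) • (1 + S) :=
    ⟨Matrix.of fun _ _ => _, fun _ _ => rfl⟩
  have hps : star p = p := by
    ext i j
    have h2 : star (1 / 2 : ℂ) = 1 / 2 := by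
      rw [show (1 / 2 : ℂ) = ((1 / 2 : ℝ) : ℂ) by norm_num, Complex.star_def, Complex.conj_ofReal]
    simp only [Matrix.star_apply, hp, star_smul, star_add, star_one, hSs, h2]
  have hpp : p * p = p := by
    ext i j
    simp only [Matrix.mul_apply, hp, Finset.univ_unique, Finset.sum_singleton,
      smul_mul_smul_comm, mul_add, add_mul, mul_one, one_mul, hSS]
    module
  obtain ⟨hu1, hu2⟩ := projUnitary_unitary p hps hpp
  obtain ⟨c, hc, hc'⟩ := oddSeq_projUnitary (Sphere R) (Fin 1) 0
  obtain ⟨q, U, hU, -⟩ := exists_sphericalUnitary (coord R) star_coord sum_coord_sq adjoin_coord _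
    (oddSeq_mem _ hu1 hu2) 0 (by simp) (by
      rw [hc' p hps]
      refine smul_ne_zero hc fun h0 => ?_
      rw [oneTensor_trM] at h0
      have hd := detects_coord hR 0 0
      -- On $1\otimes p$ this functional takes the value $\frac12$: the first slot gives 1, and the
      -- odd functional sees only the first coordinate in $p$.
      have := congrArg (prodFunctional (Fin.cons (α := fun _ => Sphere R →ₗ[ℂ] ℂ)
          (charFst hR 0 1 (by norm_num)).toLinearMap (fun _ => _))
        (fun j hj => by
          obtain ⟨k, rfl⟩ := Fin.exists_succ_eq.mpr hj
          rw [Fin.cons_succ]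
          exact hd.f_one)) h0
      rw [prodFunctional_trM, map_zero, List.ofFn_succ, List.prod_cons, List.ofFn_succ,
        List.prod_cons, List.ofFn_zero, List.prod_nil, mul_one, Fin.cons_zero, Fin.cons_zero,
        Fin.cons_succ, Fin.cons_succ] at this
      simp only [Matrix.trace, Matrix.diag, Finset.univ_unique,
        Finset.sum_singleton, Matrix.mul_apply, Matrix.map_apply, Fin.default_eq_zero,
        Matrix.one_apply_eq, hp, map_smul, map_add, hd.f_one, hS, hd.f_lin] at this
      simp at this)
  exact Or.inr ⟨0, q, U, rfl, hU⟩

theorem eq_classicalR_or (R : RMatrix 1 1) (hR : Admissible R) :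
    R = classicalR 1 1 ∨ R 0 0 0 0 = -1 := by
  have h := hR.central₁ 0 0 0 0
  simp only [Finset.univ_unique, Finset.sum_singleton, Fin.default_eq_zero, true_and,
    if_true] at h
  rcases mul_self_eq_one_iff.mp h with h | h
  · left
    funext l a b m
    rw [Subsingleton.elim l 0, Subsingleton.elim a 0, Subsingleton.elim b 0,
      Subsingleton.elim m 0, h]
    simp [classicalR]
  · exact Or.inr h

end Characters

/-! ### Simultaneous diagonalization of commuting Hermitian matrices. -/

section Diagonalization

open Module.End in
-- Joint eigenspaces over all systems of eigenvalues are orthogonal and span, so their orthonormal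
-- bases together form one of the whole space.
theorem exists_joint_eigenbasis {E : Type*} [NormedAddCommGroup E] [InnerProductSpace ℂ E]
    [FiniteDimensional ℂ E] {ι : Type*} (T : ι → E →ₗ[ℂ] E) (hT : ∀ i, (T i).IsSymmetric)
    (hc : ∀ i j, Commute (T i) (T j)) (n : ℕ) (hn : Module.finrank ℂ E = n) :
    ∃ (v : OrthonormalBasis (Fin n) ℂ E) (d : ι → Fin n → ℂ), ∀ i r, T i (v r) = d i r • v r := by
  classical
  have hO := LinearMap.IsSymmetric.orthogonalFamily_iInf_eigenspaces hT
  have hS := LinearMap.IsSymmetric.iSup_iInf_eq_top_of_commute hT (fun i j _ => hc i j)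
  let W : (ι → ℂ) → Submodule ℂ E := fun χ => ⨅ i, eigenspace (T i) (χ i)
  let w : (a : Σ χ : ι → ℂ, Fin (Module.finrank ℂ (W χ))) → E :=
    fun a => (stdOrthonormalBasis ℂ (W a.1) a.2 : E)
  have hw : Orthonormal ℂ w := hO.orthonormal_sigma_orthonormal
    (v_family := fun χ => stdOrthonormalBasis ℂ (W χ))
    (fun χ => (stdOrthonormalBasis ℂ (W χ)).orthonormal)
  have hsp : ⊤ ≤ Submodule.span ℂ (Set.range w) := by
    rw [← hS, iSup_le_iff]
    intro χ x hx
    have h1 := (stdOrthonormalBasis ℂ (W χ)).sum_repr ⟨x, hx⟩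
    have h2 := congrArg (Subtype.val) h1
    rw [← show _ = x from h2, Submodule.coe_sum]
    refine Submodule.sum_mem _ fun r _ => Submodule.smul_mem _ _ ?_
    exact Submodule.subset_span ⟨⟨χ, r⟩, rfl⟩
  -- Although there are infinitely many candidate systems of eigenvalues, linear independence leaves
  -- only finitely many basis vectors.
  have : Finite (Σ χ : ι → ℂ, Fin (Module.finrank ℂ (W χ))) :=
    hw.linearIndependent.finite
  let _ := Fintype.ofFinite (Σ χ : ι → ℂ, Fin (Module.finrank ℂ (W χ)))
  let B := OrthonormalBasis.mk hw hsp
  have hcard : Fintype.card (Σ χ : ι → ℂ, Fin (Module.finrank ℂ (W χ))) = n := by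
    rw [← hn, Module.finrank_eq_card_basis B.toBasis]
  let e := Fintype.equivFinOfCardEq hcard
  refine ⟨B.reindex e, fun i r => (e.symm r).1 i, fun i r => ?_⟩
  rw [OrthonormalBasis.reindex_apply, OrthonormalBasis.coe_mk]
  exact mem_eigenspace_iff.mp ((Submodule.mem_iInf _).mp
    (stdOrthonormalBasis ℂ (W (e.symm r).1) (e.symm r).2).2 i)

open Matrix in
/-- Commuting Hermitian matrices are simultaneously diagonalizable by a unitary. -/
theorem exists_unitary_diagonal {n : ℕ} {ι : Type*} (H : ι → Matrix (Fin n) (Fin n) ℂ)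
    (hH : ∀ i, (H i).IsHermitian) (hc : ∀ i j, H i * H j = H j * H i) :
    ∃ (V : Matrix (Fin n) (Fin n) ℂ) (d : ι → Fin n → ℂ), V * Vᴴ = 1 ∧
      ∀ i, H i = Vᴴ * diagonal (d i) * V := by
  obtain ⟨v, d, hv⟩ := exists_joint_eigenbasis (fun i => Matrix.toEuclideanLin (H i))
    (fun i => Matrix.isSymmetric_toEuclideanLin_iff.mpr (hH i)) (fun i j => by
      have h1 : ∀ i j, Matrix.toEuclideanLin (H i) ∘ₗ Matrix.toEuclideanLin (H j) =
          Matrix.toEuclideanLin (H i * H j) := by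
        intro i j
        ext x
        simp [Matrix.toLpLin_apply, Matrix.mulVec_mulVec]
      exact (h1 i j).trans ((congrArg _ (hc i j)).trans (h1 j i).symm)) n (by simp)
  let V : Matrix (Fin n) (Fin n) ℂ := Matrix.of fun r l => star (v r l)
  have hV : V * Vᴴ = 1 := by
    ext r s
    have h1 := orthonormal_iff_ite.mp v.orthonormal r s
    rw [PiLp.inner_apply] at h1
    rw [Matrix.one_apply, ← h1, Matrix.mul_apply]
    refine Finset.sum_congr rfl fun l _ => ?_
    simp [V, mul_comm]
  refine ⟨V, d, hV, fun i => ?_⟩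
  have h2 : H i * Vᴴ = Vᴴ * diagonal (d i) := by
    ext l r
    have h1 := congrArg (fun x => x l) (hv i r)
    simp only [Matrix.toLpLin_apply] at h1
    rw [Matrix.mul_diagonal, Matrix.mul_apply]
    simp only [V, Matrix.conjTranspose_apply, Matrix.of_apply, star_star]
    rw [mul_comm]
    exact h1
  rw [← h2, Matrix.mul_assoc, mul_eq_one_comm.mp hV, Matrix.mul_one]

end Diagonalization

/-! ### The diagonal form of an admissible matrix. -/

section Structure

open Matrix

variable {N₁ N₂ : ℕ} {R : RMatrix N₁ N₂}

/-- The matrix `R` as an operator on the tensor product. -/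
def RMat (R : RMatrix N₁ N₂) : Matrix (Fin N₁ × Fin N₂) (Fin N₁ × Fin N₂) ℂ :=
  Matrix.of fun p q => R p.1 p.2 q.2 q.1

theorem RMat_map_mul (hR : Admissible R) : (RMat R).map star * RMat R = 1 := by
  ext ⟨l, a⟩ ⟨n, c⟩
  have h := hR.real l a c n
  rw [Finset.sum_comm] at h
  simpa [Matrix.mul_apply, RMat, Fintype.sum_prod_type, Matrix.one_apply, Prod.ext_iff] using h

/-- The partial transpose, by `central₁`, and the complex conjugate, by reality, are both inverse to
`R` as an operator, hence equal. -/
theorem star_R_left (hR : Admissible R) (l : Fin N₁) (a b : Fin N₂) (m : Fin N₁) :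
    star (R l a b m) = R m a b l := by
  have h1 : (Matrix.of fun p q => R q.1 p.2 q.2 p.1 :
      Matrix (Fin N₁ × Fin N₂) (Fin N₁ × Fin N₂) ℂ) * RMat R = 1 := by
    ext ⟨n, c⟩ ⟨m, a⟩
    have h := hR.central₁ c n a m
    simpa [Matrix.mul_apply, RMat, Fintype.sum_prod_type, Matrix.one_apply, Prod.ext_iff,
      and_comm, eq_comm] using h
  have h2 := left_inv_eq_right_inv h1 (mul_eq_one_comm.mp (RMat_map_mul hR))
  exact (congrFun₂ h2 (l, a) (m, b)).symm

theorem star_R_right (hR : Admissible R) (l : Fin N₁) (a b : Fin N₂) (m : Fin N₁) :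
    star (R l a b m) = R l b a m := by
  have h1 : (Matrix.of fun p q => R p.1 q.2 p.2 q.1 :
      Matrix (Fin N₁ × Fin N₂) (Fin N₁ × Fin N₂) ℂ) * RMat R = 1 := by
    ext ⟨l, b⟩ ⟨m, c⟩
    have h := hR.central₂ l b c m
    rw [Finset.sum_comm] at h
    simpa [Matrix.mul_apply, RMat, Fintype.sum_prod_type, Matrix.one_apply, Prod.ext_iff] using h
  have h2 := left_inv_eq_right_inv h1 (mul_eq_one_comm.mp (RMat_map_mul hR))
  exact (congrFun₂ h2 (l, a) (m, b)).symm

/-- The blocks of `R` acting on the first factor. -/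
def blk₁ (R : RMatrix N₁ N₂) (a b : Fin N₂) : Matrix (Fin N₁) (Fin N₁) ℂ :=
  Matrix.of fun l m => R l a b m

/-- The blocks of `R` acting on the second factor. -/
def blk₂ (R : RMatrix N₁ N₂) (l m : Fin N₁) : Matrix (Fin N₂) (Fin N₂) ℂ :=
  Matrix.of fun a b => R l a b m

/-- The two unitaries and the phases diagonalizing `R`. -/
structure Diagonalizes (R : RMatrix N₁ N₂) (u : Matrix (Fin N₁) (Fin N₁) ℂ)
    (v : Matrix (Fin N₂) (Fin N₂) ℂ) (t : Fin N₁ → Fin N₂ → ℂ) : Prop where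
  unitary₁ : u * uᴴ = 1
  unitary₂ : v * vᴴ = 1
  eq : ∀ l a b m, R l a b m =
    ∑ i, ∑ j, star (u i l) * u i m * (star (v j a) * v j b) * t i j

/-- The two conjugation symmetries say that each block is Hermitian, and the Yang–Baxter equations
that the blocks of either kind commute. Substituting one diagonalization into the other diagonalizes
both factors. -/
theorem exists_diagonalizes (hR : Admissible R) : ∃ u v t, Diagonalizes R u v t := by
  obtain ⟨u, d, hu, hd⟩ := exists_unitary_diagonal (fun p : Fin N₂ × Fin N₂ => blk₁ R p.1 p.2)
    (fun p => by
      ext l m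
      exact star_R_left hR m p.1 p.2 l)
    (fun p q => by
      ext l m
      simpa [Matrix.mul_apply, blk₁] using hR.yb₁ l p.1 q.1 p.2 q.2 m)
  obtain ⟨v, d', hv, hd'⟩ := exists_unitary_diagonal (fun p : Fin N₁ × Fin N₁ => blk₂ R p.1 p.2)
    (fun p => by
      ext a b
      exact star_R_right hR p.1 b a p.2)
    (fun p q => by
      ext a b
      simpa [Matrix.mul_apply, blk₂] using hR.yb₂ p.1 q.1 a b p.2 q.2)
  have hd1 : ∀ l a b m, R l a b m = ∑ i, star (u i l) * d (a, b) i * u i m := by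
    intro l a b m
    have := congrFun₂ (hd (a, b)) l m
    rw [Matrix.mul_apply] at this
    simp only [Matrix.mul_diagonal, conjTranspose_apply] at this
    exact this
  have hd2 : ∀ l a b m, R l a b m = ∑ j, star (v j a) * d' (l, m) j * v j b := by
    intro l a b m
    have := congrFun₂ (hd' (l, m)) a b
    rw [Matrix.mul_apply] at this
    simp only [Matrix.mul_diagonal, conjTranspose_apply] at this
    exact this
  have hu' : ∀ i k, ∑ l, u i l * star (u k l) = if i = k then 1 else 0 := by
    intro i k
    have := congrFun₂ hu i k
    simpa only [Matrix.mul_apply, conjTranspose_apply, Matrix.one_apply] using this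
  have hd3 : ∀ i a b, d (a, b) i = ∑ l, ∑ m, u i l * R l a b m * star (u i m) := by
    intro i a b
    have h1 : u * blk₁ R a b * uᴴ = diagonal (d (a, b)) := by
      rw [hd (a, b), Matrix.mul_assoc, Matrix.mul_assoc, hu, Matrix.mul_one, ← Matrix.mul_assoc,
        hu, Matrix.one_mul]
    have := congrFun₂ h1 i i
    rw [Matrix.diagonal_apply_eq] at this
    rw [← this, Matrix.mul_apply, Finset.sum_comm]
    simp only [Matrix.mul_apply, conjTranspose_apply, Finset.sum_mul, blk₁, of_apply]
  refine ⟨u, v, fun i j => ∑ l, ∑ m, u i l * d' (l, m) j * star (u i m), hu, hv, ?_⟩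
  intro l a b m
  rw [hd1]
  refine Finset.sum_congr rfl fun i _ => ?_
  rw [hd3]
  simp only [hd2, Finset.mul_sum, Finset.sum_mul]
  rw [Finset.sum_congr rfl fun l _ => Finset.sum_comm, Finset.sum_comm]
  refine Finset.sum_congr rfl fun j _ => Finset.sum_congr rfl fun l' _ =>
    Finset.sum_congr rfl fun m' _ => ?_
  ring

namespace Diagonalizes

variable {u : Matrix (Fin N₁) (Fin N₁) ℂ} {v : Matrix (Fin N₂) (Fin N₂) ℂ}
  {t : Fin N₁ → Fin N₂ → ℂ}

theorem RMat_eq (h : Diagonalizes R u v t) : RMat R =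
    (kroneckerMap (· * ·) u v)ᴴ * diagonal (fun p => t p.1 p.2) * kroneckerMap (· * ·) u v := by
  ext ⟨l, a⟩ ⟨m, b⟩
  rw [Matrix.mul_apply]
  simp only [Matrix.mul_diagonal, conjTranspose_apply, RMat, of_apply, h.eq l a b m,
    Fintype.sum_prod_type, kroneckerMap_apply, star_mul']
  refine Finset.sum_congr rfl fun i _ => Finset.sum_congr rfl fun j _ => ?_
  ring

/-- Both symmetries together identify the adjoint of `RMat R` with its entrywise conjugate, which
reality makes the inverse. So the operator is unitary and its eigenvalues are phases. -/
theorem phase (h : Diagonalizes R u v t) (hR : Admissible R) (i : Fin N₁) (j : Fin N₂) :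
    t i j * star (t i j) = 1 := by
  set W := kroneckerMap (· * ·) u v with hW
  have hWW : W * Wᴴ = 1 := by
    have := Matrix.mul_kronecker_mul u uᴴ v vᴴ
    rw [h.unitary₁, h.unitary₂, Matrix.one_kronecker_one] at this
    rw [this, Matrix.conjTranspose_kronecker]
  have h1 : (RMat R)ᴴ = (RMat R).map star := by
    ext ⟨l, a⟩ ⟨m, b⟩
    simp only [conjTranspose_apply, RMat, of_apply, map_apply]
    rw [star_R_left hR, star_R_right hR]
  have h2 : RMat R * (RMat R)ᴴ = 1 := by
    rw [h1]; exact mul_eq_one_comm.mp (RMat_map_mul hR)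
  have h3 : W * RMat R * Wᴴ = diagonal (fun p => t p.1 p.2) := by
    rw [h.RMat_eq, ← hW, Matrix.mul_assoc, Matrix.mul_assoc, hWW, Matrix.mul_one,
      ← Matrix.mul_assoc, hWW, Matrix.one_mul]
  have h4 : diagonal (fun p : Fin N₁ × Fin N₂ => t p.1 p.2) *
      (diagonal (fun p => t p.1 p.2))ᴴ = 1 := by
    rw [← h3, conjTranspose_mul, conjTranspose_mul, conjTranspose_conjTranspose]
    calc W * RMat R * Wᴴ * (W * ((RMat R)ᴴ * Wᴴ))
        = W * RMat R * (Wᴴ * W) * (RMat R)ᴴ * Wᴴ := by noncomm_ring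
      _ = 1 := by
        rw [mul_eq_one_comm.mp hWW, Matrix.mul_one, Matrix.mul_assoc W, h2, Matrix.mul_one, hWW]
  rw [diagonal_conjTranspose, diagonal_mul_diagonal] at h4
  have := congrFun₂ h4 (i, j) (i, j)
  simpa using this

/-- The real matrices obtained from `R` by diagonalizing the second factor only. -/
def Q (u : Matrix (Fin N₁) (Fin N₁) ℂ) (t : Fin N₁ → Fin N₂ → ℂ) (j : Fin N₂) :
    Matrix (Fin N₁) (Fin N₁) ℂ := uᴴ * diagonal (fun i => t i j) * u

theorem blk₂_eq (h : Diagonalizes R u v t) (l m : Fin N₁) :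
    blk₂ R l m = vᴴ * diagonal (fun j => Q u t j l m) * v := by
  ext a b
  rw [Matrix.mul_apply]
  simp only [Matrix.mul_diagonal, conjTranspose_apply, blk₂, of_apply, h.eq l a b m, Q]
  rw [Finset.sum_comm]
  refine Finset.sum_congr rfl fun j _ => ?_
  rw [Matrix.mul_apply, Finset.mul_sum, Finset.sum_mul]
  refine Finset.sum_congr rfl fun i _ => ?_
  simp only [Matrix.mul_diagonal, conjTranspose_apply]
  ring

/-- Each entry of `Q u t j` is an eigenvalue of a Hermitian block acting on the second factor. -/
theorem Q_real (h : Diagonalizes R u v t) (hR : Admissible R) (j : Fin N₂) :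
    (Q u t j).map star = Q u t j := by
  have h1 : ∀ l m, Q u t j l m = ∑ a, ∑ b, v j a * R l a b m * star (v j b) := by
    intro l m
    have h2 : v * blk₂ R l m * vᴴ = diagonal (fun j => Q u t j l m) := by
      rw [h.blk₂_eq, Matrix.mul_assoc, Matrix.mul_assoc, h.unitary₂, Matrix.mul_one,
        ← Matrix.mul_assoc, h.unitary₂, Matrix.one_mul]
    have := congrFun₂ h2 j j
    rw [Matrix.diagonal_apply_eq] at this
    rw [← this, Matrix.mul_apply, Finset.sum_comm]
    simp only [Matrix.mul_apply, conjTranspose_apply, Finset.sum_mul, blk₂, of_apply]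
  ext l m
  rw [map_apply, h1, star_sum, Finset.sum_congr rfl fun a _ => star_sum _ _, Finset.sum_comm]
  refine Finset.sum_congr rfl fun a _ => Finset.sum_congr rfl fun b _ => ?_
  rw [star_mul', star_mul', star_star, star_R_right hR]
  ring

/-- Writing $D$ for the diagonal matrix of the $t_{ij}$, comparing $Q=u^*Du$ with its conjugate
gives $D\,uu^T=uu^T\bar D$. A nonzero entry of $uu^T$ thus identifies one phase with the inverse of
the other. -/
theorem compat₁ (h : Diagonalizes R u v t) (hR : Admissible R) (i k : Fin N₁)
    (hik : (u * uᵀ) i k ≠ 0) (j : Fin N₂) : t i j * t k j = 1 := by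
  have hu' : uᴴᵀ * uᵀ = 1 := by
    rw [← transpose_mul, h.unitary₁, transpose_one]
  have h0 : Q u t j = uᵀ * diagonal (fun i => star (t i j)) * uᴴᵀ := by
    rw [← h.Q_real hR j]
    ext l m
    rw [map_apply, Q, Matrix.mul_apply, Matrix.mul_apply]
    simp only [Matrix.mul_diagonal, conjTranspose_apply, transpose_apply, star_sum, star_mul',
      star_star]
  have h1 : diagonal (fun i => t i j) * (u * uᵀ) =
      (u * uᵀ) * diagonal (fun i => star (t i j)) := by
    calc diagonal (fun i => t i j) * (u * uᵀ) = u * uᴴ * diagonal (fun i => t i j) * (u * uᵀ) := by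
          rw [h.unitary₁, Matrix.one_mul]
      _ = u * Q u t j * uᵀ := by rw [Q]; simp only [Matrix.mul_assoc]
      _ = u * uᵀ * diagonal (fun i => star (t i j)) * (uᴴᵀ * uᵀ) := by
          rw [h0]; simp only [Matrix.mul_assoc]
      _ = _ := by rw [hu', Matrix.mul_one]
  have h2 := congrFun₂ h1 i k
  rw [Matrix.diagonal_mul, Matrix.mul_diagonal, mul_comm] at h2
  have h3 := mul_left_cancel₀ hik h2
  rw [h3, mul_comm, h.phase hR]

theorem det_Q (h : Diagonalizes R u v t) (j : Fin N₂) : (Q u t j).det = ∏ i, t i j := by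
  have h1 := congrArg Matrix.det h.unitary₁
  rw [det_mul, det_one] at h1
  rw [Q, det_mul, det_mul, det_diagonal]
  linear_combination (∏ i, t i j) * h1

/-- The product is the determinant of a real matrix and has modulus one. -/
theorem det_sq (h : Diagonalizes R u v t) (hR : Admissible R) (j : Fin N₂) :
    (∏ i, t i j) * ∏ i, t i j = 1 := by
  have h1 : star (∏ i, t i j) = ∏ i, t i j := by
    rw [← h.det_Q, ← h.Q_real hR j]
    rw [h.Q_real hR j]
    exact ((starRingEnd ℂ).map_det (Q u t j)).trans (congrArg det (h.Q_real hR j))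
  have h2 : (∏ i, t i j) * star (∏ i, t i j) = 1 := by
    rw [star_prod, ← Finset.prod_mul_distrib]
    exact Finset.prod_eq_one fun i _ => h.phase hR i j
  rwa [h1] at h2

end Diagonalizes

end Structure

/-! ### Symmetry between the two factors. -/

section Swap

variable {N₁ N₂ : ℕ} {R : RMatrix N₁ N₂}

/-- Exchange of the two factors. -/
def swapR (R : RMatrix N₁ N₂) : RMatrix N₂ N₁ := fun a l m b => R l a b m

theorem Admissible.swap (hR : Admissible R) : Admissible (swapR R) where
  real l a c n := by
    have := hR.real a l n c
    rw [Finset.sum_comm] at this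
    simpa only [swapR, and_comm] using this
  yb₁ l a b c d m := hR.yb₂ a b l m c d
  yb₁' l a b c d m := hR.yb₂' a b l m c d
  yb₁'' l a b c d m := (hR.yb₂'' b a l m d c).symm
  yb₂ l m a b n r := hR.yb₁ a l m n r b
  yb₂' l m a b n r := hR.yb₁' a l m n r b
  yb₂'' l m a b n r := (hR.yb₁'' a m l r n b).symm
  central₁ c n a m := by
    have := hR.central₂ c n m a
    simpa only [swapR, eq_comm (a := n)] using this
  central₂ l b c m := by
    have := hR.central₁ l b m c
    rw [Finset.sum_congr rfl fun _ _ => rfl] at this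
    simpa only [swapR, eq_comm (a := c)] using this

theorem swapR_classicalR : swapR (classicalR N₁ N₂) = classicalR N₂ N₁ := by
  funext a l m b
  simp only [swapR, classicalR, and_comm]

theorem continuous_swapR : Continuous (swapR : RMatrix N₁ N₂ → RMatrix N₂ N₁) := by
  unfold swapR
  fun_prop

theorem Diagonalizes.swap {u : Matrix (Fin N₁) (Fin N₁) ℂ} {v : Matrix (Fin N₂) (Fin N₂) ℂ}
    {t : Fin N₁ → Fin N₂ → ℂ} (h : Diagonalizes R u v t) :
    Diagonalizes (swapR R) v u (fun j i => t i j) where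
  unitary₁ := h.unitary₂
  unitary₂ := h.unitary₁
  eq a l m b := by
    rw [swapR, h.eq, Finset.sum_comm]
    refine Finset.sum_congr rfl fun _ _ => Finset.sum_congr rfl fun _ _ => ?_
    ring

end Swap

/-! ### Determinants on the classical component. -/

section Determinant

open Matrix

variable {N₁ N₂ : ℕ} {R : RMatrix N₁ N₂}

/-- The trace over the second factor of the determinant over the first factor. -/
def traceDet (R : RMatrix N₁ N₂) : ℂ :=
  ∑ σ : Equiv.Perm (Fin N₁), ((Equiv.Perm.sign σ : ℤ) : ℂ) *
    Matrix.trace (List.ofFn fun l => blk₂ R l (σ l)).prod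

theorem continuous_list_prod_ofFn {X M : Type*} [TopologicalSpace X] [TopologicalSpace M]
    [Monoid M] [ContinuousMul M] : ∀ {n : ℕ} (f : Fin n → X → M) (_ : ∀ i, Continuous (f i)),
    Continuous fun x => (List.ofFn fun i => f i x).prod
  | 0, f, _ => by simpa using continuous_const
  | n + 1, f, hf => by
    simp only [List.ofFn_succ, List.prod_cons]
    exact (hf 0).mul (continuous_list_prod_ofFn (fun i => f i.succ) fun i => hf i.succ)

theorem continuous_traceDet : Continuous (traceDet : RMatrix N₁ N₂ → ℂ) := by
  unfold traceDet
  refine continuous_finsetSum _ fun σ _ => continuous_const.mul (Continuous.matrix_trace ?_)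
  refine continuous_list_prod_ofFn (fun l (R : RMatrix N₁ N₂) => blk₂ R l (σ l)) fun l => ?_
  refine continuous_matrix fun a b => ?_
  simp only [blk₂, of_apply]
  fun_prop

theorem prod_conj_diagonal {κ : Type*} [Fintype κ] [DecidableEq κ] (v : Matrix κ κ ℂ)
    (hv : v * vᴴ = 1) : ∀ {n : ℕ} (d : Fin n → κ → ℂ),
    (List.ofFn fun l => vᴴ * diagonal (d l) * v).prod = vᴴ * diagonal (fun j => ∏ l, d l j) * v
  | 0, d => by simp [mul_eq_one_comm.mp hv]
  | n + 1, d => by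
    rw [List.ofFn_succ, List.prod_cons, prod_conj_diagonal v hv]
    simp only [Fin.prod_univ_succ]
    rw [← diagonal_mul_diagonal]
    calc _ = vᴴ * diagonal (d 0) * (v * vᴴ) * diagonal (fun j => ∏ l : Fin n, d l.succ j) * v := by
          simp only [Matrix.mul_assoc]
      _ = _ := by rw [hv, Matrix.mul_one]; simp only [Matrix.mul_assoc]

/-- The same `v` diagonalizes all blocks, so the trace of the noncommutative determinant is the sum
over `j` of the determinants of `Q u t j`. The left side is visibly continuous in `R`, although the
diagonalization need not be. -/
theorem Diagonalizes.traceDet_eq {u : Matrix (Fin N₁) (Fin N₁) ℂ} {v : Matrix (Fin N₂) (Fin N₂) ℂ}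
    {t : Fin N₁ → Fin N₂ → ℂ} (h : Diagonalizes R u v t) :
    traceDet R = ∑ j, ∏ i, t i j := by
  have h1 : ∀ σ : Equiv.Perm (Fin N₁), Matrix.trace (List.ofFn fun l => blk₂ R l (σ l)).prod =
      ∑ j, ∏ l, Q u t j l (σ l) := by
    intro σ
    simp only [h.blk₂_eq]
    rw [prod_conj_diagonal v h.unitary₂ (fun l j => Q u t j l (σ l)), Matrix.trace_mul_comm,
      ← Matrix.mul_assoc, h.unitary₂, Matrix.one_mul, Matrix.trace_diagonal]
  simp only [traceDet, h1, Finset.mul_sum]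
  rw [Finset.sum_comm]
  refine Finset.sum_congr rfl fun j _ => ?_
  rw [← h.det_Q, ← det_transpose, det_apply']
  rfl

theorem diagonalizes_classicalR :
    Diagonalizes (classicalR N₁ N₂) 1 1 (fun _ _ => 1) where
  unitary₁ := by simp
  unitary₂ := by simp
  eq l a b m := by
    simp [classicalR, Matrix.one_apply, apply_ite star, ite_and, eq_comm]
    split_ifs <;> rfl

/-- A sum of `N₂` signs takes finitely many values, hence is constant on a connected set. Its
classical value `N₂` is the maximum, which forces each sign to be `1`. -/
theorem det_eq_one_of_isPreconnected {C : Set (RMatrix N₁ N₂)} (hC : IsPreconnected C)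
    (hadm : ∀ Q ∈ C, Admissible Q) (h0 : classicalR N₁ N₂ ∈ C) (hR : R ∈ C)
    {u : Matrix (Fin N₁) (Fin N₁) ℂ} {v : Matrix (Fin N₂) (Fin N₂) ℂ}
    {t : Fin N₁ → Fin N₂ → ℂ} (h : Diagonalizes R u v t) (j : Fin N₂) : ∏ i, t i j = 1 := by
  have hpm : ∀ {Q : RMatrix N₁ N₂} {u v t}, Q ∈ C → Diagonalizes Q u v t → ∀ j,
      ∏ i, t i j = 1 ∨ ∏ i, t i j = -1 := fun hQ hd j =>
    mul_self_eq_one_iff.mp (hd.det_sq (hadm _ hQ) j)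
  let T : Set ℂ := (fun z : ℤ => (z : ℂ)) '' Set.Icc (-(N₂ : ℤ)) N₂
  have hT : IsDiscrete T := ((Set.finite_Icc _ _).image _).isDiscrete
  have hmaps : Set.MapsTo traceDet C T := by
    intro Q hQ
    obtain ⟨u, v, t, hd⟩ := exists_diagonalizes (hadm Q hQ)
    have h1 : ∀ j, ∃ z : ℤ, (-1 ≤ z ∧ z ≤ 1) ∧ ∏ i, t i j = z := by
      intro j
      rcases hpm hQ hd j with h | h
      · exact ⟨1, by norm_num, by simpa using h⟩
      · exact ⟨-1, by norm_num, by simpa using h⟩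
    choose z hz hz' using h1
    refine ⟨∑ j, z j, ⟨?_, ?_⟩, ?_⟩
    · have := Finset.card_nsmul_le_sum Finset.univ z (-1) (fun j _ => (hz j).1)
      simpa using this
    · have := Finset.sum_le_card_nsmul Finset.univ z 1 (fun j _ => (hz j).2)
      simpa using this
    · rw [hd.traceDet_eq]
      push_cast
      exact Finset.sum_congr rfl fun j _ => (hz' j).symm
  have h1 := hC.constant_of_mapsTo hT continuous_traceDet.continuousOn hmaps hR h0
  rw [h.traceDet_eq, diagonalizes_classicalR.traceDet_eq] at h1
  have h2 : ∑ j, (∏ i, t i j).re = ∑ _j : Fin N₂, (1 : ℝ) := by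
    rw [← Complex.re_sum, h1]
    simp
  have h3 := (Finset.sum_eq_sum_iff_of_le (fun j _ => by
    rcases hpm hR h j with h | h <;> rw [h] <;> simp)).mp h2 j (Finset.mem_univ j)
  rcases hpm hR h j with h | h
  · exact h
  · rw [h] at h3
    norm_num at h3

theorem det_eq_one_of_mem_connectedComponentIn
    (hR : R ∈ connectedComponentIn {Q : RMatrix N₁ N₂ | Admissible Q} (classicalR N₁ N₂))
    {u : Matrix (Fin N₁) (Fin N₁) ℂ} {v : Matrix (Fin N₂) (Fin N₂) ℂ}
    {t : Fin N₁ → Fin N₂ → ℂ} (h : Diagonalizes R u v t) :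
    (∀ j, ∏ i, t i j = 1) ∧ ∀ i, ∏ j, t i j = 1 := by
  have h0 : classicalR N₁ N₂ ∈ {Q : RMatrix N₁ N₂ | Admissible Q} := by
    by_contra h0
    rw [connectedComponentIn_eq_empty h0] at hR
    exact hR
  set C := connectedComponentIn {Q : RMatrix N₁ N₂ | Admissible Q} (classicalR N₁ N₂)
  have hC : IsPreconnected C := isPreconnected_connectedComponentIn
  have hadm : ∀ Q ∈ C, Admissible Q := fun Q hQ => connectedComponentIn_subset _ _ hQ
  have h0 : classicalR N₁ N₂ ∈ C := mem_connectedComponentIn h0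
  refine ⟨det_eq_one_of_isPreconnected hC hadm h0 hR h, ?_⟩
  refine det_eq_one_of_isPreconnected (hC.image _ continuous_swapR.continuousOn) ?_
    ⟨_, h0, swapR_classicalR⟩ ⟨R, hR, rfl⟩ h.swap
  rintro _ ⟨Q, hQ, rfl⟩
  exact (hadm Q hQ).swap

end Determinant

/-! ### Phases on all coordinates together. -/

section Twist

open Matrix

variable {K : Type*} [Fintype K] [DecidableEq K]

/-- A unitary change of coordinates together with a compatible bicharacter of phases. -/
structure Twist (U : Matrix K K ℂ) (τ : K → K → ℂ) : Prop where
  unitary : U * Uᴴ = 1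
  norm : ∀ k l, τ k l * star (τ k l) = 1
  diag : ∀ k, τ k k = 1
  compatL : ∀ k l, (U * Uᵀ) k l ≠ 0 → ∀ m, τ k m * τ l m = 1
  compatR : ∀ k l, (U * Uᵀ) k l ≠ 0 → ∀ m, τ m k * τ m l = 1
  detL : ∀ l, ∏ k, τ k l = 1
  detR : ∀ k, ∏ l, τ k l = 1

variable {N₁ N₂ : ℕ} {R : RMatrix N₁ N₂}

/-- The phases on the disjoint union of the two index sets. -/
def phases (t : Fin N₁ → Fin N₂ → ℂ) : Fin N₁ ⊕ Fin N₂ → Fin N₁ ⊕ Fin N₂ → ℂ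
  | Sum.inl i, Sum.inr j => t i j
  | _, _ => 1

/-- All phases sit on pairs ordered from the first factor to the second; the exchange factor of two
coordinates is then recovered as `τ k l * star (τ l k)`. -/
theorem Diagonalizes.twist {u : Matrix (Fin N₁) (Fin N₁) ℂ} {v : Matrix (Fin N₂) (Fin N₂) ℂ}
    {t : Fin N₁ → Fin N₂ → ℂ} (h : Diagonalizes R u v t) (hR : Admissible R)
    (h1 : ∀ j, ∏ i, t i j = 1) (h2 : ∀ i, ∏ j, t i j = 1) :
    Twist (fromBlocks u 0 0 v) (phases t) where
  unitary := by
    rw [fromBlocks_conjTranspose, fromBlocks_multiply]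
    simp [h.unitary₁, h.unitary₂]
  norm k l := by
    rcases k with i | j <;> rcases l with i' | j' <;> simp only [phases, star_one, mul_one]
    exact h.phase hR _ _
  diag k := by rcases k with i | j <;> rfl
  compatL k l hkl m := by
    rw [fromBlocks_transpose, fromBlocks_multiply] at hkl
    rcases k with i | j <;> rcases l with i' | j' <;> rcases m with i'' | j'' <;>
      simp only [phases, mul_one]
    · simp only [fromBlocks_apply₁₁, transpose_zero, Matrix.mul_zero, add_zero] at hkl
      exact h.compat₁ hR _ _ hkl _
    · simp at hkl
    · simp at hkl
  compatR k l hkl m := by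
    rw [fromBlocks_transpose, fromBlocks_multiply] at hkl
    rcases k with i | j <;> rcases l with i' | j' <;> rcases m with i'' | j'' <;>
      simp only [phases, mul_one]
    · simp at hkl
    · simp at hkl
    · simp only [fromBlocks_apply₂₂, transpose_zero, Matrix.mul_zero, zero_add] at hkl
      exact h.swap.compat₁ hR.swap _ _ hkl _
  detL l := by
    rcases l with i | j <;> simp [phases, h1]
  detR k := by
    rcases k with i | j <;> simp [phases, h2]

end Twist

/-! ### Fermionic Fock spaces. -/

section Fock

open Matrix

/-- Creation operators `θ` and second quantizations `S` of diagonal operators. -/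
structure Fock (K κ : Type*) [Fintype κ] [DecidableEq κ] [DecidableEq K] where
  θ : K → Matrix κ κ ℂ
  S : (K → ℂ) →* Matrix κ κ ℂ
  anti : ∀ k l, θ k * θ l + θ l * θ k = 0
  car : ∀ k l, θ k * star (θ l) + star (θ l) * θ k = if k = l then 1 else 0
  S_θ : ∀ t k, S t * θ k = t k • (θ k * S t)
  star_S : ∀ t, star (S t) = S (star t)

/-- Adding a mode doubles the space: the new creation operator maps the first copy to the second,
and the old ones change sign on the second copy so as to anticommute with it. -/
theorem exists_fock_fin : ∀ n : ℕ, ∃ (κ : Type) (_ : Fintype κ) (_ : DecidableEq κ)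
    (Φ : Fock (Fin n) κ), (List.ofFn Φ.θ).prod ≠ 0
  | 0 => ⟨Unit, inferInstance, inferInstance,
      ⟨fun k => k.elim0, 1, fun k => k.elim0, fun k => k.elim0, fun _ k => k.elim0,
        fun _ => by simp⟩, by simp⟩
  | n + 1 => by
    obtain ⟨κ, _, _, Φ, h⟩ := exists_fock_fin n
    let θ' : Fin (n + 1) → Matrix (κ ⊕ κ) (κ ⊕ κ) ℂ :=
      Fin.cons (fromBlocks 0 0 1 0) (fun k => fromBlocks (Φ.θ k) 0 0 (-Φ.θ k))
    let S₀ : (Fin (n + 1) → ℂ) →* Matrix κ κ ℂ := Φ.S.comp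
      { toFun := fun t k => t k.succ, map_one' := rfl, map_mul' := fun _ _ => rfl }
    have hS₀ : ∀ t k, S₀ t * Φ.θ k = t k.succ • (Φ.θ k * S₀ t) := fun t k => Φ.S_θ _ _
    have hS₀' : ∀ t, star (S₀ t) = S₀ (star t) := fun t => Φ.star_S _
    let S' : (Fin (n + 1) → ℂ) →* Matrix (κ ⊕ κ) (κ ⊕ κ) ℂ :=
      { toFun := fun t => fromBlocks (S₀ t) 0 0 (t 0 • S₀ t)
        map_one' := by simp [fromBlocks_one]
        map_mul' := fun s t => by simp [fromBlocks_multiply, smul_smul, mul_comm] }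
    refine ⟨κ ⊕ κ, inferInstance, inferInstance, ⟨θ', S', ?_, ?_, ?_, ?_⟩, ?_⟩
    · intro k l
      refine Fin.cases ?_ (fun k => ?_) k <;> refine Fin.cases ?_ (fun l => ?_) l <;>
        simp [θ', fromBlocks_multiply, fromBlocks_add, Φ.anti]
    · intro k l
      refine Fin.cases ?_ (fun k => ?_) k <;> refine Fin.cases ?_ (fun l => ?_) l <;>
        simp only [θ', Fin.cons_zero, Fin.cons_succ, star_eq_conjTranspose,
          fromBlocks_conjTranspose, fromBlocks_multiply, fromBlocks_add]
      · simp [fromBlocks_one]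
      · simp [(Fin.succ_ne_zero _).symm]
      · simp [Fin.succ_ne_zero]
      · have := Φ.car k l
        rw [star_eq_conjTranspose] at this
        by_cases hkl : k = l
        · simp [hkl] at this ⊢
          simp [this, fromBlocks_one]
        · simp [hkl] at this ⊢
          simp [this]
    · intro t k
      refine Fin.cases ?_ (fun k => ?_) k
      · simp [θ', S', fromBlocks_multiply, fromBlocks_smul]
      · simp [θ', S', fromBlocks_multiply, fromBlocks_smul, hS₀, smul_smul, mul_comm]
    · intro t
      have h1 := hS₀' t
      rw [star_eq_conjTranspose] at h1
      simp [S', star_eq_conjTranspose, fromBlocks_conjTranspose, conjTranspose_smul, h1]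
    -- The new creation operator moves the upper block of this product to the lower left corner, so
    -- the sign `s` on the second copy is immaterial.
    · have h1 : ∃ s : ℂ, (List.ofFn fun k : Fin n => fromBlocks (Φ.θ k) 0 0 (-Φ.θ k)).prod =
          fromBlocks (List.ofFn Φ.θ).prod 0 0 (s • (List.ofFn Φ.θ).prod) := by
        have : ∀ L : List (Matrix κ κ ℂ), ∃ s : ℂ,
            (L.map fun x => fromBlocks x 0 0 (-x)).prod = fromBlocks L.prod 0 0 (s • L.prod) := by
          intro L
          induction L with
          | nil => exact ⟨1, by simp [fromBlocks_one]⟩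
          | cons x L ih =>
            obtain ⟨s, hs⟩ := ih
            exact ⟨-s, by simp [hs, fromBlocks_multiply]⟩
        obtain ⟨s, hs⟩ := this (List.ofFn Φ.θ)
        rw [List.map_ofFn] at hs
        exact ⟨s, hs⟩
      obtain ⟨s, hs⟩ := h1
      rw [List.ofFn_succ, List.prod_cons]
      simp only [θ', Fin.cons_zero, Fin.cons_succ, hs, fromBlocks_multiply]
      intro h0
      apply h
      have := congrArg toBlocks₂₁ h0
      rw [toBlocks_fromBlocks₂₁] at this
      rw [show toBlocks₂₁ (0 : Matrix (κ ⊕ κ) (κ ⊕ κ) ℂ) = 0 from rfl] at this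
      simpa using this

/-- Transport of the creation operators along a bijection. -/
def Fock.reindex {K K' κ : Type*} [Fintype κ] [DecidableEq κ] [DecidableEq K] [DecidableEq K']
    (Φ : Fock K' κ) (e : K ≃ K') : Fock K κ where
  θ k := Φ.θ (e k)
  S := Φ.S.comp { toFun := fun t k => t (e.symm k), map_one' := rfl, map_mul' := fun _ _ => rfl }
  anti k l := Φ.anti _ _
  car k l := by simp [Φ.car]
  S_θ t k := by simp [Φ.S_θ]
  star_S t := Φ.star_S _

theorem exists_fock {K : Type*} [DecidableEq K] {n : ℕ} (e : Fin n ≃ K) :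
    ∃ (κ : Type) (_ : Fintype κ) (_ : DecidableEq κ) (Φ : Fock K κ),
      (List.ofFn fun i => Φ.θ (e i)).prod ≠ 0 := by
  obtain ⟨κ, i1, i2, Φ, h⟩ := exists_fock_fin n
  exact ⟨κ, i1, i2, Φ.reindex e.symm, by simpa [Fock.reindex] using h⟩

end Fock

/-! ### Reordering words and alternating forms. -/

section Words

variable {B : Type*} [Ring B] [Algebra ℂ B]

theorem mul_prod_ofFn (y : B) : ∀ {n : ℕ} (x : Fin n → B) (c : Fin n → ℂ)
    (_ : ∀ i, y * x i = c i • (x i * y)),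
    y * (List.ofFn x).prod = (∏ i, c i) • ((List.ofFn x).prod * y)
  | 0, x, c, _ => by simp
  | n + 1, x, c, h => by
    rw [List.ofFn_succ, List.prod_cons, ← mul_assoc, h, smul_mul_assoc, mul_assoc,
      mul_prod_ofFn y _ (fun i => c i.succ) (fun i => h i.succ), Fin.prod_univ_succ, mul_smul_comm,
      smul_smul, mul_assoc]

/-- Collecting the second entries of a word of twice as many letters at its end. -/
theorem prod_ofFn_mul {M : Type*} [CommMonoid M] (S : M →* B) :
    ∀ {n : ℕ} (x : Fin n → B) (t : Fin n → M) (c : Fin n → Fin n → ℂ)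
    (_ : ∀ i j, i < j → S (t i) * x j = c i j • (x j * S (t i))),
    (List.ofFn fun i => x i * S (t i)).prod =
      (∏ i, ∏ j, if i < j then c i j else 1) • ((List.ofFn x).prod * S (∏ i, t i))
  | 0, x, t, c, _ => by simp
  | n + 1, x, t, c, h => by
    rw [List.ofFn_succ, List.prod_cons, prod_ofFn_mul S (fun i => x i.succ) (fun i => t i.succ)
      (fun i j => c i.succ j.succ) (fun i j hij => h _ _ (Fin.succ_lt_succ_iff.mpr hij)),
      mul_smul_comm, mul_assoc, ← mul_assoc (S (t 0)),
      mul_prod_ofFn (S (t 0)) _ (fun j => c 0 j.succ) (fun j => h _ _ (Fin.succ_pos j)),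
      smul_mul_assoc, mul_smul_comm, smul_smul, Fin.prod_univ_succ (n := n), List.ofFn_succ,
      List.prod_cons, Fin.prod_univ_succ (fun i => t i), map_mul]
    have h1 : ∀ i : Fin n, (∏ j, if i.succ < j then c i.succ j else 1) =
        ∏ j : Fin n, if i < j then c i.succ j.succ else 1 := by
      intro i
      rw [Fin.prod_univ_succ]
      simp
    have h2 : (∏ j, if 0 < j then c 0 j else 1) = ∏ j : Fin n, c 0 j.succ := by
      rw [Fin.prod_univ_succ]
      simp
    simp only [h1, h2, mul_assoc]
    congr 1
    ring

/-- A function on permutations that changes sign under adjacent transpositions. -/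
theorem sign_of_adjacent {M : Type*} [AddCommGroup M] {n : ℕ} (F : Equiv.Perm (Fin (n + 1)) → M)
    (h : ∀ σ (i : Fin n), F (σ * Equiv.swap i.castSucc i.succ) = -F σ)
    (σ : Equiv.Perm (Fin (n + 1))) : F σ = Equiv.Perm.sign σ • F 1 := by
  have hσ : σ ∈ Submonoid.closure (Set.range fun i : Fin n =>
      Equiv.swap i.castSucc i.succ) := by
    rw [Equiv.Perm.mclosure_swap_castSucc_succ]; trivial
  induction hσ using Submonoid.closure_induction_right with
  | one => simp
  | mul_right x hx y hy ih =>
    obtain ⟨i, rfl⟩ := hy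
    rw [h, ih, Equiv.Perm.sign_mul, Equiv.Perm.sign_swap (by simp [Fin.ext_iff]), mul_neg,
      mul_one, Units.neg_smul]

theorem ofFn_swap {α : Type*} : ∀ {n : ℕ} (v : Fin (n + 1) → α) (i : Fin n), ∃ l₁ l₂,
    List.ofFn v = l₁ ++ v i.castSucc :: v i.succ :: l₂ ∧
    List.ofFn (v ∘ Equiv.swap i.castSucc i.succ) = l₁ ++ v i.succ :: v i.castSucc :: l₂
  | 0, _, i => i.elim0
  | n + 1, v, i => by
    refine Fin.cases ?_ (fun i => ?_) i
    · refine ⟨[], List.ofFn fun k => v k.succ.succ, ?_, ?_⟩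
      · simp [List.ofFn_succ]
      · have h1 : ∀ k : Fin n, Equiv.swap (0 : Fin (n + 2)) 1 k.succ.succ = k.succ.succ :=
          fun k => Equiv.swap_apply_of_ne_of_ne (Fin.succ_ne_zero _) (by simp [Fin.ext_iff])
        simp [List.ofFn_succ, h1]
    · obtain ⟨l₁, l₂, h1, h2⟩ := ofFn_swap (fun k => v k.succ) i
      refine ⟨v 0 :: l₁, l₂, ?_, ?_⟩
      · rw [List.ofFn_succ, h1]
        simp
      · have h3 : ∀ k : Fin (n + 1), Equiv.swap i.castSucc.succ i.succ.succ k.succ =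
            (Equiv.swap i.castSucc i.succ k).succ :=
          fun k => (Fin.succ_injective _).swap_apply _ _ _
        have h4 : Equiv.swap i.castSucc.succ i.succ.succ 0 = 0 :=
          Equiv.swap_apply_of_ne_of_ne (Fin.succ_ne_zero _).symm (Fin.succ_ne_zero _).symm
        rw [List.ofFn_succ, ← Fin.succ_castSucc]
        simp only [Function.comp_apply, h3, h4]
        exact congrArg (v 0 :: ·) h2

theorem prod_ofFn_perm {n : ℕ} (x : Fin (n + 1) → B) (h : ∀ i j, i ≠ j → x i * x j = -(x j * x i))
    (σ : Equiv.Perm (Fin (n + 1))) :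
    (List.ofFn (x ∘ σ)).prod = Equiv.Perm.sign σ • (List.ofFn x).prod := by
  refine sign_of_adjacent (fun σ => (List.ofFn (x ∘ σ)).prod) (fun σ i => ?_) σ
  obtain ⟨l₁, l₂, h1, h2⟩ := ofFn_swap (x ∘ σ) i
  have h3 : x ∘ (σ * Equiv.swap i.castSucc i.succ) = (x ∘ σ) ∘ Equiv.swap i.castSucc i.succ := rfl
  simp only [h3, h2]
  rw [h1]
  simp only [List.prod_append, List.prod_cons, ← mul_assoc]
  rw [mul_assoc l₁.prod, mul_assoc l₁.prod, Function.comp_apply, Function.comp_apply,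
    h _ _ (σ.injective.ne (by simp [Fin.ext_iff] : i.succ ≠ i.castSucc))]
  simp [mul_assoc]

/-- Words in the images of vectors under a linear map. -/
def wordMap {V : Type*} [AddCommGroup V] [Module ℂ V] (L : V →ₗ[ℂ] B) (n : ℕ) :
    MultilinearMap ℂ (fun _ : Fin n => V) B :=
  (MultilinearMap.mkPiAlgebraFin ℂ n B).compLinearMap (fun _ => L)

theorem wordMap_apply {V : Type*} [AddCommGroup V] [Module ℂ V] (L : V →ₗ[ℂ] B) (n : ℕ)
    (v : Fin n → V) : wordMap L n v = (List.ofFn fun i => L (v i)).prod := by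
  simp [wordMap, MultilinearMap.mkPiAlgebraFin_apply]

/-- A multilinear map changing sign under adjacent transpositions is alternating. -/
def alternatingOfAdjacent {V W : Type*} [AddCommGroup V] [Module ℂ V] [AddCommGroup W]
    [Module ℂ W] {n : ℕ} (f : MultilinearMap ℂ (fun _ : Fin (n + 1) => V) W)
    (h : ∀ v (i : Fin n), f (v ∘ Equiv.swap i.castSucc i.succ) = -f v) :
    V [⋀^Fin (n + 1)]→ₗ[ℂ] W :=
  { f with
    map_eq_zero_of_eq' := fun v i j hv hij => by
      have h1 := sign_of_adjacent (fun σ => f (v ∘ σ)) (fun σ i => h (v ∘ σ) i) (Equiv.swap i j)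
      have h2 : v ∘ Equiv.swap i j = v := by
        funext k
        simp only [Function.comp_apply, Equiv.swap_apply_def]
        split_ifs with h h <;> simp [h, hv]
      simp only [h2, Equiv.Perm.sign_swap hij, Units.neg_smul, one_smul, Equiv.Perm.coe_one,
        Function.comp_id] at h1
      have h3 : (2 : ℂ) • f v = 0 := by
        rw [two_smul]
        nth_rewrite 1 [h1]
        exact neg_add_cancel _
      exact (smul_eq_zero.mp h3).resolve_left two_ne_zero }

end Words

/-! ### Clifford generators, chirality and traces. -/

section Clifford

open Matrix

variable {K κ : Type*} [Fintype K] [DecidableEq K] [Fintype κ] [DecidableEq κ] (Φ : Fock K κ)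

/-- Creation by a vector. -/
def Fock.cre : (K → ℂ) →ₗ[ℂ] Matrix κ κ ℂ := Fintype.linearCombination ℂ Φ.θ

/-- Annihilation by a vector. -/
def Fock.ann : (K → ℂ) →ₗ[ℂ] Matrix κ κ ℂ := Fintype.linearCombination ℂ fun k => star (Φ.θ k)

theorem Fock.cre_apply (v : K → ℂ) : Φ.cre v = ∑ k, v k • Φ.θ k :=
  Fintype.linearCombination_apply _ _ _

theorem Fock.ann_apply (v : K → ℂ) : Φ.ann v = ∑ k, v k • star (Φ.θ k) :=
  Fintype.linearCombination_apply _ _ _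

theorem Fock.star_cre (v : K → ℂ) : star (Φ.cre v) = Φ.ann (star v) := by
  simp [Fock.cre_apply, Fock.ann_apply, star_sum, star_smul]

theorem Fock.star_ann (v : K → ℂ) : star (Φ.ann v) = Φ.cre (star v) := by
  simp [Fock.cre_apply, Fock.ann_apply, star_sum, star_smul]

theorem Fock.cre_cre (v w : K → ℂ) : Φ.cre v * Φ.cre w + Φ.cre w * Φ.cre v = 0 := by
  simp only [Fock.cre_apply, Finset.sum_mul, Finset.mul_sum, smul_mul_smul_comm]
  rw [Finset.sum_comm (f := fun i j => (w j * v i) • (Φ.θ j * Φ.θ i))]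
  simp only [← Finset.sum_add_distrib]
  refine Finset.sum_eq_zero fun i _ => Finset.sum_eq_zero fun j _ => ?_
  rw [mul_comm (w i), ← smul_add, Φ.anti, smul_zero]

theorem Fock.ann_ann (v w : K → ℂ) : Φ.ann v * Φ.ann w + Φ.ann w * Φ.ann v = 0 := by
  have := congrArg star (Φ.cre_cre (star w) (star v))
  simpa [Fock.star_cre] using this

theorem Fock.cre_ann (v w : K → ℂ) :
    Φ.cre v * Φ.ann w + Φ.ann w * Φ.cre v = (v ⬝ᵥ w) • 1 := by
  simp only [Fock.cre_apply, Fock.ann_apply, Finset.sum_mul, Finset.mul_sum, smul_mul_smul_comm]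
  rw [Finset.sum_comm (f := fun i j => (w j * v i) • (star (Φ.θ j) * Φ.θ i))]
  simp only [← Finset.sum_add_distrib]
  have : ∀ i j, (v j * w i) • (Φ.θ j * star (Φ.θ i)) + (w i * v j) • (star (Φ.θ i) * Φ.θ j) =
      if j = i then (v j * w i) • 1 else 0 := by
    intro i j
    rw [mul_comm (w i), ← smul_add, Φ.car]
    split_ifs <;> simp
  simp [this, dotProduct, Finset.sum_smul]

theorem Fock.S_cre (t : K → ℂ) (s : ℂ) (v : K → ℂ) (h : ∀ k, v k ≠ 0 → t k = s) :
    Φ.S t * Φ.cre v = s • (Φ.cre v * Φ.S t) := by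
  simp only [Fock.cre_apply, Finset.sum_mul, Finset.mul_sum, Finset.smul_sum]
  refine Finset.sum_congr rfl fun k _ => ?_
  by_cases hk : v k = 0
  · simp [hk]
  · rw [mul_smul_comm, Φ.S_θ, h k hk, smul_mul_assoc, smul_comm]

theorem Fock.S_star_θ (t : K → ℂ) (ht : ∀ k, t k * star (t k) = 1) (k : K) :
    Φ.S t * star (Φ.θ k) = star (t k) • (star (Φ.θ k) * Φ.S t) := by
  have := congrArg star (Φ.S_θ (star t) k)
  rw [star_mul, star_smul, star_mul, Φ.star_S, star_star, Pi.star_apply, star_star] at this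
  rw [this, smul_smul, mul_comm, ht, one_smul]

/-- The hermitian generators of the Clifford algebra of a unitary matrix `U`. -/
def Fock.gam (U : Matrix K K ℂ) : (K → ℂ) →ₗ[ℂ] Matrix κ κ ℂ :=
  Φ.cre ∘ₗ (U.map star).mulVecLin + Φ.ann ∘ₗ U.mulVecLin

variable {U : Matrix K K ℂ}

theorem Fock.gam_apply (v : K → ℂ) :
    Φ.gam U v = Φ.cre (U.map star *ᵥ v) + Φ.ann (U *ᵥ v) := rfl

theorem Fock.star_gam (v : K → ℂ) : star (Φ.gam U v) = Φ.gam U (star v) := by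
  rw [gam_apply, gam_apply, star_add, star_cre, star_ann, add_comm]
  congr 2 <;> ext k <;> simp [mulVec, dotProduct, star_sum]

/-- Unitarity makes the bilinear pairing of $\bar Uv$ with $Uw$ equal to that of $v$ with $w$, so
the anticommutation relations yield the standard complex bilinear form. -/
theorem Fock.gam_mul_gam (hU : U * Uᴴ = 1) (v w : K → ℂ) :
    Φ.gam U v * Φ.gam U w + Φ.gam U w * Φ.gam U v = (2 * v ⬝ᵥ w) • 1 := by
  have h1 : ∀ v w : K → ℂ, (U.map star *ᵥ v) ⬝ᵥ (U *ᵥ w) = v ⬝ᵥ w := by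
    intro v w
    rw [dotProduct_mulVec, ← vecMul_transpose, vecMul_vecMul]
    have : (U.map star)ᵀ * U = 1 := mul_eq_one_comm.mp hU
    rw [this, vecMul_one]
  have e1 := Φ.cre_cre (U.map star *ᵥ v) (U.map star *ᵥ w)
  have e2 := Φ.ann_ann (U *ᵥ v) (U *ᵥ w)
  have e3 := Φ.cre_ann (U.map star *ᵥ v) (U *ᵥ w)
  have e4 := Φ.cre_ann (U.map star *ᵥ w) (U *ᵥ v)
  rw [h1] at e3 e4
  rw [dotProduct_comm] at e4
  simp only [gam_apply, mul_add, add_mul]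
  rw [two_mul, add_smul]
  linear_combination (norm := abel) e1 + e2 + e3 + e4

/-- The Clifford generator of a row of `Ū`. -/
def Fock.row (U : Matrix K K ℂ) (k : K) : Matrix κ κ ℂ := Φ.gam U (star (U k))

theorem Fock.row_eq (hU : U * Uᴴ = 1) (k : K) :
    Φ.row U k = Φ.cre (fun m => star ((U * Uᵀ) k m)) + star (Φ.θ k) := by
  rw [row, gam_apply]
  congr 1
  · congr 1
    ext m
    simp only [mulVec, dotProduct, Matrix.mul_apply, map_apply, Pi.star_apply, transpose_apply,
      star_sum, star_mul']
    exact Finset.sum_congr rfl fun _ _ => mul_comm _ _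
  · have : U *ᵥ star (U k) = Pi.single k 1 := by
      ext m
      have := congrFun₂ hU m k
      rw [Matrix.one_apply] at this
      rw [Pi.single_apply, ← this]
      rfl
    rw [this, ann_apply]
    simp [Pi.single_apply]

/-- By `row_eq` the generator is $\theta_k^*$ plus those $\theta_m$ with $(UU^T)_{km}\ne0$.
Compatibility gives each such $m$ the phase $\bar t_k$, which is also the phase of $\theta_k^*$. -/
theorem Fock.S_row (hU : U * Uᴴ = 1) (t : K → ℂ) (ht : ∀ k, t k * star (t k) = 1) (k : K)
    (hc : ∀ m, (U * Uᵀ) k m ≠ 0 → t k * t m = 1) :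
    Φ.S t * Φ.row U k = star (t k) • (Φ.row U k * Φ.S t) := by
  rw [row_eq Φ hU, mul_add, Φ.S_cre t (star (t k)), Φ.S_star_θ t ht, add_mul, smul_add]
  intro m hm
  have h1 := hc m (by simpa using hm)
  have h2 := ht k
  have h3 : t k ≠ 0 := left_ne_zero_of_mul_eq_one h1
  exact mul_left_cancel₀ h3 (h1.trans h2.symm)

theorem Fock.star_row (k : K) : star (Φ.row U k) = Φ.gam U (U k) := by
  rw [row, star_gam, star_star]

/-- The Clifford generator of a coordinate vector. -/
def Fock.gen (U : Matrix K K ℂ) (a : K) : Matrix κ κ ℂ := Φ.gam U (Pi.single a 1)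

theorem Fock.gen_mul_gen (hU : U * Uᴴ = 1) (a c : K) :
    Φ.gen U a * Φ.gen U c + Φ.gen U c * Φ.gen U a = if a = c then 2 else 0 := by
  rw [gen, gen, gam_mul_gam Φ hU]
  by_cases h : a = c
  · subst h
    simp [two_smul, one_add_one_eq_two]
  · simp [h, Pi.single_apply, eq_comm]

theorem Fock.gen_sq (hU : U * Uᴴ = 1) (a : K) : Φ.gen U a * Φ.gen U a = 1 := by
  have := Φ.gen_mul_gen hU a a
  rw [if_pos rfl, ← two_smul ℂ (Φ.gen U a * _)] at this
  have h2 : (2 : Matrix κ κ ℂ) = (2 : ℂ) • 1 := by rw [two_smul, one_add_one_eq_two]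
  rw [h2] at this
  exact smul_right_injective _ (two_ne_zero (α := ℂ)) this

theorem Fock.gen_anti (hU : U * Uᴴ = 1) (a c : K) (h : a ≠ c) :
    Φ.gen U a * Φ.gen U c = -(Φ.gen U c * Φ.gen U a) := by
  have := Φ.gen_mul_gen hU a c
  rw [if_neg h] at this
  exact eq_neg_of_add_eq_zero_left this

theorem Fock.star_gen (a : K) : star (Φ.gen U a) = Φ.gen U a := by
  rw [gen, star_gam]
  congr 1
  ext k
  by_cases h : k = a <;> simp [Pi.single_apply, h]

variable {n : ℕ} (e : Fin (n + 1) ≃ K)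

/-- The product of all Clifford generators in a given order. -/
def Fock.top (U : Matrix K K ℂ) : Matrix κ κ ℂ := (List.ofFn fun i => Φ.gen U (e i)).prod

/-- The generator anticommutes with `n` letters of the product and commutes with the remaining one,
itself. -/
theorem Fock.gen_mul_top (hU : U * Uᴴ = 1) (a : K) :
    Φ.gen U a * Φ.top e U = (-1 : ℂ) ^ n • (Φ.top e U * Φ.gen U a) := by
  rw [top, mul_prod_ofFn _ _ (fun i => if i = e.symm a then 1 else -1)]
  · congr 1
    rw [← Finset.mul_prod_erase _ _ (Finset.mem_univ (e.symm a)), if_pos rfl, one_mul,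
      Finset.prod_congr rfl (fun i hi => if_neg (Finset.ne_of_mem_erase hi)), Finset.prod_const,
      Finset.card_erase_of_mem (Finset.mem_univ _), Finset.card_univ, Fintype.card_fin,
      Nat.add_sub_cancel]
  · intro i
    by_cases h : i = e.symm a
    · subst h; simp
    · rw [if_neg h, Φ.gen_anti hU _ _ (by rintro rfl; simp at h)]
      simp

theorem Fock.star_top_mul_top (hU : U * Uᴴ = 1) : star (Φ.top e U) * Φ.top e U = 1 := by
  have h : ∀ L : List (Matrix κ κ ℂ), (∀ x ∈ L, star x * x = 1) → star L.prod * L.prod = 1 := by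
    intro L
    induction L with
    | nil => simp
    | cons x L ih =>
      intro hL
      rw [List.prod_cons, star_mul, mul_assoc, ← mul_assoc (star x), hL x (by simp), one_mul]
      exact ih fun y hy => hL y (by simp [hy])
  refine h _ fun x hx => ?_
  obtain ⟨i, rfl⟩ := List.mem_ofFn.mp hx
  rw [Φ.star_gen, Φ.gen_sq hU]

theorem star_prod_ofFn {B : Type*} [Ring B] [StarRing B] {n : ℕ} (x : Fin n → B)
    (h : ∀ i, star (x i) = x i) :
    star (List.ofFn x).prod = (List.ofFn (x ∘ Fin.revPerm)).prod := by
  have h1 : ∀ L : List B, (∀ y ∈ L, star y = y) → star L.prod = L.reverse.prod := by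
    intro L
    induction L with
    | nil => simp
    | cons y L ih =>
      intro hL
      rw [List.prod_cons, star_mul, ih fun z hz => hL z (by simp [hz]), hL y (by simp)]
      simp
  rw [h1 _ (fun y hy => by obtain ⟨i, rfl⟩ := List.mem_ofFn.mp hy; exact h i)]
  congr 1
  refine List.ext_getElem (by simp) fun i h1 h2 => ?_
  simp only [List.getElem_reverse, List.getElem_ofFn, List.length_ofFn, Function.comp_apply]
  congr 1
  ext
  simp only [Fin.revPerm_apply, Fin.val_rev]
  omega

/-- The chirality operator. -/
def Fock.chi (U : Matrix K K ℂ) : Matrix κ κ ℂ :=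
  if star (Φ.top e U) = Φ.top e U then Φ.top e U else Complex.I • Φ.top e U

theorem Fock.exists_chi_eq : ∃ c : ℂ, c ≠ 0 ∧ Φ.chi e U = c • Φ.top e U := by
  unfold chi
  split_ifs
  · exact ⟨1, one_ne_zero, (one_smul _ _).symm⟩
  · exact ⟨_, Complex.I_ne_zero, rfl⟩

/-- The adjoint reverses the word, and anticommutation restores the order at the cost of the sign of
the reversal. Hence `top` or its multiple by $i$ is self-adjoint. -/
theorem Fock.star_top (hU : U * Uᴴ = 1) :
    star (Φ.top e U) = Φ.top e U ∨ star (Φ.top e U) = -Φ.top e U := by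
  rw [top, star_prod_ofFn _ (fun i => Φ.star_gen _),
    prod_ofFn_perm _ (fun i j hij => Φ.gen_anti hU _ _ (e.injective.ne hij))]
  rcases Int.units_eq_one_or (Equiv.Perm.sign (Fin.revPerm : Equiv.Perm (Fin (n + 1)))) with h | h
  · left; rw [h, one_smul]
  · right; rw [h, Units.neg_smul, one_smul]

theorem Fock.star_chi (hU : U * Uᴴ = 1) : star (Φ.chi e U) = Φ.chi e U := by
  unfold chi
  split_ifs with h
  · exact h
  · rw [star_smul, (Φ.star_top e hU).resolve_left h, Complex.star_def, Complex.conj_I, smul_neg,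
      neg_smul, neg_neg]

theorem Fock.chi_sq (hU : U * Uᴴ = 1) : Φ.chi e U * Φ.chi e U = 1 := by
  have h0 := Φ.star_top_mul_top e hU
  unfold chi
  split_ifs with h
  · rwa [h] at h0
  · rw [(Φ.star_top e hU).resolve_left h] at h0
    rw [smul_mul_smul_comm, Complex.I_mul_I, neg_smul, one_smul, ← neg_mul, h0]

theorem Fock.gen_mul_chi (hU : U * Uᴴ = 1) (a : K) :
    Φ.gen U a * Φ.chi e U = (-1 : ℂ) ^ n • (Φ.chi e U * Φ.gen U a) := by
  obtain ⟨c, -, hc⟩ := Φ.exists_chi_eq e (U := U)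
  rw [hc, mul_smul_comm, gen_mul_top Φ e hU, smul_mul_assoc, smul_comm]

theorem Fock.gam_eq_sum (v : K → ℂ) : Φ.gam U v = ∑ a, v a • Φ.gen U a := by
  have : v = ∑ a, v a • Pi.single a (1 : ℂ) := by
    ext k
    simp [Pi.single_apply]
  conv_lhs => rw [this]
  simp [gen]

theorem Fock.gam_mul_chi (hU : U * Uᴴ = 1) (v : K → ℂ) :
    Φ.gam U v * Φ.chi e U = (-1 : ℂ) ^ n • (Φ.chi e U * Φ.gam U v) := by
  simp only [gam_eq_sum, Finset.sum_mul, Finset.mul_sum, Finset.smul_sum]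
  refine Finset.sum_congr rfl fun a _ => ?_
  rw [smul_mul_assoc, Φ.gen_mul_chi e hU, mul_smul_comm, smul_comm]

/-- The traces of short words against the chirality operator vanish. -/
theorem Fock.trace_chi_word (hU : U * Uᴴ = 1) {r : ℕ} (hr : r < n + 1) (hp : Even (r + n + 1))
    (v : Fin r → K → ℂ) :
    Matrix.trace (Φ.chi e U * (List.ofFn fun i => Φ.gam U (v i)).prod) = 0 := by
  let f : MultilinearMap ℂ (fun _ : Fin r => K → ℂ) ℂ :=
    ((Matrix.traceLinearMap κ ℂ ℂ) ∘ₗ LinearMap.mulLeft ℂ (Φ.chi e U)).compMultilinearMap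
      (wordMap (Φ.gam U) r)
  have hf : ∀ v, f v = Matrix.trace (Φ.chi e U * (List.ofFn fun i => Φ.gam U (v i)).prod) :=
    fun v => by simp [f, wordMap_apply]
  suffices f = 0 by rw [← hf, this]; rfl
  refine Module.Basis.ext_multilinear (fun _ => Pi.basisFun ℂ K) fun a => ?_
  rw [hf]
  -- A generator missing from the word: conjugating by it multiplies the trace by $(-1)^{n+r}=-1$.
  obtain ⟨μ, hμ⟩ : ∃ μ, ∀ i, μ ≠ a i := by
    by_contra! h
    have h1 := Fintype.card_le_of_surjective a (fun μ => by
      obtain ⟨i, hi⟩ := h μ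
      exact ⟨i, hi.symm⟩)
    rw [← Fintype.card_congr e, Fintype.card_fin, Fintype.card_fin] at h1
    omega
  set w := (List.ofFn fun i => Φ.gen U (a i)).prod with hw
  have hw' : (List.ofFn fun i => Φ.gam U ((Pi.basisFun ℂ K) (a i))).prod = w := by
    simp only [Pi.basisFun_apply, hw, gen]
  rw [hw']
  have h1 : Φ.gen U μ * w = (-1 : ℂ) ^ r • (w * Φ.gen U μ) := by
    rw [hw, mul_prod_ofFn _ _ (fun _ => -1)]
    · simp
    · intro i
      rw [Φ.gen_anti hU _ _ (hμ i)]
      simp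
  have h2 : Matrix.trace (Φ.chi e U * w) =
      ((-1 : ℂ) ^ n * (-1) ^ r) * Matrix.trace (Φ.chi e U * w) := by
    calc Matrix.trace (Φ.chi e U * w)
        = Matrix.trace (Φ.gen U μ * (Φ.gen U μ * (Φ.chi e U * w))) := by
          rw [← mul_assoc, Φ.gen_sq hU, one_mul]
      _ = Matrix.trace (Φ.gen U μ * (Φ.chi e U * w) * Φ.gen U μ) := by
          rw [Matrix.trace_mul_comm]
      _ = (-1 : ℂ) ^ n * Matrix.trace (Φ.chi e U * (Φ.gen U μ * w) * Φ.gen U μ) := by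
          rw [← mul_assoc, Φ.gen_mul_chi e hU, smul_mul_assoc, smul_mul_assoc, trace_smul,
            smul_eq_mul, mul_assoc (Φ.chi e U)]
      _ = _ := by
          rw [h1, mul_smul_comm, smul_mul_assoc, trace_smul, smul_eq_mul, mul_assoc, mul_assoc,
            mul_assoc, Φ.gen_sq hU, mul_one, ← mul_assoc]
  rw [← pow_add, Odd.neg_one_pow (by
    rcases hp with ⟨s, hs⟩
    exact ⟨s - 1, by omega⟩)] at h2
  have h3 : (2 : ℂ) * Matrix.trace (Φ.chi e U * w) = 0 := by linear_combination h2
  simpa using h3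

/-- The trace of words of top length against the chirality operator. -/
def Fock.topForm (hU : U * Uᴴ = 1) : (K → ℂ) [⋀^Fin (n + 1)]→ₗ[ℂ] ℂ :=
  alternatingOfAdjacent (((Matrix.traceLinearMap κ ℂ ℂ) ∘ₗ
    LinearMap.mulLeft ℂ (Φ.chi e U)).compMultilinearMap (wordMap (Φ.gam U) (n + 1)))
    (fun v i => by
      obtain ⟨l₁, l₂, h1, h2⟩ := ofFn_swap v i
      have hlen : l₁.length + l₂.length + 1 = n := by
        have := congrArg List.length h1
        simp at this
        omega
      -- The sum of a word and its transposed version contains a Clifford anticommutator, hence is a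
      -- multiple of a word with two letters fewer, whose trace vanishes.
      have h3 := Φ.trace_chi_word e hU (r := (l₁ ++ l₂).length) (by simp; omega)
        ⟨n, by simp; omega⟩ (fun i => (l₁ ++ l₂).get i)
      have h4 : (List.ofFn fun i => Φ.gam U ((l₁ ++ l₂).get i)).prod =
          (l₁.map (Φ.gam U)).prod * (l₂.map (Φ.gam U)).prod := by
        rw [← List.prod_append, ← List.map_append]
        conv_rhs => rw [← List.ofFn_get (l₁ ++ l₂), List.map_ofFn]
        rfl
      have h5 : ∀ v : Fin (n + 1) → K → ℂ, (List.ofFn fun i => Φ.gam U (v i)) =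
          (List.ofFn v).map (Φ.gam U) := fun v => by rw [List.map_ofFn]; rfl
      rw [h4] at h3
      rw [eq_neg_iff_add_eq_zero]
      simp only [LinearMap.compMultilinearMap_apply, wordMap_apply, LinearMap.comp_apply,
        LinearMap.mulLeft_apply, Matrix.traceLinearMap_apply, h5, h1, h2]
      rw [← Matrix.trace_add, ← mul_add]
      simp only [List.map_append, List.map_cons, List.prod_append, List.prod_cons]
      rw [← mul_add, ← mul_assoc (Φ.gam U (v i.succ)), ← mul_assoc (Φ.gam U (v i.castSucc)),
        ← add_mul, Φ.gam_mul_gam hU]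
      simp only [smul_mul_assoc, one_mul, mul_smul_comm, Matrix.trace_smul, h3, smul_zero])

theorem Fock.topForm_apply (hU : U * Uᴴ = 1) (v : Fin (n + 1) → K → ℂ) :
    Φ.topForm e hU v = Matrix.trace (Φ.chi e U * (List.ofFn fun i => Φ.gam U (v i)).prod) := by
  change (((Matrix.traceLinearMap κ ℂ ℂ) ∘ₗ
    LinearMap.mulLeft ℂ (Φ.chi e U)).compMultilinearMap (wordMap (Φ.gam U) (n + 1))) v = _
  simp [wordMap_apply]

/-- On the coordinate vectors the form is the trace of `chi * top`, a nonzero multiple of the trace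
of `chi * chi = 1`. -/
theorem Fock.topForm_ne_zero [Nonempty κ] (hU : U * Uᴴ = 1) : Φ.topForm e hU ≠ 0 := by
  intro h0
  have h1 := congrArg (fun f => f fun i => Pi.single (e i) 1) h0
  simp only [topForm_apply, AlternatingMap.zero_apply] at h1
  change Matrix.trace (Φ.chi e U * Φ.top e U) = 0 at h1
  obtain ⟨c, hc, hc'⟩ := Φ.exists_chi_eq e (U := U)
  have h2 := Φ.chi_sq e hU
  rw [hc', mul_smul_comm, ← hc'] at h2
  have h3 := congrArg Matrix.trace h2
  rw [Matrix.trace_smul, h1, smul_zero, Matrix.trace_one] at h3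
  exact Fintype.card_ne_zero (by exact_mod_cast h3.symm)

/-- The rows of an invertible matrix, as a basis. -/
def rowBasis [Nonempty K] (W W' : Matrix K K ℂ) (h : W * W' = 1) : Module.Basis (Fin (n + 1)) ℂ (K → ℂ) :=
  (basisOfLinearIndependentOfCardEqFinrank (b := W.row)
    (Matrix.linearIndependent_rows_of_isUnit ⟨⟨W, W', h, mul_eq_one_comm.mp h⟩, rfl⟩)
    (by simp)).reindex e.symm

end Clifford

/-! ### Traces of twisted Clifford words. -/

section TwistedWords

open Matrix

variable {K κ : Type*} [Fintype K] [DecidableEq K] [Fintype κ] [DecidableEq κ] (Φ : Fock K κ)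
  {U : Matrix K K ℂ} {τ : K → K → ℂ} {n : ℕ} (e : Fin (n + 1) ≃ K)

theorem alternating_rows_ne_zero (f : (K → ℂ) [⋀^Fin (n + 1)]→ₗ[ℂ] ℂ) (hf : f ≠ 0)
    (W W' : Matrix K K ℂ) (h : W * W' = 1) : f (fun i => W (e i)) ≠ 0 := by
  have : Nonempty K := ⟨e 0⟩
  have h1 := (f.map_basis_ne_zero_iff (rowBasis e W W' h)).mpr hf
  have h2 : ⇑(rowBasis e W W' h) = fun i => W (e i) := by
    funext i
    rw [rowBasis, Module.Basis.reindex_apply, Equiv.symm_symm,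
      coe_basisOfLinearIndependentOfCardEqFinrank]
    rfl
  rwa [h2] at h1

theorem map_star_mul_transpose (hU : U * Uᴴ = 1) : U.map star * Uᵀ = 1 := by
  have := congrArg (fun M => M.map star) hU
  ext i j
  have h := congrFun₂ this i j
  simpa [Matrix.mul_apply, star_sum, Matrix.one_apply, apply_ite star] using h

theorem Fock.S_mul_prod_row (hU : U * Uᴴ = 1) (t : K → ℂ) (ht : ∀ k, t k * star (t k) = 1)
    (hc : ∀ k m, (U * Uᵀ) k m ≠ 0 → t k * t m = 1) {r : ℕ} (k : Fin r → K) :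
    Φ.S t * (List.ofFn fun i => Φ.row U (k i)).prod =
      star (∏ i, t (k i)) • ((List.ofFn fun i => Φ.row U (k i)).prod * Φ.S t) := by
  rw [mul_prod_ofFn _ _ (fun i => star (t (k i))) (fun i => Φ.S_row hU t ht _ (hc _)), star_prod]

/-- Antisymmetrized words of full length are a top-degree form with operator values. On the rows of
$\bar U$ the operator $S(t)$ moves past each of them at the cost of the conjugate of $\prod_kt_k=1$.
A top-degree form is determined by one basis, so the same holds on the coordinate basis, where the
value is $(n+1)!$ times `top`. -/
theorem Fock.S_mul_chi (hU : U * Uᴴ = 1) (t : K → ℂ) (ht : ∀ k, t k * star (t k) = 1)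
    (hc : ∀ k m, (U * Uᵀ) k m ≠ 0 → t k * t m = 1) (hdet : ∏ k, t k = 1) :
    Φ.S t * Φ.chi e U = Φ.chi e U * Φ.S t := by
  set A := MultilinearMap.alternatization (wordMap (Φ.gam U) (n + 1)) with hA
  have hA1 : ∀ v, A v = ∑ σ : Equiv.Perm (Fin (n + 1)), Equiv.Perm.sign σ •
      (List.ofFn fun i => Φ.gam U (v (σ i))).prod := by
    intro v
    rw [hA, MultilinearMap.alternatization_apply]
    refine Finset.sum_congr rfl fun σ _ => ?_
    rw [MultilinearMap.domDomCongr_apply, wordMap_apply]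
  have hrow : Φ.S t * A (fun i => (U.map star) (e i)) = A (fun i => (U.map star) (e i)) * Φ.S t := by
    rw [hA1, Finset.mul_sum, Finset.sum_mul]
    refine Finset.sum_congr rfl fun σ _ => ?_
    have h1 := Φ.S_mul_prod_row hU t ht hc (fun i => e (σ i))
    rw [show ∏ i, t (e (σ i)) = 1 by rw [← hdet]; exact Equiv.prod_comp (σ.trans e) t, star_one,
      one_smul] at h1
    rw [mul_smul_comm, smul_mul_assoc]
    exact congrArg _ h1
  have htop : A (fun i => Pi.single (e i) 1) = ((n + 1).factorial : ℂ) • Φ.top e U := by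
    rw [hA1, Finset.sum_congr rfl (fun σ _ => by
      rw [show (List.ofFn fun i => Φ.gam U (Pi.single (e (σ i)) 1)).prod = _ from
        prod_ofFn_perm (fun i => Φ.gen U (e i))
          (fun i j hij => Φ.gen_anti hU _ _ (e.injective.ne hij)) σ, smul_smul,
        Int.units_mul_self, one_smul]), Finset.sum_const, Finset.card_univ, Fintype.card_perm,
      Fintype.card_fin, Nat.cast_smul_eq_nsmul]
    rfl
  have hcomm : Φ.S t * A (fun i => Pi.single (e i) 1) =
      A (fun i => Pi.single (e i) 1) * Φ.S t := by
    rw [← sub_eq_zero]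
    ext p q
    let L : Matrix κ κ ℂ →ₗ[ℂ] ℂ := Matrix.entryLinearMap ℂ ℂ p q ∘ₗ
      (LinearMap.mulLeft ℂ (Φ.S t) - LinearMap.mulRight ℂ (Φ.S t))
    have hL : L.compAlternatingMap A = 0 := by
      by_contra h
      refine alternating_rows_ne_zero e _ h _ _ (map_star_mul_transpose hU) ?_
      simp only [LinearMap.compAlternatingMap_apply, L, LinearMap.comp_apply, LinearMap.sub_apply,
        LinearMap.mulLeft_apply, LinearMap.mulRight_apply]
      rw [hrow, sub_self, map_zero]
    have := congrArg (fun f => f fun i => Pi.single (e i) 1) hL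
    simpa [L] using this
  rw [htop, mul_smul_comm, smul_mul_assoc] at hcomm
  have h2 := smul_right_injective _ (Nat.cast_ne_zero.mpr (Nat.factorial_ne_zero (n + 1)) :
    ((n + 1).factorial : ℂ) ≠ 0) hcomm
  obtain ⟨c, -, hc⟩ := Φ.exists_chi_eq e (U := U)
  rw [hc, mul_smul_comm, smul_mul_assoc, h2]

variable (h : Twist U τ)

/-- The twisted Clifford generators. -/
def Fock.tw (U : Matrix K K ℂ) (τ : K → K → ℂ) (k : K) : Matrix κ κ ℂ := Φ.row U k * Φ.S (τ k)

/-- The product of phases appearing when collecting the twists of a word. -/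
def wordPhase (c : K → K → ℂ) {r : ℕ} (k : Fin r → K) : ℂ :=
  ∏ i, ∏ j, if i < j then c (k i) (k j) else 1

include h in
theorem Fock.prod_tw {r : ℕ} (k : Fin r → K) : (List.ofFn fun i => Φ.tw U τ (k i)).prod =
    wordPhase (fun a b => star (τ a b)) k •
      ((List.ofFn fun i => Φ.row U (k i)).prod * Φ.S (∏ i, τ (k i))) :=
  prod_ofFn_mul Φ.S _ (fun i => τ (k i)) (fun i j => star (τ (k i) (k j)))
    (fun _ _ _ => Φ.S_row h.unitary _ (h.norm _) _ (fun _ hm => h.compatR _ _ hm _))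

include h in
-- If the total twist is nontrivial at some `l`, conjugation by the operator of the phases `τ · l`
-- fixes the chirality operator but scales the word by a phase other than 1.
theorem Fock.trace_row_word_eq_zero {r : ℕ} (k : Fin r → K) (hk : ∏ i, τ (k i) ≠ 1) (t : K → ℂ) :
    Matrix.trace (Φ.chi e U * ((List.ofFn fun i => Φ.row U (k i)).prod * Φ.S t)) = 0 := by
  obtain ⟨l, hl⟩ : ∃ l, ∏ i, τ (k i) l ≠ 1 := by
    by_contra! h0
    exact hk (funext fun l => by rw [Finset.prod_apply]; exact h0 l)
  set s : K → ℂ := fun m => τ m l with hs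
  have hs1 : ∀ m, s m * star (s m) = 1 := fun m => h.norm m l
  have hs2 : Φ.S s * Φ.S (star s) = 1 := by
    rw [← map_mul, show s * star s = 1 from funext hs1, map_one]
  have hsc : ∀ k m, (U * Uᵀ) k m ≠ 0 → s k * s m = 1 := fun k m hkm => h.compatL _ _ hkm _
  have h1 := Φ.S_mul_prod_row h.unitary s hs1 hsc k
  have h2 := Φ.S_mul_chi e h.unitary s hs1 hsc (h.detL l)
  set W := (List.ofFn fun i => Φ.row U (k i)).prod
  have h3 : Φ.S s * (Φ.chi e U * (W * Φ.S t)) =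
      star (∏ i, s (k i)) • (Φ.chi e U * (W * Φ.S t) * Φ.S s) := by
    rw [← mul_assoc, h2, mul_assoc, ← mul_assoc (Φ.S s), h1, smul_mul_assoc, mul_smul_comm,
      mul_assoc, mul_assoc, mul_assoc, ← map_mul, ← map_mul, mul_comm s]
  set Y := Φ.chi e U * (W * Φ.S t)
  have h4 : star (∏ i, s (k i)) * Matrix.trace Y = Matrix.trace Y := by
    calc star (∏ i, s (k i)) * Matrix.trace Y
        = Matrix.trace (star (∏ i, s (k i)) • (Y * (Φ.S s * Φ.S (star s)))) := by
          rw [hs2, mul_one, Matrix.trace_smul, smul_eq_mul]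
      _ = Matrix.trace (Φ.S s * Y * Φ.S (star s)) := by
          rw [h3, smul_mul_assoc, mul_assoc Y]
      _ = Matrix.trace Y := by
          rw [mul_assoc, Matrix.trace_mul_comm, mul_assoc Y, ← map_mul, mul_comm (star s), map_mul,
            hs2, mul_one]
  have h5 : star (∏ i, s (k i)) ≠ 1 := by
    intro h5
    apply hl
    have := congrArg star h5
    rwa [star_star, star_one] at this
  by_contra h6
  exact h5 (mul_right_cancel₀ h6 (h4.trans (one_mul _).symm))

/-- The trace of a twisted word against the chirality operator. -/
def Fock.twTrace (U : Matrix K K ℂ) (τ : K → K → ℂ) {r : ℕ} (k : Fin r → K) : ℂ :=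
  Matrix.trace (Φ.chi e U * (List.ofFn fun i => Φ.tw U τ (k i)).prod)

include h in
-- Either the total twist is trivial, and the untwisted vanishing applies, or the phases alone kill
-- the trace.
theorem Fock.twTrace_eq_zero {r : ℕ} (hr : r < n + 1) (hp : Even (r + n + 1)) (k : Fin r → K) :
    Φ.twTrace e U τ k = 0 := by
  rw [twTrace, Φ.prod_tw h, mul_smul_comm, Matrix.trace_smul]
  by_cases hk : ∏ i, τ (k i) = 1
  · rw [hk, map_one, mul_one]
    exact smul_eq_zero_of_right _ (Φ.trace_chi_word e h.unitary hr hp _)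
  · rw [Φ.trace_row_word_eq_zero e h k hk, smul_zero]

include h in
theorem Fock.twTrace_top (k : Fin (n + 1) → K) (hk : ∏ i, τ (k i) = 1) :
    Φ.twTrace e U τ k = wordPhase (fun a b => star (τ a b)) k *
      Φ.topForm e h.unitary (fun i => (U.map star) (k i)) := by
  rw [twTrace, Φ.prod_tw h, mul_smul_comm, Matrix.trace_smul, hk, map_one, mul_one, smul_eq_mul,
    topForm_apply]
  rfl

include h in
-- The twisted and the untwisted trace vanish together, so the sum over all words can later be
-- rewritten with the untwisted form.
theorem Fock.twTrace_top_of_ne (k : Fin (n + 1) → K) (hk : ∏ i, τ (k i) ≠ 1) :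
    Φ.twTrace e U τ k = 0 ∧ Φ.topForm e h.unitary (fun i => (U.map star) (k i)) = 0 := by
  constructor
  · rw [twTrace, Φ.prod_tw h, mul_smul_comm, Matrix.trace_smul, Φ.trace_row_word_eq_zero e h k hk,
      smul_zero]
  · have := Φ.trace_row_word_eq_zero e h k hk 1
    rw [map_one, mul_one] at this
    rw [topForm_apply]
    exact this

end TwistedWords

/-! ### The twisted Clifford element and its Chern characters. -/

section Dirac

open Matrix

variable {A : Type*} [Ring A] [StarRing A] [Algebra ℂ A] [StarModule ℂ A]
  {K κ : Type*} [Fintype K] [DecidableEq K] [Fintype κ] [DecidableEq κ] (Φ : Fock K κ)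
  {U : Matrix K K ℂ} {τ : K → K → ℂ} {n : ℕ} (e : Fin (n + 1) ≃ K)

/-- Hermitian coordinates on a sphere that commute up to phases after a unitary change. -/
structure TwistedCoords (U : Matrix K K ℂ) (τ : K → K → ℂ) (x ζ : K → A) : Prop where
  star_x : ∀ a, star (x a) = x a
  sum_sq : ∑ a, x a * x a = 1
  ζ_eq : ∀ k, ζ k = ∑ a, U k a • x a
  exch : ∀ k l, ζ k * ζ l = (τ k l * star (τ l k)) • (ζ l * ζ k)

variable {x ζ : K → A}

theorem sum_star_mul (hU : U * Uᴴ = 1) (a b : K) :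
    ∑ k, star (U k a) * U k b = if a = b then 1 else 0 := by
  have h1 : Uᴴ * U = 1 := mul_eq_one_comm.mp hU
  have := congrFun₂ h1 a b
  rw [Matrix.mul_apply, Matrix.one_apply] at this
  exact this

theorem TwistedCoords.x_eq (hU : U * Uᴴ = 1) (hx : TwistedCoords U τ x ζ) (a : K) :
    x a = ∑ k, star (U k a) • ζ k := by
  simp only [hx.ζ_eq, Finset.smul_sum, smul_smul]
  rw [Finset.sum_comm]
  simp only [← Finset.sum_smul, sum_star_mul hU]
  simp

theorem TwistedCoords.sum_ζ (hU : U * Uᴴ = 1) (hx : TwistedCoords U τ x ζ) :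
    ∑ k, ∑ l, star ((U * Uᵀ) k l) • (ζ l * ζ k) = 1 := by
  rw [← hx.sum_sq]
  have h1 : ∀ a, x a * x a = ∑ k, ∑ l, (star (U k a) * star (U l a)) • (ζ l * ζ k) := by
    intro a
    rw [hx.x_eq hU a, Finset.sum_mul, Finset.sum_comm]
    refine Finset.sum_congr rfl fun l _ => ?_
    rw [Finset.mul_sum]
    refine Finset.sum_congr rfl fun k _ => ?_
    rw [smul_mul_smul_comm, mul_comm]
  simp only [h1]
  symm
  rw [Finset.sum_comm]
  refine Finset.sum_congr rfl fun k _ => ?_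
  rw [Finset.sum_comm]
  refine Finset.sum_congr rfl fun l _ => ?_
  rw [← Finset.sum_smul, Matrix.mul_apply, star_sum]
  simp only [star_mul', transpose_apply]

theorem TwistedCoords.star_ζ (hU : U * Uᴴ = 1) (hx : TwistedCoords U τ x ζ) (k : K) :
    star (ζ k) = ∑ l, star ((U * Uᵀ) k l) • ζ l := by
  have h1 : star (ζ k) = ∑ a, star (U k a) • x a := by
    rw [hx.ζ_eq, star_sum]
    simp only [star_smul, hx.star_x]
  rw [h1]
  simp only [hx.x_eq hU, Finset.smul_sum, smul_smul]
  rw [Finset.sum_comm]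
  refine Finset.sum_congr rfl fun l _ => ?_
  rw [← Finset.sum_smul, Matrix.mul_apply, star_sum]
  simp only [star_mul', transpose_apply]

theorem sm_zero_right (C : Matrix κ κ ℂ) : sm C (0 : A) = 0 := by
  ext
  simp [sm_apply]

/-- The self-adjoint unitary of the twisted sphere. -/
def Fock.dirac (U : Matrix K K ℂ) (τ : K → K → ℂ) (ζ : K → A) : Matrix κ κ A :=
  ∑ k, sm (Φ.tw U τ k) (ζ k)

/-- When the terms $(k,l)$ and $(l,k)$ are paired, the exchange phases of the coordinates cancel
those of the twists and leave a Clifford anticommutator. It is nonzero only where compatibility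
makes the remaining twist trivial, and the sum is then the sphere relation. -/
theorem Fock.dirac_sq (h : Twist U τ) (hx : TwistedCoords U τ x ζ) :
    Φ.dirac U τ ζ * Φ.dirac U τ ζ = 1 := by
  have hS : ∀ k l, Φ.S (τ k) * Φ.row U l = star (τ k l) • (Φ.row U l * Φ.S (τ k)) := fun k l =>
    Φ.S_row h.unitary _ (h.norm _) _ (fun m hm => h.compatR _ _ hm _)
  have hww : ∀ k l, Φ.tw U τ k * Φ.tw U τ l =
      star (τ k l) • (Φ.row U k * Φ.row U l * Φ.S (τ k * τ l)) := by
    intro k l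
    rw [tw, tw, mul_assoc, ← mul_assoc (Φ.S (τ k)), hS, smul_mul_assoc, mul_smul_comm, map_mul]
    simp only [mul_assoc]
  have hrr : ∀ k l, Φ.row U k * Φ.row U l + Φ.row U l * Φ.row U k =
      (2 * star ((U * Uᵀ) k l)) • 1 := by
    intro k l
    rw [row, row, Φ.gam_mul_gam h.unitary]
    congr 2
    simp [Matrix.mul_apply, dotProduct, star_sum]
  let P : K → K → Matrix κ κ A := fun k l => sm (Φ.tw U τ k * Φ.tw U τ l) (ζ k * ζ l)
  have hP : ∀ k l, P k l + P l k = (2 : ℂ) • sm 1 (star ((U * Uᵀ) k l) • (ζ l * ζ k)) := by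
    intro k l
    have h1 : P k l = star (τ l k) •
        sm (Φ.row U k * Φ.row U l * Φ.S (τ k * τ l)) (ζ l * ζ k) := by
      simp only [P]
      rw [hww, hx.exch, sm_smul, sm_smul', smul_smul, ← mul_assoc, mul_comm (star (τ k l)),
        h.norm, one_mul]
    have h2 : P l k = star (τ l k) •
        sm (Φ.row U l * Φ.row U k * Φ.S (τ k * τ l)) (ζ l * ζ k) := by
      simp only [P]
      rw [hww, sm_smul, mul_comm (τ l) (τ k)]
    rw [h1, h2, ← smul_add, ← sm_add, ← add_mul, hrr]
    by_cases hc : (U * Uᵀ) k l = 0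
    · simp [hc, sm_zero, sm_zero_right, sm_smul']
    · have h3 : τ k * τ l = 1 := funext fun m => h.compatL _ _ hc m
      have h4 : τ l k = 1 := by
        have := h.compatR _ _ hc l
        rwa [h.diag, mul_one] at this
      rw [h3, h4, map_one, mul_one, star_one, one_smul, sm_smul, sm_smul', smul_smul]
  have h2 : (2 : ℂ) • (Φ.dirac U τ ζ * Φ.dirac U τ ζ) = (2 : ℂ) • 1 := by
    have h3 : Φ.dirac U τ ζ * Φ.dirac U τ ζ = ∑ k, ∑ l, P k l := by
      simp only [dirac, Finset.sum_mul, Finset.mul_sum, sm_mul, P]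
      exact Finset.sum_comm
    have h4 : Φ.dirac U τ ζ * Φ.dirac U τ ζ = ∑ k, ∑ l, P l k := by
      rw [h3]; exact Finset.sum_comm
    rw [two_smul]
    nth_rewrite 1 [h3]
    rw [h4]
    simp only [← Finset.sum_add_distrib, hP, ← Finset.smul_sum, ← sm_sum']
    rw [hx.sum_ζ h.unitary, sm_one]
  exact smul_right_injective _ (two_ne_zero (α := ℂ)) h2

/-- Expanding the adjoint of $\zeta_k$ in the $\zeta_l$ involves only indices with
$\bar\tau_k=\tau_l$, and summing over $k$ turns the rows of $U$ into those of $\bar U$. The diagonal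
phases are 1, so twist and generator commute. -/
theorem Fock.star_dirac (h : Twist U τ) (hx : TwistedCoords U τ x ζ) :
    star (Φ.dirac U τ ζ) = Φ.dirac U τ ζ := by
  have h1 : ∀ k l, star ((U * Uᵀ) k l) • (Φ.S (star (τ k)) * Φ.gam U (U k)) =
      Φ.S (τ l) * Φ.gam U (star ((U * Uᵀ) k l) • U k) := by
    intro k l
    rw [map_smul, mul_smul_comm]
    by_cases hc : (U * Uᵀ) k l = 0
    · simp [hc]
    · congr 3
      funext m
      have h2 := h.compatL _ _ hc m
      have h3 : τ k m ≠ 0 := left_ne_zero_of_mul_eq_one h2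
      exact mul_left_cancel₀ h3 ((h.norm k m).trans h2.symm)
  have h2 : ∀ l, ∑ k, star ((U * Uᵀ) k l) • U k = star (U l) := by
    intro l
    funext a
    rw [Finset.sum_apply]
    simp only [Pi.smul_apply, Matrix.mul_apply, star_sum, smul_eq_mul, Finset.sum_mul,
      transpose_apply, star_mul']
    rw [Finset.sum_comm]
    have : ∀ b, ∑ k, star (U k b) * star (U l b) * U k a = star (U l b) * if b = a then 1 else 0 := by
      intro b
      rw [← sum_star_mul h.unitary, Finset.mul_sum]
      exact Finset.sum_congr rfl fun k _ => by ring
    rw [Finset.sum_congr rfl fun b _ => this b]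
    simp
  have h3 : ∀ l, Φ.S (τ l) * Φ.row U l = Φ.row U l * Φ.S (τ l) := by
    intro l
    rw [Φ.S_row h.unitary _ (h.norm _) _ (fun m hm => h.compatR _ _ hm _), h.diag, star_one,
      one_smul]
  rw [dirac, star_sum]
  simp only [star_sm, tw, star_mul, star_row, star_S, hx.star_ζ h.unitary, sm_sum', sm_smul',
    ← sm_smul, h1]
  rw [Finset.sum_comm]
  refine Finset.sum_congr rfl fun l _ => ?_
  rw [← sm_sum, ← Finset.mul_sum, ← map_sum, h2, ← h3, row]

theorem Fock.tw_mul_chi (h : Twist U τ) (k : K) :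
    Φ.tw U τ k * Φ.chi e U = (-1 : ℂ) ^ n • (Φ.chi e U * Φ.tw U τ k) := by
  rw [tw, mul_assoc, Φ.S_mul_chi e h.unitary _ (h.norm k) (fun a m hm => h.compatR _ _ hm _)
    (h.detR k), ← mul_assoc, row, Φ.gam_mul_chi e h.unitary, smul_mul_assoc, mul_assoc]

/-- The chain of top degree. -/
def Fock.topChain (U : Matrix K K ℂ) (τ : K → K → ℂ) (ζ : K → A) (r : ℕ) : Chain A r :=
  ∑ k : Fin (r + 1) → K, Φ.twTrace e U τ k • chainMk A r (fun i => ζ (k i))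

theorem Fock.topChain_eq_zero (h : Twist U τ) {r : ℕ} (hr : r < n) (hp : Even (r + n)) :
    Φ.topChain e U τ ζ r = 0 := by
  refine Finset.sum_eq_zero fun k _ => ?_
  rw [Φ.twTrace_eq_zero e h (by omega), zero_smul]
  obtain ⟨s, hs⟩ := hp
  exact ⟨s + 1, by omega⟩

theorem prod_ofFn_commute {B : Type*} [Ring B] (c : B) : ∀ {r : ℕ} (w : Fin r → B)
    (_ : ∀ i, w i * c = c * w i), (List.ofFn fun i => c * w i).prod = c ^ r * (List.ofFn w).prod
  | 0, _, _ => by simp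
  | r + 1, w, h => by
    have h1 : w 0 * c ^ r = c ^ r * w 0 := (Commute.pow_right (h 0) r)
    rw [List.ofFn_succ, List.prod_cons, prod_ofFn_commute c (fun i => w i.succ) (fun i => h _),
      List.ofFn_succ, List.prod_cons, pow_succ']
    simp only [mul_assoc]
    rw [← mul_assoc (w 0), h1, mul_assoc]

theorem trHead_half_add {r : ℕ} (X : Matrix κ κ A) :
    trHead r ((1 / 2 : ℂ) • (1 + X) - (1 / 2 : ℂ) • 1) ((1 / 2 : ℂ) • (1 + X)) =
      ((1 / 2 : ℂ) ^ (r + 1)) • trM A κ r (fun _ => X) := by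
  have h1 : (fun j : Fin (r + 1) => if j = 0 then (1 / 2 : ℂ) • (1 + X) - (1 / 2 : ℂ) • 1
      else (1 / 2 : ℂ) • (1 + X)) = (fun _ => (1 / 2 : ℂ) • X) +
      fun j => if j = 0 then 0 else (1 / 2 : ℂ) • (1 : Matrix κ κ A) := by
    funext j
    by_cases hj : j = 0
    · simp only [hj, if_true, Pi.add_apply, add_zero]
      rw [smul_add, add_sub_cancel_left]
    · simp only [hj, if_false, Pi.add_apply, smul_add, add_comm]
  rw [trHead, h1, trM_add_const _ _ (by simp)]
  · have := MultilinearMap.map_smul_univ (trM A κ r) (fun _ : Fin (r + 1) => (1 / 2 : ℂ))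
      (fun _ => X)
    rw [this, Finset.prod_const, Finset.card_univ, Fintype.card_fin]
  · intro j hj
    exact ⟨_, by simpa [hj] using algebraMap_matrix_map (A := A) (1 / 2 : ℂ)⟩

/-- For even `n` the chirality $\chi$ commutes with $F$, so $\frac12(1+\chi F)$ is a projection. The
$2k+1$ copies of $\chi$ in a word reduce to a single one. -/
theorem Fock.exists_even (h : Twist U τ) (hx : TwistedCoords U τ x ζ) (hn : Even n) :
    ∃ F ∈ evenReal A, ∀ k, F k = ((1 / 2 : ℂ) ^ (2 * k + 1)) • Φ.topChain e U τ ζ (2 * k) := by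
  set X := sm (Φ.chi e U) (1 : A) with hX
  set F := Φ.dirac U τ ζ with hF
  have hFF : F * F = 1 := Φ.dirac_sq h hx
  have hXX : X * X = 1 := by rw [hX, sm_mul, Φ.chi_sq e h.unitary, one_mul, sm_one]
  have hXs : star X = X := by rw [hX, star_sm, Φ.star_chi e h.unitary, star_one]
  have htw : ∀ k, Φ.tw U τ k * Φ.chi e U = Φ.chi e U * Φ.tw U τ k := fun k => by
    rw [Φ.tw_mul_chi e h, hn.neg_one_pow, one_smul]
  have hFX : F * X = X * F := by
    simp only [hF, dirac, hX, Finset.sum_mul, Finset.mul_sum, sm_mul, mul_one, one_mul, htw]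
  have hsq : (X * F) * (X * F) = 1 := by
    rw [mul_assoc, ← mul_assoc F, hFX, mul_assoc, hFF, mul_one, hXX]
  have hid : ((1 / 2 : ℂ) • (1 + X * F)) * ((1 / 2 : ℂ) • (1 + X * F)) =
      (1 / 2 : ℂ) • (1 + X * F) := by
    rw [smul_mul_smul_comm]
    simp only [mul_add, add_mul, hsq, mul_one, one_mul]
    module
  have hst : star ((1 / 2 : ℂ) • (1 + X * F)) = (1 / 2 : ℂ) • (1 + X * F) := by
    have h2 : star (1 / 2 : ℂ) = 1 / 2 := by
      rw [show (1 / 2 : ℂ) = ((1 / 2 : ℝ) : ℂ) by norm_num, Complex.star_def, Complex.conj_ofReal]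
    rw [star_smul, star_add, star_one, star_mul, hXs, hF, Φ.star_dirac h hx, ← hF, hFX, h2]
  refine ⟨_, evenSeq_mem _ hid hst, fun k => ?_⟩
  rw [evenSeq, trHead_half_add]
  congr 1
  have h1 : X * F = ∑ k, sm (Φ.chi e U * Φ.tw U τ k) (ζ k) := by
    simp only [hF, dirac, hX, Finset.mul_sum, sm_mul, one_mul]
  rw [h1, trM_sum_sm (fun _ k => Φ.chi e U * Φ.tw U τ k) ζ, topChain]
  refine Finset.sum_congr rfl fun a _ => ?_
  rw [prod_ofFn_commute _ (fun j => Φ.tw U τ (a j)) (fun j => htw _), twTrace, pow_succ, pow_mul,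
    sq, Φ.chi_sq e h.unitary, one_pow, one_mul]

/-- Each letter exchanges `p` and `q`, so every inserted idempotent moves left and is absorbed by
its predecessor. -/
theorem prod_ofFn_alternate {B : Type*} [Ring B] : ∀ {r : ℕ} (p q : B) (_ : p * p = p)
    (_ : q * q = q) (w : Fin (r + 1) → B) (_ : ∀ i, w i * p = q * w i)
    (_ : ∀ i, w i * q = p * w i),
    (List.ofFn fun i : Fin (r + 1) => (if Even i.val then p else q) * w i).prod =
      p * (List.ofFn w).prod
  | 0, p, q, _, _, w, _, _ => by simp
  | r + 1, p, q, hp, hq, w, h1, h2 => by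
    have ih := prod_ofFn_alternate q p hq hp (fun i : Fin (r + 1) => w i.succ) (fun i => h2 _)
      (fun i => h1 _)
    rw [List.ofFn_succ, List.prod_cons, List.ofFn_succ (f := w), List.prod_cons]
    have h3 : ∀ i : Fin (r + 1), (if Even (i.succ).val then p else q) * w i.succ =
        (if Even i.val then q else p) * w i.succ := by
      intro i
      rw [Fin.val_succ]
      by_cases hi : Even i.val
      · simp [hi, Nat.even_add_one]
      · simp [hi, Nat.even_add_one]
    simp only [h3, ih]
    rw [if_pos (by simp), mul_assoc, ← mul_assoc (w 0), h2, mul_assoc, ← mul_assoc p p, hp]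

/-- The constants matter only in the zeroth slot. -/
theorem trAlt_add_const (X Y C D : Matrix κ κ A) (r : ℕ)
    (hC : ∃ C' : Matrix κ κ ℂ, C = C'.map (algebraMap ℂ A))
    (hD : ∃ D' : Matrix κ κ ℂ, D = D'.map (algebraMap ℂ A)) :
    trAlt r (X + C) (Y + D) = trAlt r X Y +
      trM A κ r (fun j => if j = 0 then C else if Even j.val then X else Y) := by
  have e1 : (fun j : Fin (r + 1) => if Even j.val then X + C else Y + D) =
      (fun j => if j = 0 then X + C else if Even j.val then X else Y) +
      fun j => if j = 0 then 0 else if Even j.val then C else D := by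
    funext j
    by_cases hj : j = 0
    · simp [hj]
    · simp only [hj, if_false, Pi.add_apply]
      split_ifs <;> rfl
  rw [trAlt, e1, trM_add_const _ _ (by simp)]
  · have e2 : ∀ Z : Matrix κ κ A,
        (fun j : Fin (r + 1) => if j = 0 then Z else if Even j.val then X else Y) =
        Function.update (fun j => if Even j.val then X else Y) 0 Z := by
      intro Z
      funext j
      simp [Function.update_apply]
    rw [e2, MultilinearMap.map_update_add, ← e2 C, trAlt]
    congr 2
    funext j
    by_cases hj : j = 0
    · simp [hj]
    · simp [hj]
  · intro j hj
    simp only [hj, if_false]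
    split_ifs
    · exact hC
    · exact hD

theorem trM_head_add_neg (r : ℕ) (C : Matrix κ κ A) (M : Fin (r + 1) → Matrix κ κ A) :
    trM A κ r (fun j => if j = 0 then (1 : ℂ) • C else M j) +
      trM A κ r (fun j => if j = 0 then (-1 : ℂ) • C else M j) = 0 := by
  have e2 : ∀ Z : Matrix κ κ A, (fun j : Fin (r + 1) => if j = 0 then Z else M j) =
      Function.update M 0 Z := by
    intro Z
    funext j
    simp [Function.update_apply]
  rw [e2, e2, MultilinearMap.map_update_smul, MultilinearMap.map_update_smul, ← add_smul]
  simp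

-- For odd `n` the chirality anticommutes with $F$, so with $p,q=\frac12(1\pm\chi)$ the element $pF$
-- is only a partial isometry. A constant Clifford generator $G$ completes it to the unitaries
-- $pF\pm qG$. Adding the two characters cancels the constants left in zeroth slots, and the two
-- alternating halves combine through $p-q=\chi$.
set_option maxHeartbeats 800000 in
theorem Fock.exists_odd (h : Twist U τ) (hx : TwistedCoords U τ x ζ) (hn : Odd n) :
    ∃ F ∈ oddReal A, ∀ k, F k = (2 : ℂ) • Φ.topChain e U τ ζ (2 * k + 1) := by
  set χ := Φ.chi e U with hχ
  set p : Matrix κ κ ℂ := (1 / 2 : ℂ) • (1 + χ) with hp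
  set q : Matrix κ κ ℂ := (1 / 2 : ℂ) • (1 - χ) with hq
  set g := Φ.gen U (e 0) with hg
  set F := Φ.dirac U τ ζ with hF
  have h2 : star (1 / 2 : ℂ) = 1 / 2 := by
    rw [show (1 / 2 : ℂ) = ((1 / 2 : ℝ) : ℂ) by norm_num, Complex.star_def, Complex.conj_ofReal]
  have hχχ : χ * χ = 1 := Φ.chi_sq e h.unitary
  have hχs : star χ = χ := Φ.star_chi e h.unitary
  have hpp : p * p = p := by
    rw [hp, smul_mul_smul_comm]
    simp only [mul_add, add_mul, mul_sub, sub_mul, hχχ, mul_one, one_mul]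
    module
  have hqq : q * q = q := by
    rw [hq, smul_mul_smul_comm]
    simp only [mul_add, add_mul, mul_sub, sub_mul, hχχ, mul_one, one_mul]
    module
  have hpq : p * q = 0 := by
    rw [hp, hq, smul_mul_smul_comm]
    simp only [mul_add, add_mul, mul_sub, sub_mul, hχχ, mul_one, one_mul]
    module
  have hqp : q * p = 0 := by
    rw [hp, hq, smul_mul_smul_comm]
    simp only [mul_add, add_mul, mul_sub, sub_mul, hχχ, mul_one, one_mul]
    module
  have hpq1 : p + q = 1 := by rw [hp, hq]; module
  have hpmq : p - q = χ := by rw [hp, hq]; module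
  have hps : star p = p := by rw [hp, star_smul, star_add, star_one, hχs, h2]
  have hqs : star q = q := by rw [hq, star_smul, star_sub, star_one, hχs, h2]
  have hanti : ∀ w : Matrix κ κ ℂ, w * χ = -(χ * w) → w * p = q * w ∧ w * q = p * w := by
    intro w hw
    constructor
    · rw [hp, hq, mul_smul_comm, smul_mul_assoc, mul_add, sub_mul, hw, mul_one, one_mul,
        sub_eq_add_neg]
    · rw [hp, hq, mul_smul_comm, smul_mul_assoc, mul_sub, add_mul, hw, mul_one, one_mul,
        sub_neg_eq_add]
  have htw : ∀ k, Φ.tw U τ k * p = q * Φ.tw U τ k ∧ Φ.tw U τ k * q = p * Φ.tw U τ k := fun k =>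
    hanti _ (by rw [Φ.tw_mul_chi e h, hn.neg_one_pow, neg_one_smul])
  have hgp : g * p = q * g ∧ g * q = p * g :=
    hanti _ (by rw [Φ.gen_mul_chi e h.unitary, hn.neg_one_pow, neg_one_smul])
  have hgg : g * g = 1 := Φ.gen_sq h.unitary _
  have hgs : star g = g := Φ.star_gen _
  have hFF : F * F = 1 := Φ.dirac_sq h hx
  have hFs : star F = F := Φ.star_dirac h hx
  set P := sm p (1 : A) with hP
  set Q := sm q (1 : A) with hQ
  set G := sm g (1 : A) with hG
  have smm : ∀ C D : Matrix κ κ ℂ, sm C (1 : A) * sm D 1 = sm (C * D) 1 := fun C D => by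
    rw [sm_mul, one_mul]
  have hFP : F * P = Q * F := by
    simp only [hF, dirac, hP, hQ, Finset.sum_mul, Finset.mul_sum, sm_mul, mul_one, one_mul,
      (htw _).1]
  have hFQ : F * Q = P * F := by
    simp only [hF, dirac, hP, hQ, Finset.sum_mul, Finset.mul_sum, sm_mul, mul_one, one_mul,
      (htw _).2]
  have hGP : G * P = Q * G := by rw [hG, hP, hQ, smm, smm, hgp.1]
  have hGQ : G * Q = P * G := by rw [hG, hP, hQ, smm, smm, hgp.2]
  have hGG : G * G = 1 := by rw [hG, smm, hgg, sm_one]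
  have hPP : P * P = P := by rw [hP, smm, hpp]
  have hQQ : Q * Q = Q := by rw [hQ, smm, hqq]
  have hPQ : P * Q = 0 := by rw [hP, hQ, smm, hpq, sm_zero]
  have hQP : Q * P = 0 := by rw [hP, hQ, smm, hqp, sm_zero]
  have hPQ1 : P + Q = 1 := by rw [hP, hQ, ← sm_add, hpq1, sm_one]
  have hPs : star P = P := by rw [hP, star_sm, hps, star_one]
  have hQs : star Q = Q := by rw [hQ, star_sm, hqs, star_one]
  have hGs : star G = G := by rw [hG, star_sm, hgs, star_one]
  have hU : ∀ s : ℂ, s * s = 1 → star s = s →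
      star (P * F + s • (Q * G)) = Q * F + s • (P * G) := by
    intro s _ hs
    rw [star_add, star_smul, star_mul, star_mul, hPs, hQs, hFs, hGs, hFP, hGQ, hs]
  have hmem : ∀ s : ℂ, s * s = 1 → star s = s → oddSeq (P * F + s • (Q * G)) ∈ oddReal A := by
    intro s hs hs'
    have a1 : Q * F * (P * F) = Q := by
      rw [mul_assoc, ← mul_assoc F, hFP, mul_assoc, hFF, mul_one, hQQ]
    have a2 : Q * F * (Q * G) = 0 := by
      rw [mul_assoc, ← mul_assoc F, hFQ, mul_assoc, ← mul_assoc, hQP, zero_mul]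
    have a3 : P * G * (P * F) = 0 := by
      rw [mul_assoc, ← mul_assoc G, hGP, mul_assoc, ← mul_assoc, hPQ, zero_mul]
    have a4 : P * G * (Q * G) = P := by
      rw [mul_assoc, ← mul_assoc G, hGQ, mul_assoc, hGG, mul_one, hPP]
    have b1 : P * F * (Q * F) = P := by
      rw [mul_assoc, ← mul_assoc F, hFQ, mul_assoc, hFF, mul_one, hPP]
    have b2 : P * F * (P * G) = 0 := by
      rw [mul_assoc, ← mul_assoc F, hFP, mul_assoc, ← mul_assoc, hPQ, zero_mul]
    have b3 : Q * G * (Q * F) = 0 := by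
      rw [mul_assoc, ← mul_assoc G, hGQ, mul_assoc, ← mul_assoc, hQP, zero_mul]
    have b4 : Q * G * (P * G) = Q := by
      rw [mul_assoc, ← mul_assoc G, hGP, mul_assoc, hGG, mul_one, hQQ]
    refine oddSeq_mem _ ?_ ?_
    · rw [hU s hs hs', add_mul, mul_add, mul_add, smul_mul_smul_comm, smul_mul_assoc,
        mul_smul_comm, a1, a2, a3, a4, hs, one_smul, smul_zero, add_zero, zero_add,
        add_comm, hPQ1]
    · rw [hU s hs hs', add_mul, mul_add, mul_add, smul_mul_smul_comm, smul_mul_assoc,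
        mul_smul_comm, b1, b2, b3, b4, hs, one_smul, smul_zero, add_zero, zero_add,
        hPQ1]
  have hPG : ∀ s : ℂ, ∃ D : Matrix κ κ ℂ, s • (P * G) = D.map (algebraMap ℂ A) := fun s =>
    ⟨s • (p * g), by rw [hP, hG, smm, ← sm_smul, sm_one_eq_map]⟩
  have hQG : ∀ s : ℂ, ∃ D : Matrix κ κ ℂ, s • (Q * G) = D.map (algebraMap ℂ A) := fun s =>
    ⟨s • (q * g), by rw [hQ, hG, smm, ← sm_smul, sm_one_eq_map]⟩
  refine ⟨_, AddSubgroup.add_mem _ (hmem 1 (by norm_num) (by simp))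
    (hmem (-1) (by norm_num) (by simp)), fun k => ?_⟩
  have key : ∀ (p' q' : Matrix κ κ ℂ), p' * p' = p' → q' * q' = q' →
      (∀ k, Φ.tw U τ k * p' = q' * Φ.tw U τ k) → (∀ k, Φ.tw U τ k * q' = p' * Φ.tw U τ k) →
      trAlt (2 * k + 1) (sm p' (1 : A) * F) (sm q' (1 : A) * F) =
      ∑ a : Fin (2 * k + 2) → K, Matrix.trace (p' * (List.ofFn fun i => Φ.tw U τ (a i)).prod) •
        chainMk A (2 * k + 1) (fun i => ζ (a i)) := by
    intro p' q' hp' hq' h1 h2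
    have e1 : ∀ C : Matrix κ κ ℂ, sm C (1 : A) * F = ∑ k, sm (C * Φ.tw U τ k) (ζ k) := by
      intro C
      simp only [hF, dirac, Finset.mul_sum, sm_mul, one_mul]
    have e2 : (fun j : Fin (2 * k + 2) => if Even j.val then sm p' (1 : A) * F else sm q' 1 * F) =
        fun j => ∑ a, sm ((if Even j.val then p' else q') * Φ.tw U τ a) (ζ a) := by
      funext j
      split_ifs <;> rw [e1]
    rw [trAlt, e2, trM_sum_sm (fun j a => (if Even j.val then p' else q') * Φ.tw U τ a) ζ]
    refine Finset.sum_congr rfl fun a _ => ?_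
    rw [prod_ofFn_alternate p' q' hp' hq' (fun j => Φ.tw U τ (a j)) (fun i => h1 _)
      (fun i => h2 _)]
  rw [Pi.add_apply, oddSeq, oddSeq, hU 1 (by norm_num) (by simp), hU (-1) (by norm_num) (by simp),
    trAlt_add_const _ _ _ _ _ (hQG 1) (hPG 1), trAlt_add_const _ _ _ _ _ (hQG (-1)) (hPG (-1)),
    trAlt_add_const _ _ _ _ _ (hPG 1) (hQG 1), trAlt_add_const _ _ _ _ _ (hPG (-1)) (hQG (-1)),
    key p q hpp hqq (fun k => (htw k).1) (fun k => (htw k).2),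
    key q p hqq hpp (fun k => (htw k).2) (fun k => (htw k).1)]
  have e3 : ∀ X Y a b c d : Chain A (2 * k + 1), a + b = 0 → c + d = 0 →
      X + a - (Y + c) + (X + b - (Y + d)) = (2 : ℂ) • (X - Y) := by
    intro X Y a b c d hab hcd
    rw [eq_neg_of_add_eq_zero_left hab, eq_neg_of_add_eq_zero_left hcd]
    module
  rw [e3 _ _ _ _ _ _ (trM_head_add_neg _ _ _) (trM_head_add_neg _ _ _), topChain, ← Finset.sum_sub_distrib]
  congr 1
  refine Finset.sum_congr rfl fun a _ => ?_
  rw [← sub_smul, ← Matrix.trace_sub, ← sub_mul, hpmq, twTrace]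

end Dirac

/-! ### Hochschild cocycles from derivations. -/

section Cocycle

variable {A B : Type*} [Ring A] [Algebra ℂ A] [Ring B] [Algebra ℂ B] (ρ : A →ₐ[ℂ] B)
  (δ : A →ₗ[ℂ] B) (ℓ : B →ₗ[ℂ] ℂ)

theorem merge_succ_succ {l : ℕ} (i : Fin (l + 1)) (a : Fin (l + 3) → A) (j : Fin (l + 1)) :
    merge i.succ a j.succ = merge i (fun k => a k.succ) j := by
  simp only [merge, Fin.succ_lt_succ_iff, Fin.succ_inj, Fin.castSucc_succ]

theorem merge_zero_succ {l : ℕ} (a : Fin (l + 3) → A) (j : Fin (l + 1)) :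
    merge 0 a j.succ = a j.succ.succ := by
  simp [merge, Fin.succ_ne_zero]

/-- The product of the values of a derivation. -/
def derWord {r : ℕ} (a : Fin r → A) : B := (List.ofFn fun i => δ (a i)).prod

theorem derWord_succ {r : ℕ} (a : Fin (r + 1) → A) :
    derWord δ a = δ (a 0) * derWord δ (fun i => a i.succ) := by
  rw [derWord, List.ofFn_succ, List.prod_cons, derWord]

variable {ρ δ} (hδ : ∀ a c, δ (a * c) = ρ a * δ c + δ a * ρ c)

include hδ

/-- The Leibniz rule writes each face as two terms; neighbouring faces cancel and only the two outer
terms remain. -/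
theorem sum_derWord_merge : ∀ {l : ℕ} (a : Fin (l + 2) → A),
    ∑ i : Fin (l + 1), (-1 : ℂ) ^ (i : ℕ) • derWord δ (merge i a) =
      ρ (a 0) * derWord δ (fun i : Fin (l + 1) => a i.succ) +
        (-1 : ℂ) ^ l • (derWord δ (fun i : Fin (l + 1) => a i.castSucc) * ρ (a (Fin.last _)))
  | 0, a => by
    simp only [derWord_succ]
    simp [derWord, merge, hδ]
  | l + 1, a => by
    rw [Fin.sum_univ_succ]
    have h1 : ∀ i : Fin (l + 1), (-1 : ℂ) ^ (i.succ : ℕ) • derWord δ (merge i.succ a) =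
        -(δ (a 0) * ((-1 : ℂ) ^ (i : ℕ) • derWord δ (merge i (fun k => a k.succ)))) := by
      intro i
      rw [derWord_succ]
      simp only [merge_succ_succ]
      have h2 : merge i.succ a 0 = a 0 := by simp [merge]
      rw [h2, Fin.val_succ, pow_succ, mul_neg_one, neg_smul, mul_smul_comm]
    have h3 : merge 0 a 0 = a 0 * a 1 := by simp [merge]
    simp only [h1]
    rw [Finset.sum_neg_distrib, ← Finset.mul_sum, sum_derWord_merge (fun k => a k.succ),
      derWord_succ δ (merge 0 a), h3, hδ]
    simp only [merge_zero_succ]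
    rw [derWord_succ δ (fun i : Fin (l + 2) => a i.succ),
      derWord_succ δ (fun i : Fin (l + 2) => a i.castSucc), Fin.val_zero, pow_zero, one_smul,
      pow_succ, mul_neg_one, neg_smul, mul_add, mul_smul_comm]
    simp only [Fin.succ_castSucc, Fin.succ_last, Fin.succ_zero_eq_one, Fin.castSucc_zero, mul_assoc,
      add_mul]
    abel

theorem der_one : δ 1 = 0 := by
  have := hδ 1 1
  rw [mul_one, map_one ρ, one_mul, mul_one] at this
  exact left_eq_add.mp this

/-- The functional `a₀ ⊗ ⋯ ⊗ aₗ ↦ ℓ(ρ(a₀) δ(a₁) ⋯ δ(aₗ))`. -/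
def derCocycle (l : ℕ) : Chain A l →ₗ[ℂ] ℂ :=
  chainLift (ℓ.compMultilinearMap ((MultilinearMap.mkPiAlgebraFin ℂ (l + 1) B).compLinearMap
    (fun j => if j = 0 then ρ.toLinearMap else δ))) (fun a j hj h => by
      simp only [LinearMap.compMultilinearMap_apply, MultilinearMap.compLinearMap_apply,
        MultilinearMap.mkPiAlgebraFin_apply]
      rw [List.prod_eq_zero, map_zero]
      rw [List.mem_ofFn]
      exact ⟨j, by rw [if_neg hj, h, der_one hδ]⟩)

theorem derCocycle_chainMk (l : ℕ) (a : Fin (l + 1) → A) :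
    derCocycle ℓ hδ l (chainMk A l a) = ℓ (ρ (a 0) * derWord δ (fun i : Fin l => a i.succ)) := by
  rw [derCocycle, chainLift_chainMk]
  simp only [LinearMap.compMultilinearMap_apply, MultilinearMap.compLinearMap_apply,
    MultilinearMap.mkPiAlgebraFin_apply, List.ofFn_succ, List.prod_cons, derWord]
  simp [Fin.succ_ne_zero]

/-- After telescoping, the one remaining term has `ρ` of the last entry on the right, and the trace
property `hℓ` matches it with the cyclic face. -/
theorem derCocycle_b (hℓ : ∀ a X, ℓ (ρ a * X) = ℓ (X * ρ a)) (l : ℕ) (c : Chain A (l + 1)) :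
    derCocycle ℓ hδ l (b A l c) = 0 := by
  suffices h : (derCocycle ℓ hδ l ∘ₗ b A l) ∘ₗ (degenerate A (l + 1)).mkQ = 0 by
    obtain ⟨c, rfl⟩ := Submodule.mkQ_surjective _ c
    exact LinearMap.congr_fun h c
  refine PiTensorProduct.ext (MultilinearMap.ext fun a => ?_)
  change derCocycle ℓ hδ l (b A l (chainMk A (l + 1) a)) = 0
  have hlast : derCocycle ℓ hδ l (chainMk A l (merge 0 (a ∘ (finRotate (l + 2)).symm))) =
      ℓ (ρ (a 0) * (derWord δ (fun i : Fin l => a i.succ.castSucc) * ρ (a (Fin.last _)))) := by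
    have h1 : ∀ k : Fin (l + 1), (finRotate (l + 2)).symm k.succ = k.castSucc := by
      intro k
      rw [Equiv.symm_apply_eq, finRotate_apply]
      ext; simp
    have h0 : (finRotate (l + 2)).symm 0 = Fin.last _ := by
      rw [Equiv.symm_apply_eq, finRotate_last]
    have h2 : merge 0 (a ∘ (finRotate (l + 2)).symm) 0 = a (Fin.last _) * a 0 := by
      simp only [merge, lt_irrefl, if_true, if_false, Function.comp_apply, Fin.castSucc_zero, h0,
        h1]
    have h3 : ∀ i : Fin l, merge 0 (a ∘ (finRotate (l + 2)).symm) i.succ = a i.succ.castSucc := by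
      intro i
      simp [merge, Fin.succ_ne_zero, h1]
    rw [derCocycle_chainMk, h2]
    simp only [h3]
    rw [map_mul ρ, mul_assoc, hℓ, mul_assoc]
  rw [b_chainMk, map_add, map_smul, map_sum, hlast]
  simp only [map_smul, derCocycle_chainMk]
  cases l with
  | zero =>
    simp [merge, derWord]
  | succ l =>
    rw [Fin.sum_univ_succ]
    have h1 : ∀ i : Fin (l + 1), (-1 : ℂ) ^ (i.succ : ℕ) • ℓ (ρ (merge i.succ a 0) *
          derWord δ (fun j : Fin (l + 1) => merge i.succ a j.succ)) =
        -ℓ (ρ (a 0) * ((-1 : ℂ) ^ (i : ℕ) • derWord δ (merge i (fun k => a k.succ)))) := by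
      intro i
      simp only [merge_succ_succ]
      have h2 : merge i.succ a 0 = a 0 := by simp [merge]
      rw [h2, Fin.val_succ, pow_succ, mul_neg_one, neg_smul, mul_smul_comm, map_smul]
    have h3 : merge 0 a 0 = a 0 * a 1 := by simp [merge]
    simp only [h1]
    rw [Finset.sum_neg_distrib, ← map_sum, ← Finset.mul_sum,
      sum_derWord_merge hδ (fun k => a k.succ), h3]
    simp only [merge_zero_succ]
    rw [mul_add, map_add, map_mul ρ, mul_assoc, Fin.val_zero, pow_zero, one_smul, mul_smul_comm,
      map_smul, pow_add, pow_add]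
    simp only [Fin.succ_castSucc, Fin.succ_last, Fin.succ_zero_eq_one, smul_eq_mul]
    ring

theorem derCocycle_eq_zero_of_mem_range (hℓ : ∀ a X, ℓ (ρ a * X) = ℓ (X * ρ a)) (l : ℕ)
    (c : Chain A l) (hc : c ∈ LinearMap.range (b A l)) : derCocycle ℓ hδ l c = 0 := by
  obtain ⟨d, rfl⟩ := hc
  exact derCocycle_b ℓ hδ hℓ l d

end Cocycle

/-! ### Coordinates that commute up to phases. -/

section DiagonalCoordinates

open Matrix

variable {N₁ N₂ : ℕ} {R : RMatrix N₁ N₂} {B : Type*} [Ring B] [Algebra ℂ B]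
  {u : Matrix (Fin N₁) (Fin N₁) ℂ} {v : Matrix (Fin N₂) (Fin N₂) ℂ} {t : Fin N₁ → Fin N₂ → ℂ}

theorem sum_mul_star {N : Type*} [Fintype N] [DecidableEq N] {u : Matrix N N ℂ} (hu : u * uᴴ = 1) (i j : N) :
    ∑ l, u i l * star (u j l) = if i = j then 1 else 0 := by
  have := congrFun₂ hu i j
  rw [Matrix.mul_apply, Matrix.one_apply] at this
  exact this

theorem sum_conj_combination {N : Type*} [Fintype N] [DecidableEq N] {u : Matrix N N ℂ} (hu : u * uᴴ = 1)
    (z : N → B) (i : N) : ∑ l, u i l • ∑ j, star (u j l) • z j = z i := by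
  simp only [Finset.smul_sum, smul_smul]
  rw [Finset.sum_comm]
  simp only [← Finset.sum_smul, sum_mul_star hu]
  simp

theorem sum_combination {N : Type*} [Fintype N] [DecidableEq N] {u : Matrix N N ℂ} (hu : u * uᴴ = 1)
    (x : N → B) (l : N) : ∑ i, star (u i l) • ∑ m, u i m • x m = x l := by
  simp only [Finset.smul_sum, smul_smul]
  rw [Finset.sum_comm]
  simp only [← Finset.sum_smul, sum_star_mul hu]
  simp

theorem Diagonalizes.sum_smul (h : Diagonalizes R u v t) (X₁ : Fin N₁ → B) (X₂ : Fin N₂ → B)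
    (l : Fin N₁) (a : Fin N₂) : ∑ b, ∑ m, R l a b m • (X₂ b * X₁ m) =
      ∑ i, ∑ j, (star (u i l) * star (v j a) * t i j) •
        ((∑ b, v j b • X₂ b) * ∑ m, u i m • X₁ m) := by
  simp only [h.eq, Finset.sum_smul, Finset.sum_mul, Finset.mul_sum, Finset.smul_sum,
    smul_mul_smul_comm, smul_smul]
  rw [Finset.sum_comm' (t' := Finset.univ) (s' := fun _ => Finset.univ) (by simp)]
  have e1 : ∀ f : Fin N₁ → Fin N₂ → Fin N₁ → Fin N₂ → B,
      ∑ m, ∑ b, ∑ i, ∑ j, f m b i j = ∑ i, ∑ j, ∑ m, ∑ b, f m b i j := by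
    intro f
    have e2 : ∀ m, ∑ b, ∑ i, ∑ j, f m b i j = ∑ i, ∑ j, ∑ b, f m b i j := by
      intro m
      rw [Finset.sum_comm]
      exact Finset.sum_congr rfl fun i _ => Finset.sum_comm
    simp only [e2]
    rw [Finset.sum_comm]
    exact Finset.sum_congr rfl fun i _ => Finset.sum_comm
  rw [e1]
  refine Finset.sum_congr rfl fun i _ => Finset.sum_congr rfl fun j _ =>
    Finset.sum_congr rfl fun m _ => Finset.sum_congr rfl fun b _ => ?_
  congr 1
  ring

/-- Elements satisfying the diagonal exchange relations satisfy those of `R` after a unitary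
change. -/
theorem Diagonalizes.exchange (h : Diagonalizes R u v t) {z : Fin N₁ → B} {w : Fin N₂ → B}
    (hz : ∀ i j, z i * z j = z j * z i) (hw : ∀ i j, w i * w j = w j * w i)
    (hzw : ∀ i j, z i * w j = t i j • (w j * z i)) :
    Exchange R (fun l => ∑ i, star (u i l) • z i) (fun a => ∑ j, star (v j a) • w j) where
  comm₁ l m := by
    simp only [Finset.sum_mul, Finset.mul_sum, smul_mul_smul_comm]
    rw [Finset.sum_comm]
    refine Finset.sum_congr rfl fun i _ => Finset.sum_congr rfl fun j _ => ?_
    rw [hz, mul_comm]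
  comm₂ l m := by
    simp only [Finset.sum_mul, Finset.mul_sum, smul_mul_smul_comm]
    rw [Finset.sum_comm]
    refine Finset.sum_congr rfl fun i _ => Finset.sum_congr rfl fun j _ => ?_
    rw [hw, mul_comm]
  mixed l a := by
    rw [h.sum_smul]
    simp only [sum_conj_combination h.unitary₁, sum_conj_combination h.unitary₂]
    simp only [Finset.sum_mul, Finset.mul_sum, smul_mul_smul_comm, hzw, smul_smul]
    rw [Finset.sum_comm]

theorem Diagonalizes.exchange_diagonal (h : Diagonalizes R u v t) {X₁ : Fin N₁ → B}
    {X₂ : Fin N₂ → B} (hX : Exchange R X₁ X₂) (i : Fin N₁) (j : Fin N₂) :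
    (∑ l, u i l • X₁ l) * (∑ a, v j a • X₂ a) =
      t i j • ((∑ a, v j a • X₂ a) * ∑ l, u i l • X₁ l) := by
  set z : Fin N₁ → B := fun i => ∑ l, u i l • X₁ l with hz
  set w : Fin N₂ → B := fun j => ∑ a, v j a • X₂ a with hw
  have h1 : ∀ l a, X₁ l * X₂ a = ∑ i, ∑ j, (star (u i l) * star (v j a) * t i j) • (w j * z i) :=
    fun l a => (hX.mixed l a).trans (h.sum_smul X₁ X₂ l a)
  have h2 : z i * w j = ∑ i', ∑ j', ((∑ l, u i l * star (u i' l)) *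
      (∑ a, v j a * star (v j' a)) * t i' j') • (w j' * z i') := by
    have h3 : z i * w j = ∑ a, ∑ l, (u i l * v j a) • (X₁ l * X₂ a) := by
      simp only [hz, hw, Finset.sum_mul, Finset.mul_sum, smul_mul_smul_comm]
    rw [h3]
    clear_value z w
    simp only [h1, Finset.smul_sum, smul_smul, Finset.sum_smul, Finset.sum_mul, Finset.mul_sum]
    have e1 : ∀ f : Fin N₂ → Fin N₁ → Fin N₁ → Fin N₂ → B,
        ∑ a, ∑ l, ∑ i', ∑ j', f a l i' j' = ∑ i', ∑ j', ∑ a, ∑ l, f a l i' j' := by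
      intro f
      have e2 : ∀ a, ∑ l, ∑ i, ∑ j, f a l i j = ∑ i, ∑ j, ∑ l, f a l i j := by
        intro m
        rw [Finset.sum_comm]
        exact Finset.sum_congr rfl fun i _ => Finset.sum_comm
      simp only [e2]
      rw [Finset.sum_comm]
      exact Finset.sum_congr rfl fun i _ => Finset.sum_comm
    rw [e1]
    refine Finset.sum_congr rfl fun i _ => Finset.sum_congr rfl fun j _ =>
      Finset.sum_congr rfl fun m _ => Finset.sum_congr rfl fun b _ => ?_
    congr 1
    ring
  change z i * w j = t i j • (w j * z i)
  rw [h2]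
  simp only [sum_mul_star h.unitary₁, sum_mul_star h.unitary₂]
  rw [Finset.sum_eq_single i, Finset.sum_eq_single j]
  · simp
  · intro j' _ hj'
    simp [hj'.symm]
  · simp
  · intro i' _ hi'
    simp [hi'.symm]
  · simp

theorem commute_combinations {N : ℕ} {x : Fin N → B} (hx : ∀ l m, x l * x m = x m * x l)
    (c d : Fin N → ℂ) : (∑ l, c l • x l) * (∑ m, d m • x m) =
      (∑ m, d m • x m) * ∑ l, c l • x l := by
  simp only [Finset.sum_mul, Finset.mul_sum, smul_mul_smul_comm]
  rw [Finset.sum_comm]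
  refine Finset.sum_congr rfl fun i _ => Finset.sum_congr rfl fun j _ => ?_
  rw [hx, mul_comm]

/-- The diagonal coordinates of the sphere. -/
def diagCoord (R : RMatrix N₁ N₂) (u : Matrix (Fin N₁) (Fin N₁) ℂ)
    (v : Matrix (Fin N₂) (Fin N₂) ℂ) (k : Fin N₁ ⊕ Fin N₂) : Sphere R :=
  ∑ a, fromBlocks u 0 0 v k a • coord R a

theorem diagCoord_inl (i : Fin N₁) :
    diagCoord R u v (Sum.inl i) = ∑ l, u i l • coord R (Sum.inl l) := by
  simp [diagCoord, Fintype.sum_sum_type]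

theorem diagCoord_inr (j : Fin N₂) :
    diagCoord R u v (Sum.inr j) = ∑ a, v j a • coord R (Sum.inr a) := by
  simp [diagCoord, Fintype.sum_sum_type]

theorem Diagonalizes.twistedCoords (h : Diagonalizes R u v t)
    (hT : Twist (fromBlocks u 0 0 v) (phases t)) :
    TwistedCoords (fromBlocks u 0 0 v) (phases t) (coord R) (diagCoord R u v) where
  star_x := star_coord
  sum_sq := sum_coord_sq
  ζ_eq _ := rfl
  exch k l := by
    rcases k with i | j <;> rcases l with i' | j'
    · rw [diagCoord_inl, diagCoord_inl, commute_combinations (exchange_coord R).comm₁]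
      simp [phases]
    · rw [diagCoord_inl, diagCoord_inr, h.exchange_diagonal (exchange_coord R)]
      simp [phases]
    · rw [diagCoord_inl, diagCoord_inr, h.exchange_diagonal (exchange_coord R), smul_smul]
      have := hT.norm (Sum.inl i') (Sum.inr j)
      simp only [phases] at this ⊢
      rw [one_mul, mul_comm, this, one_smul]
    · rw [diagCoord_inr, diagCoord_inr, commute_combinations (exchange_coord R).comm₂]
      simp [phases]

end DiagonalCoordinates

/-! ### Twisted first-order jets at a coordinate point. -/

section Representation

open Matrix TrivSqZeroExt

variable {K κ : Type*} [Fintype K] [DecidableEq K] [Fintype κ] [DecidableEq κ] (Φ : Fock K κ)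

/-- The linear map deleting the coordinate `o`. -/
def dropCoord (o : K) : (K → ℂ) →ₗ[ℂ] K → ℂ :=
  LinearMap.pi fun k => if k = o then 0 else LinearMap.proj k

theorem dropCoord_apply (o : K) (w : K → ℂ) (k : K) :
    dropCoord o w k = if k = o then 0 else w k := by
  simp only [dropCoord, LinearMap.pi_apply]
  split_ifs <;> simp

/-- The first order jet at a point of the classical sphere, with differentials `θ`. -/
def Fock.jet (o : K) : (K → ℂ) →ₗ[ℂ] TrivSqZeroExt (Matrix κ κ ℂ) (Matrix κ κ ℂ) where
  toFun w := inl (w o • 1) + inr (Φ.cre (dropCoord o w))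
  map_add' w w' := by
    ext1 <;> simp [add_smul]
  map_smul' c w := by
    ext1 <;> simp [smul_smul]

theorem Fock.fst_jet (o : K) (w : K → ℂ) : (Φ.jet o w).fst = w o • 1 := by
  simp [jet]

theorem Fock.snd_jet (o : K) (w : K → ℂ) : (Φ.jet o w).snd = Φ.cre (dropCoord o w) := by
  simp [jet]

/-- Values are scalars and no product of two differentials occurs to first order, so the
anticommutativity of the `θ` is not seen. -/
theorem Fock.jet_comm (o : K) (w w' : K → ℂ) :
    Φ.jet o w * Φ.jet o w' = Φ.jet o w' * Φ.jet o w := by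
  ext1
  · simp [fst_jet, smul_smul, mul_comm]
  · simp [fst_jet, snd_jet, add_comm]

theorem Fock.inl_S_mul_jet (o : K) (s : K → ℂ) (c : ℂ) (w : K → ℂ) (h : ∀ k, w k ≠ 0 → s k = c)
    (ho : s o = 1) : inl (Φ.S s) * Φ.jet o w = c • (Φ.jet o w * inl (Φ.S s)) := by
  ext1
  · by_cases hw : w o = 0
    · simp [fst_jet, hw]
    · have : c = 1 := (h o hw).symm.trans ho
      simp [fst_jet, this]
  · have := Φ.S_cre s c (dropCoord o w) (fun k hk => h k (by
      rw [dropCoord_apply] at hk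
      split_ifs at hk
      · exact absurd rfl hk
      · exact hk))
    simp [fst_jet, snd_jet, this]

/-- The jets twisted by the second quantized phases. -/
def Fock.twistedJet (o : K) (W : Matrix K K ℂ) (τ : K → K → ℂ) (k : K) :
    TrivSqZeroExt (Matrix κ κ ℂ) (Matrix κ κ ℂ) := Φ.jet o (W k) * inl (Φ.S (τ k))

variable {o : K} {W : Matrix K K ℂ} {τ : K → K → ℂ}

theorem Fock.twistedJet_mul (hW : ∀ k l m, W l m ≠ 0 → τ k m = τ k l) (ho : ∀ k, τ k o = 1)
    (k l : K) : Φ.twistedJet o W τ k * Φ.twistedJet o W τ l =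
      τ k l • (Φ.jet o (W k) * Φ.jet o (W l) * inl (Φ.S (τ k * τ l))) := by
  rw [twistedJet, twistedJet, mul_assoc, ← mul_assoc (inl (Φ.S (τ k))),
    Φ.inl_S_mul_jet o (τ k) (τ k l) (W l) (fun m hm => hW k l m hm) (ho k), smul_mul_assoc,
    mul_smul_comm, map_mul, inl_mul]
  simp only [mul_assoc]

theorem Fock.twistedJet_exch (hτ : ∀ k l, τ k l * star (τ k l) = 1)
    (hW : ∀ k l m, W l m ≠ 0 → τ k m = τ k l) (ho : ∀ k, τ k o = 1) (k l : K) :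
    Φ.twistedJet o W τ k * Φ.twistedJet o W τ l =
      (τ k l * star (τ l k)) • (Φ.twistedJet o W τ l * Φ.twistedJet o W τ k) := by
  rw [Φ.twistedJet_mul hW ho, Φ.twistedJet_mul hW ho, smul_smul, Φ.jet_comm, mul_comm (τ k) (τ l)]
  congr 1
  rw [mul_assoc, mul_comm (star _), hτ, mul_one]

/-- The squares of the jets of the coordinates sum to one. -/
theorem Fock.sum_twistedJet_sq {U : Matrix K K ℂ} (hT : Twist U τ)
    (hW : ∀ k l m, W l m ≠ 0 → τ k m = τ k l) (ho : ∀ k, τ k o = 1)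
    (h₁ : ∀ c, (∑ k, star (U k c) • W k) = Pi.single c 1 ∨ (∑ k, star (U k c) • W k) o = 0)
    (h₂ : (∑ k, star (U k o) • W k) = Pi.single o 1) :
    ∑ c, (∑ k, star (U k c) • Φ.twistedJet o W τ k) * (∑ k, star (U k c) • Φ.twistedJet o W τ k) =
      1 := by
  have e1 : ∀ c, (∑ k, star (U k c) • Φ.twistedJet o W τ k) *
      (∑ k, star (U k c) • Φ.twistedJet o W τ k) =
      ∑ k, ∑ l, (star (U k c) * star (U l c)) •
        (Φ.twistedJet o W τ k * Φ.twistedJet o W τ l) := by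
    intro c
    simp only [Finset.sum_mul, Finset.mul_sum, smul_mul_smul_comm]
    rw [Finset.sum_comm]
  have e2 : ∀ c, Φ.jet o (∑ k, star (U k c) • W k) * Φ.jet o (∑ k, star (U k c) • W k) =
      ∑ k, ∑ l, (star (U k c) * star (U l c)) • (Φ.jet o (W k) * Φ.jet o (W l)) := by
    intro c
    simp only [map_sum, map_smul, Finset.sum_mul, Finset.mul_sum, smul_mul_smul_comm]
    rw [Finset.sum_comm]
  have e3 : ∀ Q : K → K → TrivSqZeroExt (Matrix κ κ ℂ) (Matrix κ κ ℂ),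
      ∑ c, ∑ k, ∑ l, (star (U k c) * star (U l c)) • Q k l =
        ∑ k, ∑ l, star ((U * Uᵀ) k l) • Q k l := by
    intro Q
    rw [Finset.sum_comm]
    refine Finset.sum_congr rfl fun k _ => ?_
    rw [Finset.sum_comm]
    refine Finset.sum_congr rfl fun l _ => ?_
    rw [← Finset.sum_smul, Matrix.mul_apply, star_sum]
    simp only [star_mul', transpose_apply]
  -- Untwisted, only the coordinate `o` has a nonzero value, namely 1, and its differential is zero;
  -- all other squares vanish to first order.
  have e4 : ∑ c, Φ.jet o (∑ k, star (U k c) • W k) * Φ.jet o (∑ k, star (U k c) • W k) = 1 := by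
    rw [Finset.sum_eq_single o]
    · rw [h₂]
      have : dropCoord o (Pi.single o 1) = 0 := by
        funext k
        rw [dropCoord_apply]
        split_ifs with h <;> simp [h]
      ext1
      · simp [fst_jet]
      · simp [fst_jet, snd_jet, this]
    · intro c _ hc
      have h0 : (∑ k, star (U k c) • W k) o = 0 := by
        rcases h₁ c with h | h
        · rw [h]
          simp [hc.symm]
        · exact h
      ext1
      · simp only [fst_mul, fst_jet, h0, zero_smul, mul_zero, fst_zero]
      · simp only [snd_mul, fst_jet, h0, zero_smul, MulOpposite.op_zero, add_zero, snd_zero]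
    · simp
  rw [← e4]
  simp only [e1, e2]
  rw [e3, e3]
  refine Finset.sum_congr rfl fun k _ => Finset.sum_congr rfl fun l _ => ?_
  -- The twists drop out of every product that occurs in the quadratic relation.
  by_cases hc : (U * Uᵀ) k l = 0
  · simp [hc]
  · have h3 : τ k * τ l = 1 := funext fun m => hT.compatL _ _ hc m
    have h4 : τ k l = 1 := by
      have := hT.compatR _ _ hc k
      rwa [hT.diag, one_mul] at this
    rw [Φ.twistedJet_mul hW ho, h3, h4, map_one, inl_one, mul_one, one_smul]

end Representation

/-! ### Pairing the top chain with the jet cocycle. -/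

section Pairing

open Matrix

variable {K κ : Type*} [Fintype K] [DecidableEq K] [Fintype κ] [DecidableEq κ] (Φ : Fock K κ)
  {U W : Matrix K K ℂ} {τ : K → K → ℂ} {n : ℕ} (e : Fin (n + 1) ≃ K) (o : K)

/-- The top product of creation operators. -/
def Fock.vol : Matrix κ κ ℂ := (List.ofFn fun i => Φ.θ (e i)).prod

/-- The pairing with the normal covector at the coordinate point `o`. -/
def Fock.normalTrace : Matrix κ κ ℂ →ₗ[ℂ] ℂ :=
  (Matrix.traceLinearMap κ ℂ ℂ) ∘ₗ LinearMap.mulLeft ℂ (star (Φ.vol e) * Φ.θ o)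

theorem Fock.normalTrace_apply (X : Matrix κ κ ℂ) :
    Φ.normalTrace e o X = Matrix.trace (star (Φ.vol e) * Φ.θ o * X) := rfl

theorem Fock.S_mul_vol (s : K → ℂ) (hs : ∏ k, s k = 1) : Φ.S s * Φ.vol e = Φ.vol e * Φ.S s := by
  rw [vol, mul_prod_ofFn _ _ (fun i => s (e i)) (fun i => Φ.S_θ _ _), Equiv.prod_comp e s, hs,
    one_smul]

/-- The volume element scales by the product of the phases and $\theta_o$ by the phase at `o`, both
equal to 1. -/
theorem Fock.normalTrace_S_comm (s : K → ℂ) (hs : ∏ k, s k = 1) (ho : s o = 1) :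
    Φ.S s * (star (Φ.vol e) * Φ.θ o) = star (Φ.vol e) * Φ.θ o * Φ.S s := by
  have h1 := congrArg star (Φ.S_mul_vol e (star s) (by
    rw [show ∏ k, (star s) k = star (∏ k, s k) from (star_prod _ _).symm, hs, star_one]))
  rw [star_mul, star_mul, Φ.star_S, star_star] at h1
  rw [← mul_assoc, ← h1, mul_assoc, Φ.S_θ, ho, one_smul, mul_assoc]

/-- The letters of the words evaluating the cocycle of the jets. -/
def Fock.jetLetter (j : Fin (n + 1)) : (K → ℂ) →ₗ[ℂ] Matrix κ κ ℂ :=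
  if j = 0 then (LinearMap.proj o : (K → ℂ) →ₗ[ℂ] ℂ).smulRight 1 else Φ.cre ∘ₗ dropCoord o

theorem Fock.jetLetter_zero (w : K → ℂ) : Φ.jetLetter (n := n) o 0 w = w o • 1 := by
  simp [jetLetter]

theorem Fock.jetLetter_ne_zero {j : Fin (n + 1)} (hj : j ≠ 0) (w : K → ℂ) :
    Φ.jetLetter o j w = Φ.cre (dropCoord o w) := by
  simp [jetLetter, hj]

/-- The form of top degree at the coordinate point `o`. -/
def Fock.jetForm : MultilinearMap ℂ (fun _ : Fin (n + 1) => K → ℂ) ℂ :=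
  (Φ.normalTrace e o).compMultilinearMap
    ((MultilinearMap.mkPiAlgebraFin ℂ (n + 1) (Matrix κ κ ℂ)).compLinearMap (Φ.jetLetter o))

theorem Fock.jetForm_apply (w : Fin (n + 1) → K → ℂ) :
    Φ.jetForm e o w = Φ.normalTrace e o (List.ofFn fun j => Φ.jetLetter o j (w j)).prod := by
  simp [jetForm, MultilinearMap.mkPiAlgebraFin_apply]

/-- Only `o` has a nonzero value at the point. When it comes first, the factor $\theta_o$ of
`normalTrace` completes the remaining differentials to the volume element, up to the sign of `σ`. -/
theorem Fock.jetForm_basis (σ : Equiv.Perm (Fin (n + 1))) :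
    Φ.jetForm e o (fun i => Pi.single (e (σ i)) 1) =
      if e (σ 0) = o then
        (Equiv.Perm.sign σ : ℂ) * Matrix.trace (star (Φ.vol e) * Φ.vol e) else 0 := by
  rw [jetForm_apply, normalTrace_apply, List.ofFn_succ, List.prod_cons, jetLetter_zero]
  split_ifs with h
  · have h1 : ∀ j : Fin n, Φ.jetLetter o j.succ (Pi.single (e (σ j.succ)) 1) =
        Φ.θ (e (σ j.succ)) := by
      intro j
      rw [Φ.jetLetter_ne_zero o (Fin.succ_ne_zero j), cre_apply]
      have h2 : ∀ k, dropCoord o (Pi.single (e (σ j.succ)) (1 : ℂ)) k =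
          if k = e (σ j.succ) then 1 else 0 := by
        intro k
        rw [dropCoord_apply, Pi.single_apply]
        split_ifs with h3 h4
        · rw [h4, ← h] at h3
          exact absurd (σ.injective (e.injective h3)) (Fin.succ_ne_zero j)
        all_goals rfl
      simp [h2]
    simp only [h1]
    have h2 := prod_ofFn_perm (fun i => Φ.θ (e i))
      (fun i j _ => eq_neg_of_add_eq_zero_left (Φ.anti _ _)) σ
    rw [List.ofFn_succ, List.prod_cons] at h2
    simp only [Function.comp_apply, h] at h2
    rw [h, Pi.single_eq_same, one_smul, one_mul, mul_assoc, h2, Units.smul_def,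
      ← Int.cast_smul_eq_zsmul ℂ, mul_smul_comm, Matrix.trace_smul, smul_eq_mul]
    rfl
  · rw [Pi.single_eq_of_ne (Ne.symm h), zero_smul, zero_mul, mul_zero, Matrix.trace_zero]

open ComplexOrder in
-- The signs square to one, so every permutation sending 0 to `o` contributes the same nonzero
-- trace.
theorem Fock.alternatization_jetForm_ne_zero (hΦ : Φ.vol e ≠ 0) :
    MultilinearMap.alternatization (Φ.jetForm e o) ≠ 0 := by
  intro h0
  have h1 := congrArg (fun f => f fun i => Pi.single (e i) 1) h0
  simp only [MultilinearMap.alternatization_apply, MultilinearMap.domDomCongr_apply,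
    AlternatingMap.zero_apply] at h1
  have h2 : ∀ σ : Equiv.Perm (Fin (n + 1)), Equiv.Perm.sign σ •
      Φ.jetForm e o (fun i => Pi.single (e (σ i)) 1) =
      (if e (σ 0) = o then 1 else 0) * Matrix.trace (star (Φ.vol e) * Φ.vol e) := by
    intro σ
    rw [jetForm_basis]
    split_ifs
    · rw [Units.smul_def, ← Int.cast_smul_eq_zsmul ℂ, smul_eq_mul, ← mul_assoc, ← Int.cast_mul,
        ← Units.val_mul, Int.units_mul_self]
      simp
    · simp
  simp only [h2] at h1
  rw [← Finset.sum_mul, Finset.sum_boole] at h1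
  rcases mul_eq_zero.mp h1 with h3 | h3
  · rw [Nat.cast_eq_zero, Finset.card_eq_zero] at h3
    have : Equiv.swap 0 (e.symm o) ∈
        Finset.univ.filter (fun σ : Equiv.Perm (Fin (n + 1)) => e (σ 0) = o) := by
      simp
    rw [h3] at this
    simp at this
  · exact hΦ (Matrix.trace_conjTranspose_mul_self_eq_zero_iff.mp h3)

/-- Contraction of an alternating with a multilinear form over all tuples of rows. -/
theorem sum_rows_mul (f : (K → ℂ) [⋀^Fin (n + 1)]→ₗ[ℂ] ℂ)
    (g : MultilinearMap ℂ (fun _ : Fin (n + 1) => K → ℂ) ℂ) (V W : Matrix K K ℂ) :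
    ∑ k : Fin (n + 1) → K, f (fun i => V (k i)) * g (fun i => W (k i)) =
      f (fun i => V (e i)) * MultilinearMap.alternatization g (fun i => W (e i)) := by
  symm
  rw [MultilinearMap.alternatization_apply, Finset.mul_sum]
  refine Finset.sum_of_injOn (fun σ : Equiv.Perm (Fin (n + 1)) => fun i => e (σ i)) ?_ ?_ ?_ ?_
  · intro σ _ σ' _ hσ
    ext i
    have := congrFun hσ i
    simp only [EmbeddingLike.apply_eq_iff_eq] at this
    rw [this]
  · exact fun _ _ => Finset.mem_coe.mpr (Finset.mem_univ _)
  · intro k _ hk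
    have h1 : ¬Function.Injective k := by
      intro hinj
      apply hk
      have h2 : Function.Injective (e.symm ∘ k) := e.symm.injective.comp hinj
      refine ⟨Equiv.ofBijective _ (Finite.injective_iff_bijective.mp h2),
        Finset.mem_coe.mpr (Finset.mem_univ _), ?_⟩
      funext i
      simp
    rw [f.map_eq_zero_of_not_injective _ (fun h2 => h1 fun i j hij => h2 (congrArg V hij)),
      zero_mul]
  · intro σ _
    have h1 : f (fun i => V (e (σ i))) = Equiv.Perm.sign σ • f (fun i => V (e i)) :=
      f.map_perm (fun i => V (e i)) σ
    rw [h1, MultilinearMap.domDomCongr_apply, smul_mul_assoc, mul_smul_comm]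

variable {A : Type*} [Ring A] [Algebra ℂ A] {ρ : A →ₐ[ℂ] Matrix κ κ ℂ}
  {δ : A →ₗ[ℂ] Matrix κ κ ℂ} (hδ : ∀ a c, δ (a * c) = ρ a * δ c + δ a * ρ c) {ζ : K → A}

theorem wordPhase_mul (h : ∀ k l, τ k l * star (τ k l) = 1) {r : ℕ} (k : Fin r → K) :
    wordPhase (fun a b => star (τ a b)) k * wordPhase τ k = 1 := by
  rw [wordPhase, wordPhase, ← Finset.prod_mul_distrib]
  refine Finset.prod_eq_one fun i _ => ?_
  rw [← Finset.prod_mul_distrib]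
  refine Finset.prod_eq_one fun j _ => ?_
  split_ifs
  · rw [mul_comm, h]
  · rw [mul_one]

/-- Collecting the twists at the end costs the word phase, and the total twist is trivial by `hk`.
-/
theorem Fock.derCocycle_word (hW : ∀ k l m, W l m ≠ 0 → τ k m = τ k l)
    (hρ : ∀ k, ρ (ζ k) = W k o • Φ.S (τ k))
    (hδζ : ∀ k, δ (ζ k) = Φ.cre (dropCoord o (W k)) * Φ.S (τ k)) (k : Fin (n + 1) → K)
    (hk : ∏ i, τ (k i) = 1) :
    derCocycle (Φ.normalTrace e o) hδ n (chainMk A n (fun i => ζ (k i))) =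
      wordPhase τ k * Φ.jetForm e o (fun i => W (k i)) := by
  rw [derCocycle_chainMk]
  have h1 : ρ (ζ (k 0)) * derWord δ (fun i : Fin n => ζ (k i.succ)) =
      (List.ofFn fun j => Φ.jetLetter o j (W (k j)) * Φ.S (τ (k j))).prod := by
    rw [List.ofFn_succ, List.prod_cons, jetLetter_zero, hρ, derWord]
    simp only [smul_mul_assoc, one_mul, hδζ, Φ.jetLetter_ne_zero o (Fin.succ_ne_zero _)]
  rw [h1, prod_ofFn_mul Φ.S _ (fun i => τ (k i)) (fun i j => τ (k i) (k j)), hk, map_one, mul_one,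
    map_smul, smul_eq_mul, jetForm_apply]
  · rfl
  · intro i j hij
    rw [Φ.jetLetter_ne_zero o (Fin.ne_zero_of_lt hij)]
    refine Φ.S_cre _ _ _ fun m hm => hW _ _ _ fun h0 => hm ?_
    rw [dropCoord_apply, h0, ite_self]

/-- The word phases of chain and cocycle are mutually inverse. The untwisted sum factors by
`sum_rows_mul` into two nonzero top-degree forms, each evaluated on a basis. -/
theorem Fock.derCocycle_topChain_ne_zero (hΦ : Φ.vol e ≠ 0) (h : Twist U τ) {W' : Matrix K K ℂ}
    (hWW : W * W' = 1) (hW : ∀ k l m, W l m ≠ 0 → τ k m = τ k l)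
    (hρ : ∀ k, ρ (ζ k) = W k o • Φ.S (τ k))
    (hδζ : ∀ k, δ (ζ k) = Φ.cre (dropCoord o (W k)) * Φ.S (τ k)) :
    derCocycle (Φ.normalTrace e o) hδ n (Φ.topChain e U τ ζ n) ≠ 0 := by
  have : Nonempty κ := by
    by_contra hκ
    rw [not_nonempty_iff] at hκ
    exact hΦ (Subsingleton.elim _ _)
  have h1 : ∀ k : Fin (n + 1) → K, Φ.twTrace e U τ k *
      derCocycle (Φ.normalTrace e o) hδ n (chainMk A n (fun i => ζ (k i))) =
      Φ.topForm e h.unitary (fun i => (U.map star) (k i)) *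
        Φ.jetForm e o (fun i => W (k i)) := by
    intro k
    by_cases hk : ∏ i, τ (k i) = 1
    · rw [Φ.twTrace_top e h k hk, Φ.derCocycle_word e o hδ hW hρ hδζ k hk]
      linear_combination (Φ.topForm e h.unitary (fun i => (U.map star) (k i)) *
        Φ.jetForm e o (fun i => W (k i))) * wordPhase_mul h.norm k
    · obtain ⟨h2, h3⟩ := Φ.twTrace_top_of_ne e h k hk
      rw [h2, h3, zero_mul, zero_mul]
  simp only [topChain, map_sum, map_smul, smul_eq_mul, h1]
  rw [sum_rows_mul e]
  exact mul_ne_zero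
    (alternating_rows_ne_zero e _ (Φ.topForm_ne_zero e h.unitary) _ _
      (map_star_mul_transpose h.unitary))
    (alternating_rows_ne_zero e _ (Φ.alternatization_jetForm_ne_zero e o hΦ) _ _ hWW)

end Pairing

/-! ### The volume class and the final assembly. -/

section VolumeClass

open Matrix TrivSqZeroExt

variable {N₁ N₂ : ℕ} {R : RMatrix N₁ N₂} {u : Matrix (Fin N₁) (Fin N₁) ℂ}
  {v : Matrix (Fin N₂) (Fin N₂) ℂ} {t : Fin N₁ → Fin N₂ → ℂ} {κ : Type*} [Fintype κ]
  [DecidableEq κ] (Φ : Fock (Fin N₁ ⊕ Fin N₂) κ)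

theorem phases_compat (k l m : Fin N₁ ⊕ Fin N₂)
    (h : (fromBlocks u 0 0 1 : Matrix (Fin N₁ ⊕ Fin N₂) (Fin N₁ ⊕ Fin N₂) ℂ) l m ≠ 0) :
    phases t k m = phases t k l := by
  rcases l with i | j <;> rcases m with i' | j'
  · rcases k with k | k <;> rfl
  · simp at h
  · simp at h
  · have : j = j' := by
      by_contra hne
      simp [Matrix.one_apply, hne] at h
    rw [this]

theorem phases_inl (k : Fin N₁ ⊕ Fin N₂) (o : Fin N₁) : phases t k (Sum.inl o) = 1 := by
  rcases k with k | k <;> rfl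

/-- The point jet of the sphere, as a representation on dual numbers. -/
theorem Fock.exists_jet_hom (hR : Admissible R) (h : Diagonalizes R u v t)
    (hT : Twist (fromBlocks u 0 0 v) (phases t)) (o : Fin N₁) :
    ∃ Ψ : Sphere R →ₐ[ℂ] TrivSqZeroExt (Matrix κ κ ℂ) (Matrix κ κ ℂ),
      ∀ k, Ψ (diagCoord R u v k) =
        Φ.twistedJet (Sum.inl o) (fromBlocks u 0 0 1) (phases t) k := by
  -- The base point is a coordinate point of the first factor, where all second-index phases are 1,
  -- so any block is allowed there. In the second factor each diagonal coordinate must carry a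
  -- single phase, hence the identity block.
  set W : Matrix (Fin N₁ ⊕ Fin N₂) (Fin N₁ ⊕ Fin N₂) ℂ := fromBlocks u 0 0 1 with hW
  set z := Φ.twistedJet (Sum.inl o) W (phases t) with hz
  have hc : ∀ k l m, W l m ≠ 0 → phases t k m = phases t k l := phases_compat
  have ho : ∀ k, phases t k (Sum.inl o) = 1 := fun k => phases_inl k o
  have hexch := Φ.twistedJet_exch hT.norm hc ho
  have hE : Exchange R (fun l => ∑ i, star (u i l) • z (Sum.inl i))
      (fun a => ∑ j, star (v j a) • z (Sum.inr j)) := by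
    refine h.exchange (fun i j => ?_) (fun i j => ?_) (fun i j => ?_)
    · refine (hexch _ _).trans ?_
      simp [phases]
      rfl
    · refine (hexch _ _).trans ?_
      simp [phases]
      rfl
    · refine (hexch _ _).trans ?_
      simp [phases]
      rfl
  have hX : ∀ c, ∑ k, star ((fromBlocks u 0 0 v :
      Matrix (Fin N₁ ⊕ Fin N₂) (Fin N₁ ⊕ Fin N₂) ℂ) k c) • z k =
      Sum.elim (fun l => ∑ i, star (u i l) • z (Sum.inl i))
        (fun a => ∑ j, star (v j a) • z (Sum.inr j)) c := by
    intro c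
    rcases c with l | a <;> simp [Fintype.sum_sum_type]
  have hw : ∀ l : Fin N₁, ∑ k, star ((fromBlocks u 0 0 v :
      Matrix (Fin N₁ ⊕ Fin N₂) (Fin N₁ ⊕ Fin N₂) ℂ) k (Sum.inl l)) • W k =
        Pi.single (Sum.inl l) 1 := by
    intro l
    funext m
    rw [Finset.sum_apply, Fintype.sum_sum_type]
    simp only [Pi.smul_apply, smul_eq_mul, hW]
    rcases m with m | m
    · simp only [fromBlocks_apply₁₁, fromBlocks_apply₂₁, Matrix.zero_apply, mul_zero,
        Finset.sum_const_zero, add_zero, sum_star_mul h.unitary₁, Pi.single_apply,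
        Sum.inl.injEq, eq_comm]
    · simp
  have h1 : ∑ l, (∑ i, star (u i l) • z (Sum.inl i)) ^ 2 +
      ∑ a, (∑ j, star (v j a) • z (Sum.inr j)) ^ 2 = 1 := by
    have h2 := Φ.sum_twistedJet_sq hT (W := W) (o := Sum.inl o) hc ho (fun c => by
      rcases c with l | a
      · exact Or.inl (hw l)
      · right
        rw [Finset.sum_apply, Fintype.sum_sum_type]
        simp [hW]) (hw o)
    simp only [← hz, hX] at h2
    rw [Fintype.sum_sum_type] at h2
    simpa only [sq, Sum.elim_inl, Sum.elim_inr] using h2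
  refine ⟨sphLift hR hE h1, fun k => ?_⟩
  rw [diagCoord, map_sum]
  simp only [map_smul, sphLift_coord, ← hX]
  exact sum_conj_combination hT.unitary z k

/-- The two components of a homomorphism into dual numbers are a representation and a derivation
along it. -/
theorem Fock.exists_derivation (hR : Admissible R) (h : Diagonalizes R u v t)
    (hT : Twist (fromBlocks u 0 0 v) (phases t)) (o : Fin N₁) :
    ∃ (ρ : Sphere R →ₐ[ℂ] Matrix κ κ ℂ) (δ : Sphere R →ₗ[ℂ] Matrix κ κ ℂ),
      (∀ a c, δ (a * c) = ρ a * δ c + δ a * ρ c) ∧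
      (∀ k, ρ (diagCoord R u v k) = (fromBlocks u 0 0 1 :
        Matrix (Fin N₁ ⊕ Fin N₂) (Fin N₁ ⊕ Fin N₂) ℂ) k (Sum.inl o) • Φ.S (phases t k)) ∧
      ∀ k, δ (diagCoord R u v k) = Φ.cre (dropCoord (Sum.inl o) ((fromBlocks u 0 0 1 :
        Matrix (Fin N₁ ⊕ Fin N₂) (Fin N₁ ⊕ Fin N₂) ℂ) k)) * Φ.S (phases t k) := by
  obtain ⟨Ψ, hΨ⟩ := Φ.exists_jet_hom hR h hT o
  refine ⟨(fstHom ℂ _ _).comp Ψ,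
    { toFun := fun a => (Ψ a).snd
      map_add' := fun a c => by rw [map_add, snd_add]
      map_smul' := fun c a => by rw [map_smul, snd_smul]; rfl }, fun a c => ?_, fun k => ?_,
    fun k => ?_⟩
  · simp
  · simp [hΨ, twistedJet, fst_jet]
  · simp [hΨ, twistedJet, fst_jet, snd_jet]

theorem coord_eq_sum_diagCoord (hT : Twist (fromBlocks u 0 0 v) (phases t))
    (c : Fin N₁ ⊕ Fin N₂) : coord R c = ∑ k, star ((fromBlocks u 0 0 v :
      Matrix (Fin N₁ ⊕ Fin N₂) (Fin N₁ ⊕ Fin N₂) ℂ) k c) • diagCoord R u v k :=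
  (sum_combination hT.unitary (coord R) c).symm

theorem sphere_induction (S : Subalgebra ℂ (Sphere R)) (h : ∀ c, coord R c ∈ S) (a : Sphere R) :
    a ∈ S := by
  obtain ⟨b, rfl⟩ := sphMk_surjective R a
  exact algR_induction (S.comap (sphMk R)) (fun l => h (Sum.inl l)) (fun a => h (Sum.inr a)) b

/-- The image of `ρ` is generated by multiples of the operators `S (phases t k)`, which commute with
$\mathrm{vol}^*\theta_o$. This gives the trace property that makes the functional vanish on
boundaries. -/
theorem Fock.topChain_notMem_range (hR : Admissible R) (h : Diagonalizes R u v t)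
    (hT : Twist (fromBlocks u 0 0 v) (phases t)) (hN : 0 < N₁) {n : ℕ}
    (e : Fin (n + 1) ≃ Fin N₁ ⊕ Fin N₂) (hΦ : Φ.vol e ≠ 0) :
    Φ.topChain e (fromBlocks u 0 0 v) (phases t) (diagCoord R u v) n ∉
      LinearMap.range (b (Sphere R) n) := by
  set o : Fin N₁ := ⟨0, hN⟩
  obtain ⟨ρ, δ, hδ, h1, h2⟩ := Φ.exists_derivation hR h hT o
  have hcent : ∀ a, ρ a * (star (Φ.vol e) * Φ.θ (Sum.inl o)) =
      star (Φ.vol e) * Φ.θ (Sum.inl o) * ρ a := by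
    intro a
    have := sphere_induction ((Subalgebra.centralizer ℂ
      {star (Φ.vol e) * Φ.θ (Sum.inl o)}).comap ρ) (fun c => by
        rw [coord_eq_sum_diagCoord hT]
        refine Subalgebra.sum_mem _ fun k _ => Subalgebra.smul_mem _ ?_ _
        rw [Subalgebra.mem_comap, Subalgebra.mem_centralizer_iff]
        rintro _ rfl
        rw [h1, mul_smul_comm, smul_mul_assoc,
          Φ.normalTrace_S_comm e _ _ (hT.detR k) (phases_inl k o)]) a
    rw [Subalgebra.mem_comap, Subalgebra.mem_centralizer_iff] at this
    exact (this _ rfl).symm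
  have hℓ : ∀ a X, Φ.normalTrace e (Sum.inl o) (ρ a * X) =
      Φ.normalTrace e (Sum.inl o) (X * ρ a) := by
    intro a X
    rw [normalTrace_apply, normalTrace_apply, ← mul_assoc, ← hcent, mul_assoc,
      Matrix.trace_mul_comm, mul_assoc]
  have hWW : (fromBlocks u 0 0 1 : Matrix (Fin N₁ ⊕ Fin N₂) (Fin N₁ ⊕ Fin N₂) ℂ) *
      fromBlocks uᴴ 0 0 1 = 1 := by
    rw [fromBlocks_multiply]
    simp [h.unitary₁]
  intro hmem
  exact Φ.derCocycle_topChain_ne_zero e (Sum.inl o) hδ hΦ hT hWW phases_compat h1 h2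
    (derCocycle_eq_zero_of_mem_range _ hδ hℓ n _ hmem)

theorem isSphericalManifoldWithVolumeClass (hN₁ : 0 < N₁) (hR : Admissible R)
    (hmem : R ∈ connectedComponentIn {Q : RMatrix N₁ N₂ | Admissible Q} (classicalR N₁ N₂)) :
    IsSphericalManifoldWithVolumeClass (Sphere R) (N₁ + N₂ - 1) := by
  obtain ⟨u, v, t, h⟩ := exists_diagonalizes hR
  obtain ⟨h1, h2⟩ := det_eq_one_of_mem_connectedComponentIn hmem h
  have hT := h.twist hR h1 h2
  have hx := h.twistedCoords hT
  obtain ⟨n, hn⟩ : ∃ n, n + 1 = N₁ + N₂ := ⟨N₁ + N₂ - 1, by omega⟩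
  rw [← hn, Nat.add_sub_cancel]
  let e : Fin (n + 1) ≃ Fin N₁ ⊕ Fin N₂ := (finCongr hn).trans finSumFinEquiv.symm
  obtain ⟨κ, _, _, Φ, hΦ⟩ := exists_fock e
  have hvol := Φ.topChain_notMem_range hR h hT hN₁ e hΦ
  rcases Nat.even_or_odd' n with ⟨m, hm | hm⟩
  · obtain ⟨F, hF, hF'⟩ := Φ.exists_even e hT hx ⟨m, by omega⟩
    have hc : F m ∉ LinearMap.range (b (Sphere R) (2 * m)) := by
      subst hm
      rw [hF', Submodule.smul_mem_iff _ (pow_ne_zero _ (by norm_num))]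
      exact hvol
    obtain ⟨q, p, hp, hp'⟩ := exists_sphericalProjection (coord R) star_coord sum_coord_sq
      adjoin_coord F hF m (fun k hk => by
        rw [hF', Φ.topChain_eq_zero e hT (by omega) ⟨k + m, by omega⟩, smul_zero])
      (fun h0 => hc (h0 ▸ Submodule.zero_mem _))
    exact Or.inl ⟨m, q, p, hm, hp, hp' ▸ hc⟩
  · obtain ⟨F, hF, hF'⟩ := Φ.exists_odd e hT hx ⟨m, hm⟩
    have hc : F m ∉ LinearMap.range (b (Sphere R) (2 * m + 1)) := by
      subst hm
      rw [hF', Submodule.smul_mem_iff _ two_ne_zero]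
      exact hvol
    obtain ⟨q, p, hp, hp'⟩ := exists_sphericalUnitary (coord R) star_coord sum_coord_sq
      adjoin_coord F hF m (fun k hk => by
        rw [hF', Φ.topChain_eq_zero e hT (by omega) ⟨k + m + 1, by omega⟩, smul_zero])
      (fun h0 => hc (h0 ▸ Submodule.zero_mem _))
    exact Or.inr ⟨m, q, p, hm, hp, hp' ▸ hc⟩

theorem IsSphericalManifoldWithVolumeClass.isSphericalManifold {A : Type*} [Ring A] [StarRing A]
    [Algebra ℂ A] [StarModule ℂ A] {d : ℕ} (h : IsSphericalManifoldWithVolumeClass A d) :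
    IsSphericalManifold A d := by
  rcases h with ⟨m, q, e, hd, he, -⟩ | ⟨m, q, e, hd, he, -⟩
  · exact Or.inl ⟨m, q, e, hd, he⟩
  · exact Or.inr ⟨m, q, e, hd, he⟩

theorem isSphericalManifold_sphere (hN₁ : 0 < N₁) (hN₂ : 0 < N₂) (hR : Admissible R) :
    IsSphericalManifold (Sphere R) (N₁ + N₂ - 1) := by
  by_cases hN : 3 ≤ N₁ + N₂
  · exact isSphericalManifold_of_three_le hN₁ hN₂ hN hR
  · obtain rfl : N₁ = 1 := by omega
    obtain rfl : N₂ = 1 := by omega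
    -- The finite-difference argument needs `1 ≤ m`, so the two circles are treated separately; the
    -- classical matrix lies in its own component.
    rcases eq_classicalR_or R hR with rfl | h
    · exact (isSphericalManifoldWithVolumeClass hN₁ hR
        (mem_connectedComponentIn hR)).isSphericalManifold
    · exact isSphericalManifold_circle hR h

end VolumeClass

end NCSphere

end

theorem mainTheorem3 (N₁ N₂ : ℕ) (hN₁ : 0 < N₁) (hN₂ : 0 < N₂) (R : NCSphere.RMatrix N₁ N₂)
    (hR : NCSphere.Admissible R) :
    (∀ u : NCSphere.AlgR R, Commute (NCSphere.normSq R) u) ∧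
    NCSphere.IsSphericalManifold (NCSphere.Sphere R) (N₁ + N₂ - 1) ∧
    (R ∈ connectedComponentIn {Q : NCSphere.RMatrix N₁ N₂ | NCSphere.Admissible Q}
        (NCSphere.classicalR N₁ N₂) →
      NCSphere.IsSphericalManifoldWithVolumeClass (NCSphere.Sphere R) (N₁ + N₂ - 1)) := by
  exact ⟨NCSphere.normSq_central hR, NCSphere.isSphericalManifold_sphere hN₁ hN₂ hR,
    NCSphere.isSphericalManifoldWithVolumeClass hN₁ hR⟩
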